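/- Let $[\ell..r]$ be a non-empty interval of integers, possibly with $\ell=-\infty$ and/or $r=+\infty$, and let $(a_i)_{i\in[\ell..r]}\in\{L,R\}^{[\ell..r]}$ and $(b_i)_{i\in[\ell..r]}\in\{+,-\}^{[\ell..r]}$. The rail yard graph $G$ is the bipartite plane graph (edges drawn straight) with vertices $(x,y)$, $y\in\mathbb Z+\frac12$, $x\in\mathbb Z$ with $2\ell-1\le x\le 2r+1$, in which each vertex $(2m,y)$, $m\in[\ell..r]$, is incident to two horizontal edges, to $(2m-1,y)$ and $(2m+1,y)$, and to one diagonal edge, to $(2m-1,y\pm1)$ if $a_m=L$ and to $(2m+1,y\pm 1)$ if $a_m=R$, where $\pm$ is the sign $b_m$. The inner vertices are all those that do not lie on $x=2\ell-1$ or $x=2r+1$. For finite $\ell,r$, an admissible dimer covering of $G$ is a partial matching of $G$ that covers every inner vertex, contains finitely many diagonal edges, and is such that for some integer $N\ge0$: $(2\ell-1,y)$ is covered for $y>N$ and uncovered for $y<-N$, and $(2r+1,y)$ is covered for $y<-N$ and uncovered for $y>N$. It is pure if this holds with $N=0$, and the fundamental covering is the pure one with no diagonal edge. In general, an admissible (resp.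 pure, resp. fundamental) covering is a partial matching that covers every inner vertex and for which there are finite $\ell'\le r'$ in $[\ell..r]$ such that it restricts to an admissible (resp. pure, resp. fundamental) covering of the rail yard graph on $[\ell'..r']$, all its other edges being horizontal. If exactly half of the edges bordering a bounded face of $G$ belong to an admissible covering, the flip of this face replaces them by the other edges bordering the face. The flip distance of two admissible coverings is the minimal number of flips needed to go from one to the other. Assume the finiteness condition: if $\ell=-\infty$, there is $\ell'\in\mathbb Z$ with $b_i=+$ for all $i<\ell'$ in $[\ell..r]$; and if $r=+\infty$, there is $r'\in\mathbb Z$ with $b_i=-$ for all $i>r'$ in $[\ell..r]$. Then every pure covering $C$ is at finite flip distance $d(C)$ from the fundamental covering, and the partition function $Z(G;q)=\sum_{C\text{ pure}} q^{d(C)}$ is a well-defined formal power series in $q$, equal to $$Z(G;q)=\prod_{\substack{\ell\le i<j\le r\\ b_i=+,\ b_j=-}} z_{ij},\qquad z_{ij}=\begin{cases}1+q^{j-i}&\text{if }a_i\ne a_j,\\ (1-q^{j-i})^{-1}&\text{if }a_i=a_j,\end{cases}$$ where the (possibly infinite) product converges as a formal power series. -/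

import Mathlib

open scoped PowerSeries.WithPiTopology

/-- The letters of an LR sequence. -/
inductive LR
  | L
  | R
  deriving DecidableEq

/-- The letters of a sign sequence. -/
inductive Sgn
  | plus
  | minus
  deriving DecidableEq

/-- The shift `+1` or `-1` given by a sign. -/
def Sgn.toInt : Sgn → ℤ
  | .plus => 1
  | .minus => -1

/-- The pair `(x, k)` stands for the vertex with abscissa `x` and ordinate `k + 1/2`; thus the
ordinate is positive iff `0 ≤ k` and negative iff `k < 0`. -/
abbrev RYVertex := ℤ × ℤ

/-- An edge `(α, β)` is given by its even endpoint `α` and its odd endpoint `β`. -/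
abbrev RYEdge := RYVertex × RYVertex

/-- The data of a rail yard graph: two bounds `lo ≤ hi`, possibly infinite, an LR sequence and a
sign sequence. Only the values of `a` and `b` at the integers of `[lo..hi]` matter. -/
structure RailYard where
  lo : WithBot ℤ
  hi : WithTop ℤ
  a : ℤ → LR
  b : ℤ → Sgn
  lo_le_hi : ∃ m : ℤ, lo ≤ (m : WithBot ℤ) ∧ (m : WithTop ℤ) ≤ hi

namespace RailYard

variable (G : RailYard)

/-- The set of integers `[lo..hi]`. -/
def cols : Set ℤ := {m | G.lo ≤ (m : WithBot ℤ) ∧ (m : WithTop ℤ) ≤ G.hi}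

/-- The odd endpoint of the diagonal edge at the even vertex `(2m, k)`. -/
def diagEnd (m k : ℤ) : RYVertex :=
  match G.a m with
  | .L => (2 * m - 1, k + (G.b m).toInt)
  | .R => (2 * m + 1, k + (G.b m).toInt)

/-- The edges incident to the even vertices of abscissa `2m`: for each of them, the left
horizontal edge, the right horizontal edge and the diagonal edge. -/
def columnEdges (m : ℤ) : Set RYEdge :=
  {e | ∃ k : ℤ, e = ((2 * m, k), (2 * m - 1, k)) ∨ e = ((2 * m, k), (2 * m + 1, k)) ∨
    e = ((2 * m, k), G.diagEnd m k)}

/-- The edges of the rail yard graph. -/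
def edges : Set RYEdge := {e | ∃ m ∈ G.cols, e ∈ G.columnEdges m}

/-- The edges in the strip `2l - 1 ≤ x ≤ 2r + 1`. -/
def stripEdges (l r : ℤ) : Set RYEdge := {e | ∃ m ∈ Set.Icc l r, e ∈ G.columnEdges m}

end RailYard

/-- The edge is horizontal (an edge of a rail yard graph is diagonal iff it is not horizontal). -/
def RYEdge.IsHorizontal (e : RYEdge) : Prop := e.1.2 = e.2.2

/-- The vertex `v` is covered by the set of edges `C`. -/
def RYCovers (C : Set RYEdge) (v : RYVertex) : Prop := ∃ e ∈ C, e.1 = v ∨ e.2 = v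

/-- No two distinct edges of `C` share an endpoint. -/
def RYIsMatching (C : Set RYEdge) : Prop :=
  ∀ e ∈ C, ∀ f ∈ C, ∀ v : RYVertex, (e.1 = v ∨ e.2 = v) → (f.1 = v ∨ f.2 = v) → e = f

namespace RailYard

variable (G : RailYard)

/-- `C` is an admissible dimer covering of the finite rail yard graph on `[l..r]` (with the
sequences of `G`) for which the condition on the boundary vertices holds with the integer `N`. -/
structure IsStripCovering (l r : ℤ) (N : ℕ) (C : Set RYEdge) : Prop where
  subset : C ⊆ G.stripEdges l r
  matching : RYIsMatching C
  covers_inner : ∀ x k : ℤ, 2 * l - 1 < x → x < 2 * r + 1 → RYCovers C (x, k)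
  left_covered : ∀ k : ℤ, (N : ℤ) ≤ k → RYCovers C (2 * l - 1, k)
  left_uncovered : ∀ k : ℤ, k < -(N : ℤ) → ¬ RYCovers C (2 * l - 1, k)
  right_covered : ∀ k : ℤ, k < -(N : ℤ) → RYCovers C (2 * r + 1, k)
  right_uncovered : ∀ k : ℤ, (N : ℤ) ≤ k → ¬ RYCovers C (2 * r + 1, k)
  finite_diagonal : {e ∈ C | ¬ e.IsHorizontal}.Finite

/-- `C` is a partial matching of `G` that covers all inner vertices. The latter are the even
vertices and the odd vertices that have a column of even vertices on both sides. -/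
structure IsInnerCovering (C : Set RYEdge) : Prop where
  subset : C ⊆ G.edges
  matching : RYIsMatching C
  covers_even : ∀ m k : ℤ, m ∈ G.cols → RYCovers C (2 * m, k)
  covers_odd : ∀ m k : ℤ, m ∈ G.cols → m + 1 ∈ G.cols → RYCovers C (2 * m + 1, k)

/-- Admissible dimer coverings, for finite or infinite bounds. -/
def IsAdmissible (C : Set RYEdge) : Prop :=
  G.IsInnerCovering C ∧ ∃ l r : ℤ, l ≤ r ∧ l ∈ G.cols ∧ r ∈ G.cols ∧
    (∃ N : ℕ, G.IsStripCovering l r N (C ∩ G.stripEdges l r)) ∧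
    ∀ e ∈ C, e ∉ G.stripEdges l r → e.IsHorizontal

/-- Pure dimer coverings, for finite or infinite bounds. -/
def IsPure (C : Set RYEdge) : Prop :=
  G.IsInnerCovering C ∧ ∃ l r : ℤ, l ≤ r ∧ l ∈ G.cols ∧ r ∈ G.cols ∧
    G.IsStripCovering l r 0 (C ∩ G.stripEdges l r) ∧
    ∀ e ∈ C, e ∉ G.stripEdges l r → e.IsHorizontal

/-- The fundamental dimer covering: the pure one without diagonal edges. -/
def IsFundamental (C : Set RYEdge) : Prop := G.IsPure C ∧ ∀ e ∈ C, e.IsHorizontal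

/-- The part in column `m` of the boundary of the face that contains the open vertical segment
from `(x, k)` to `(x, k + 1)`, where `x` is the odd abscissa `2m + 1` or `2m - 1`. If the diagonal
edges of column `m` are on the side of `x`, the boundary turns back at the even vertex of the
diagonal edge between the levels `k` and `k + 1`. Otherwise it follows the level `k` to the even
vertex `(2m, k)`, passes through the diagonal edge and a horizontal edge on the other side, and
returns from `(2m, k + 1)` along the level `k + 1`. -/
def halfFace (m x k : ℤ) : Finset RYEdge :=
  if (G.diagEnd m k).1 = x then
    match G.b m with
    | .plus => {((2 * m, k), (x, k)), ((2 * m, k), (x, k + 1))}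
    | .minus => {((2 * m, k + 1), (x, k)), ((2 * m, k + 1), (x, k + 1))}
  else
    match G.b m with
    | .plus => {((2 * m, k), (x, k)), ((2 * m, k), (4 * m - x, k + 1)),
        ((2 * m, k + 1), (4 * m - x, k + 1)), ((2 * m, k + 1), (x, k + 1))}
    | .minus => {((2 * m, k), (x, k)), ((2 * m, k), (4 * m - x, k)),
        ((2 * m, k + 1), (4 * m - x, k)), ((2 * m, k + 1), (x, k + 1))}

/-- The edges that border the face containing the open vertical segment from `(2m + 1, k)` to
`(2m + 1, k + 1)`. The inner (that is, bounded) faces of `G` are those with `m` and `m + 1` in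
`[lo..hi]`. -/
def face (m k : ℤ) : Finset RYEdge :=
  G.halfFace m (2 * m + 1) k ∪ G.halfFace (m + 1) (2 * m + 1) k

/-- `C'` is obtained from `C` by the flip of an inner face: exactly half of the edges bordering
the face belong to `C`, and they are replaced by the other ones. -/
def IsFlip (C C' : Set RYEdge) : Prop :=
  ∃ m k : ℤ, m ∈ G.cols ∧ m + 1 ∈ G.cols ∧
    2 * (C ∩ ↑(G.face m k)).ncard = (G.face m k).card ∧
    C' = (C \ ↑(G.face m k)) ∪ (↑(G.face m k) \ C)

theorem face_nonempty (m k : ℤ) : (G.face m k).Nonempty := by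
  refine Finset.Nonempty.inl ?_
  unfold halfFace
  split_ifs <;> cases G.b m <;> simp

theorem IsFlip.symm {G : RailYard} {C C' : Set RYEdge} (h : G.IsFlip C C') : G.IsFlip C' C := by
  obtain ⟨m, k, hm, hm', hc, rfl⟩ := h
  refine ⟨m, k, hm, hm', ?_, ?_⟩
  · have h1 : ((C \ ↑(G.face m k)) ∪ (↑(G.face m k) \ C)) ∩ (↑(G.face m k) : Set RYEdge)
        = ↑(G.face m k) \ (C ∩ ↑(G.face m k)) := by
      ext e; simp only [Set.mem_inter_iff, Set.mem_union, Set.mem_sdiff]; tauto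
    have h2 := Set.ncard_sdiff_add_ncard_of_subset
      (s := C ∩ ↑(G.face m k)) (t := (↑(G.face m k) : Set RYEdge)) Set.inter_subset_right
      (Finset.finite_toSet _)
    rw [Set.ncard_coe_finset] at h2
    rw [h1]; omega
  · ext e; simp only [Set.mem_union, Set.mem_sdiff]; tauto

theorem IsFlip.ne {G : RailYard} {C C' : Set RYEdge} (h : G.IsFlip C C') : C ≠ C' := by
  obtain ⟨m, k, -, -, -, rfl⟩ := h
  intro heq
  obtain ⟨e, he⟩ := G.face_nonempty m k
  have he' : e ∈ (↑(G.face m k) : Set RYEdge) := he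
  have := Set.ext_iff.mp heq e
  simp only [Set.mem_union, Set.mem_sdiff] at this
  tauto

/-- The graph on the sets of edges whose adjacent pairs are the pairs of admissible dimer coverings
that differ by a flip. The flip distance is the distance in this graph. -/
def flipGraph : SimpleGraph (Set RYEdge) where
  Adj C C' := G.IsAdmissible C ∧ G.IsAdmissible C' ∧ G.IsFlip C C'
  symm := ⟨fun _ _ h => ⟨h.2.1, h.1, h.2.2.symm⟩⟩
  loopless := ⟨fun _ h => h.2.2.ne rfl⟩

/-- The finiteness condition on the sign sequence. -/
def FinitenessCondition : Prop :=
  (G.lo = ⊥ → ∃ l' : ℤ, ∀ i ∈ G.cols, i < l' → G.b i = .plus) ∧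
  (G.hi = ⊤ → ∃ r' : ℤ, ∀ i ∈ G.cols, r' < i → G.b i = .minus)

/-- The weight `q ^ d` of the covering `C`, where `d` is the flip distance from `C₀` to `C`. -/
noncomputable def qWeight (C₀ C : Set RYEdge) : PowerSeries ℤ :=
  PowerSeries.X ^ G.flipGraph.dist C₀ C

/-- The partition function of the `q`-RYG dimer model: the sum of the weights `q ^ d` over all pure
dimer coverings, `C₀` being the fundamental one. The sum is taken in the ring of formal power
series with the topology of coefficientwise convergence (the coefficients being discrete). -/
noncomputable def qPartitionFunction (C₀ : Set RYEdge) : PowerSeries ℤ :=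
  ∑' C : {C : Set RYEdge // G.IsPure C}, G.qWeight C₀ C

/-- The index set of the product: the pairs `i < j` in `[lo..hi]` with `b i = +`, `b j = -`. -/
def hooks : Set (ℤ × ℤ) :=
  {p | p.1 ∈ G.cols ∧ p.2 ∈ G.cols ∧ p.1 < p.2 ∧ G.b p.1 = .plus ∧ G.b p.2 = .minus}

/-- The factor `1 + q ^ (j - i)` or `(1 - q ^ (j - i))⁻¹` of the product. -/
noncomputable def hookFactor (i j : ℤ) : PowerSeries ℤ :=
  if G.a i ≠ G.a j then 1 + PowerSeries.X ^ (j - i).toNat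
  else PowerSeries.invOfUnit (1 - PowerSeries.X ^ (j - i).toNat) 1

/-- The explicit covering by left horizontal edges at positive ordinates and right horizontal
edges at negative ordinates. -/
def straight : Set RYEdge :=
  {e | ∃ m ∈ G.cols, ∃ k : ℤ, (0 ≤ k ∧ e = ((2 * m, k), (2 * m - 1, k))) ∨
    (k < 0 ∧ e = ((2 * m, k), (2 * m + 1, k)))}

/-- The fundamental dimer covering exists. -/
theorem isFundamental_straight : G.IsFundamental G.straight := by
  have hor : ∀ e ∈ G.straight, e.IsHorizontal := by
    rintro e ⟨m, -, k, ⟨-, rfl⟩ | ⟨-, rfl⟩⟩ <;> rfl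
  have mat : RYIsMatching G.straight := by
    rintro e ⟨m, -, k, ⟨hk, rfl⟩ | ⟨hk, rfl⟩⟩ f ⟨m', -, k', ⟨hk', rfl⟩ | ⟨hk', rfl⟩⟩ ⟨x, y⟩ h h' <;>
      simp only [Prod.mk.injEq] at h h' ⊢ <;> omega
  have sub : G.straight ⊆ G.edges := by
    rintro e ⟨m, hm, k, ⟨-, rfl⟩ | ⟨-, rfl⟩⟩
    · exact ⟨m, hm, k, Or.inl rfl⟩
    · exact ⟨m, hm, k, Or.inr (Or.inl rfl)⟩
  have hL : ∀ m ∈ G.cols, ∀ k : ℤ, 0 ≤ k → ((2 * m, k), (2 * m - 1, k)) ∈ G.straight :=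
    fun m hm k hk => ⟨m, hm, k, Or.inl ⟨hk, rfl⟩⟩
  have hR : ∀ m ∈ G.cols, ∀ k : ℤ, k < 0 → ((2 * m, k), (2 * m + 1, k)) ∈ G.straight :=
    fun m hm k hk => ⟨m, hm, k, Or.inr ⟨hk, rfl⟩⟩
  have heven : ∀ m k : ℤ, m ∈ G.cols → RYCovers G.straight (2 * m, k) := by
    intro m k hm
    rcases lt_or_ge k 0 with hk | hk
    · exact ⟨_, hR m hm k hk, Or.inl rfl⟩
    · exact ⟨_, hL m hm k hk, Or.inl rfl⟩
  obtain ⟨m, hm⟩ := G.lo_le_hi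
  have hm : m ∈ G.cols := hm
  have hLm : ∀ k : ℤ, (((2 * m, k), (2 * m - 1, k)) : RYEdge) ∈ G.stripEdges m m :=
    fun k => ⟨m, ⟨le_rfl, le_rfl⟩, k, Or.inl rfl⟩
  have hRm : ∀ k : ℤ, (((2 * m, k), (2 * m + 1, k)) : RYEdge) ∈ G.stripEdges m m :=
    fun k => ⟨m, ⟨le_rfl, le_rfl⟩, k, Or.inr (Or.inl rfl)⟩
  have key : ∀ e ∈ G.straight ∩ G.stripEdges m m, e.1.1 = 2 * m := by
    rintro e ⟨-, m', ⟨h1, h2⟩, k, rfl | rfl | rfl⟩ <;> simp only <;> omega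
  refine ⟨⟨⟨sub, mat, heven, ?_⟩, m, m, le_rfl, hm, hm,
    ⟨Set.inter_subset_right, ?_, ?_, ?_, ?_, ?_, ?_, ?_⟩, fun e he _ => hor e he⟩, hor⟩
  · intro m k hm hm'
    rcases lt_or_ge k 0 with hk | hk
    · exact ⟨_, hR m hm k hk, Or.inr rfl⟩
    · refine ⟨_, hL (m + 1) hm' k hk, Or.inr ?_⟩
      exact Prod.ext (show 2 * (m + 1) - 1 = 2 * m + 1 by ring) rfl
  · exact fun e he f hf => mat e he.1 f hf.1
  · intro x k h1 h2
    obtain rfl : x = 2 * m := by omega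
    rcases lt_or_ge k 0 with hk | hk
    · exact ⟨_, ⟨hR m hm k hk, hRm k⟩, Or.inl rfl⟩
    · exact ⟨_, ⟨hL m hm k hk, hLm k⟩, Or.inl rfl⟩
  · intro k hk
    exact ⟨_, ⟨hL m hm k (by simpa using hk), hLm k⟩, Or.inr rfl⟩
  · rintro k hk ⟨e, he, h⟩
    have h3 := key e he
    obtain ⟨⟨m', -, k', ⟨h4, rfl⟩ | ⟨h4, rfl⟩⟩, -⟩ := he <;>
      simp only [Prod.mk.injEq] at h h3 <;> push_cast at hk <;> omega
  · intro k hk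
    exact ⟨_, ⟨hR m hm k (by simpa using hk), hRm k⟩, Or.inr rfl⟩
  · rintro k hk ⟨e, he, h⟩
    have h3 := key e he
    obtain ⟨⟨m', -, k', ⟨h4, rfl⟩ | ⟨h4, rfl⟩⟩, -⟩ := he <;>
      simp only [Prod.mk.injEq] at h h3 <;> push_cast at hk <;> omega
  · convert Set.finite_empty using 1
    ext e
    simp only [Set.mem_ofPred_eq, Set.mem_empty_iff_false, iff_false, not_and, not_not]
    exact fun he => hor e he.1

end RailYard

/-! Read a covering column by column and put a particle at an odd vertex when it is matched to the
column on its left. For a pure covering the particles at abscissa `2m + 1` form a Maya diagram of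
charge zero, that is, a Young diagram `Λ m`. Having a dimer at every even vertex of column `m` then
means that `Λ (m - 1)` and `Λ m` differ by a horizontal strip (letter `L`) or a vertical strip
(letter `R`), added or removed according to the sign. So pure coverings are in bijection with
finitely supported interlacing sequences (`exists_stateEquiv`), the fundamental covering being the
empty sequence.

The flip distance is the total number of cells (`IsState.dist_eq`). It is at most that, because a
nonempty sequence always has a cell whose removal keeps all interlacings (`IsState.exists_removal`),
and this removal is a flip (`isFlip_removal`). It is at least that, because a signed sum over
diagonal edges, the volume, is defined on all admissible coverings, changes by `1` or `-1` under
every flip (`volume_of_adj`), and equals the number of cells on the covering of a sequence.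

It remains to count sequences by cells, which is the commutation of vertex operators made bijective.
On a finite window, summation by parts turns the number of cells into a sum over columns of the
label of the column times the decrease in size across it. When a `+` column `i` is directly followed
by a `-` column `j`, the local bijection `LR.commutes` exchanges them; the labels move with the
columns, and a multiplicity of weight `j - i` splits off, whose generating function is the hook
factor of `(i, j)`. Once all `-` precede all `+`, only the empty sequence is left
(`isGenFun_seqWeight_perm`).

For infinite bounds, the coefficient of `q ^ d` sees only the hooks with `j - i ≤ d`, and the
finiteness condition leaves finitely many of them. The counts on all windows that contain these
hooks agree, so all sequences with `d` cells live on one window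
(`FinitenessCondition.exists_coeff`). -/

namespace YoungDiagram

/-! ### Young diagrams described by their row lengths -/

theorem le_iff_rowLen {x y : YoungDiagram} : x ≤ y ↔ ∀ i, x.rowLen i ≤ y.rowLen i := by
  constructor
  · intro h i
    by_contra! hlt
    exact lt_irrefl _ (mem_iff_lt_rowLen.1 (h (mem_iff_lt_rowLen.2 hlt)))
  · rintro h ⟨i, j⟩ hx
    exact mem_iff_lt_rowLen.2 ((mem_iff_lt_rowLen.1 hx).trans_le (h i))

theorem ext_rowLen {x y : YoungDiagram} (h : ∀ i, x.rowLen i = y.rowLen i) : x = y :=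
  le_antisymm (le_iff_rowLen.2 fun i => (h i).le) (le_iff_rowLen.2 fun i => (h i).ge)

theorem exists_rowLen_eq_zero (x : YoungDiagram) : ∃ n, ∀ i, n ≤ i → x.rowLen i = 0 := by
  refine ⟨x.colLen 0, fun i hi => ?_⟩
  by_contra h
  have := mem_iff_lt_colLen.1 (mem_iff_lt_rowLen.2 (Nat.pos_of_ne_zero h))
  omega

/-- The Young diagram with given row lengths. -/
noncomputable def ofRows (f : ℕ → ℕ) (hf : ∀ i, f (i + 1) ≤ f i) (hz : ∃ n, f n = 0) : YoungDiagram where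
  cells := ((Finset.range hz.choose) ×ˢ (Finset.range (f 0))).filter fun c => c.2 < f c.1
  isLowerSet := by
    have hanti : Antitone f := antitone_nat_of_succ_le hf
    rintro ⟨i, j⟩ ⟨i', j'⟩ ⟨h1, h2⟩ h
    simp only [Finset.coe_filter, Finset.mem_product, Finset.mem_range, Set.mem_ofPred_eq] at h ⊢
    simp only at h1 h2
    have := hanti h1
    omega

theorem rowLen_ofRows (f : ℕ → ℕ) (hf : ∀ i, f (i + 1) ≤ f i) (hz : ∃ n, f n = 0) (i : ℕ) :
    (ofRows f hf hz).rowLen i = f i := by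
  have hanti : Antitone f := antitone_nat_of_succ_le hf
  have key : ∀ j, j < (ofRows f hf hz).rowLen i ↔ j < f i := by
    intro j
    rw [← mem_iff_lt_rowLen, ← mem_cells]
    simp only [ofRows, Finset.mem_filter, Finset.mem_product, Finset.mem_range,
      and_iff_right_iff_imp]
    intro h
    refine ⟨?_, h.trans_le (hanti (Nat.zero_le i))⟩
    by_contra! h'
    have := hanti h'
    have := hz.choose_spec
    omega
  have h1 := key (f i)
  have h2 := key ((ofRows f hf hz).rowLen i)
  omega

theorem card_eq_sum_rowLen (x : YoungDiagram) {n : ℕ} (hn : x.rowLen n = 0) :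
    x.card = ∑ i ∈ Finset.range n, x.rowLen i := by
  have : x.cells = (Finset.range n).biUnion x.row := by
    ext ⟨i, j⟩
    simp only [Finset.mem_biUnion, Finset.mem_range, mem_row_iff, mem_cells]
    refine ⟨fun h => ⟨i, ?_, h, rfl⟩, fun ⟨_, _, h, _⟩ => h⟩
    by_contra! hi
    have := x.rowLen_anti _ _ hi
    have := mem_iff_lt_rowLen.1 h
    omega
  rw [YoungDiagram.card, this, Finset.card_biUnion]
  · exact Finset.sum_congr rfl fun i _ => (x.rowLen_eq_card).symm
  · intro i _ j _ hij
    rw [Function.onFun, Finset.disjoint_left]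
    intro c hc hc'
    rw [mem_row_iff] at hc hc'
    exact hij (hc.2.symm.trans hc'.2)

theorem card_transpose (x : YoungDiagram) : x.transpose.card = x.card := by
  simp [YoungDiagram.card, transpose]

end YoungDiagram

/-! ### Interlacing diagrams and the local commutation bijections -/

open YoungDiagram

/-- The interlacing relation `x ≺ y`: the skew shape `y / x` is a horizontal strip (type `L`) or a
vertical strip (type `R`). -/
def LR.Interlace : LR → YoungDiagram → YoungDiagram → Prop
  | .L, x, y => x ≤ y ∧ ∀ i j, (i + 1, j) ∈ y → (i, j) ∈ x
  | .R, x, y => x ≤ y ∧ ∀ i j, (i, j + 1) ∈ y → (i, j) ∈ x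

namespace LR

theorem Interlace.le {a : LR} {x y : YoungDiagram} (h : a.Interlace x y) : x ≤ y := by
  cases a
  · exact h.1
  · exact h.1

theorem interlace_L_iff {x y : YoungDiagram} :
    LR.L.Interlace x y ↔ ∀ i, x.rowLen i ≤ y.rowLen i ∧ y.rowLen (i + 1) ≤ x.rowLen i := by
  rw [Interlace, le_iff_rowLen, forall_and]
  refine and_congr_right fun _ => forall_congr' fun i => ⟨fun h => ?_, fun h j hj => ?_⟩
  · by_contra! hlt
    exact lt_irrefl _ (mem_iff_lt_rowLen.1 (h _ (mem_iff_lt_rowLen.2 hlt)))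
  · exact mem_iff_lt_rowLen.2 ((mem_iff_lt_rowLen.1 hj).trans_le h)

theorem interlace_R_iff {x y : YoungDiagram} :
    LR.R.Interlace x y ↔ ∀ i, x.rowLen i ≤ y.rowLen i ∧ y.rowLen i ≤ x.rowLen i + 1 := by
  rw [Interlace, le_iff_rowLen, forall_and]
  refine and_congr_right fun _ => forall_congr' fun i => ⟨fun h => ?_, fun h j hj => ?_⟩
  · by_contra! hlt
    exact lt_irrefl _ (mem_iff_lt_rowLen.1 (h _ (mem_iff_lt_rowLen.2 hlt)))
  · have := mem_iff_lt_rowLen.1 hj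
    exact mem_iff_lt_rowLen.2 (by omega)

theorem interlace_transpose {x y : YoungDiagram} :
    LR.R.Interlace x.transpose y.transpose ↔ LR.L.Interlace x y := by
  simp only [Interlace, transpose_le_iff, mem_transpose, Prod.swap_prod_mk]
  exact and_congr_right fun _ => forall_comm

/-- The possible multiplicities of a pair of columns of given types. -/
abbrev Mult (a a' : LR) : Type := {n : ℕ // a ≠ a' → n ≤ 1}

/-- The statement that the operators of types `a` and `a'` commute up to a factor, in the form of a
bijection that respects sizes. -/
def Commutes (a a' : LR) (x y : YoungDiagram) : Prop :=
  ∃ φ : {z // a.Interlace x z ∧ a'.Interlace y z} ≃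
      {w // a'.Interlace w x ∧ a.Interlace w y} × Mult a a',
    ∀ z, z.1.card + (φ z).1.1.card = x.card + y.card + (φ z).2.1

theorem Commutes.symm {a a' : LR} {x y : YoungDiagram} (h : Commutes a a' x y) :
    Commutes a' a y x := by
  obtain ⟨φ, hφ⟩ := h
  refine ⟨(Equiv.subtypeEquivRight fun _ => and_comm).trans (φ.trans (Equiv.prodCongr
    (Equiv.subtypeEquivRight fun _ => and_comm)
    (Equiv.subtypeEquivRight fun _ => by rw [ne_comm]))), fun z => ?_⟩
  have := hφ ((Equiv.subtypeEquivRight fun _ => and_comm) z)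
  rw [add_comm y.card]
  exact this

/-- This is a local rule of RSK type. Row `i + 1` of `z` and row `i` of `w` range over the same
interval, from the maximum of the rows `i + 1` of `x` and `y` to the minimum of their rows `i`, and
are matched by reflecting this interval. Row `0` of `z` is bounded only from below; its excess over
the maximum of the rows `0` is the free multiplicity. -/
theorem commutes_L_L (x y : YoungDiagram) : Commutes .L .L x y := by
  obtain ⟨n, hn⟩ := x.exists_rowLen_eq_zero
  obtain ⟨n', hn'⟩ := y.exists_rowLen_eq_zero
  obtain ⟨M, hM, hM'⟩ : ∃ M, n ≤ M ∧ n' ≤ M := ⟨max n n', le_max_left _ _, le_max_right _ _⟩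
  have hx : ∀ i, M ≤ i → x.rowLen i = 0 := fun i hi => hn i (hM.trans hi)
  have hy : ∀ i, M ≤ i → y.rowLen i = 0 := fun i hi => hn' i (hM'.trans hi)
  have ax : ∀ i, x.rowLen (i + 1) ≤ x.rowLen i := fun i => x.rowLen_anti _ _ (Nat.le_succ i)
  have ay : ∀ i, y.rowLen (i + 1) ≤ y.rowLen i := fun i => y.rowLen_anti _ _ (Nat.le_succ i)
  have up : ∀ z, LR.L.Interlace x z ∧ LR.L.Interlace y z ↔ ∀ i,
      (x.rowLen i ≤ z.rowLen i ∧ z.rowLen (i + 1) ≤ x.rowLen i) ∧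
      (y.rowLen i ≤ z.rowLen i ∧ z.rowLen (i + 1) ≤ y.rowLen i) := by
    intro z; rw [interlace_L_iff, interlace_L_iff, ← forall_and]
  have dn : ∀ w, LR.L.Interlace w x ∧ LR.L.Interlace w y ↔ ∀ i,
      (w.rowLen i ≤ x.rowLen i ∧ x.rowLen (i + 1) ≤ w.rowLen i) ∧
      (w.rowLen i ≤ y.rowLen i ∧ y.rowLen (i + 1) ≤ w.rowLen i) := by
    intro w; rw [interlace_L_iff, interlace_L_iff, ← forall_and]
  let f : YoungDiagram → ℕ → ℕ := fun z i =>
    max (x.rowLen (i + 1)) (y.rowLen (i + 1)) + min (x.rowLen i) (y.rowLen i) - z.rowLen (i + 1)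
  let g : YoungDiagram → ℕ → ℕ → ℕ := fun w n i => match i with
    | 0 => max (x.rowLen 0) (y.rowLen 0) + n
    | i + 1 => max (x.rowLen (i + 1)) (y.rowLen (i + 1)) + min (x.rowLen i) (y.rowLen i)
        - w.rowLen i
  have fanti : ∀ z, (LR.L.Interlace x z ∧ LR.L.Interlace y z) → ∀ i, f z (i + 1) ≤ f z i := by
    intro z hz i
    have h1 := (up z).1 hz (i + 1)
    have h2 := (up z).1 hz (i + 1 + 1)
    have h3 := (up z).1 hz i
    have := ax i; have := ay i; have := ax (i + 1); have := ay (i + 1)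
    simp only [f]; omega
  have fz : ∀ z, ∃ n, f z n = 0 := fun z => ⟨M, by
    simp only [f, hx M le_rfl, hy M le_rfl, hx (M + 1) (by omega), hy (M + 1) (by omega)]; omega⟩
  have ganti : ∀ w, (LR.L.Interlace w x ∧ LR.L.Interlace w y) → ∀ n i,
      g w n (i + 1) ≤ g w n i := by
    intro w hw n i
    have h1 := (dn w).1 hw (i + 1)
    have h2 := (dn w).1 hw i
    cases i with
    | zero => simp only [g]; omega
    | succ i =>
      have h3 := (dn w).1 hw i
      simp only [g]; omega
  have gz : ∀ w n, ∃ k, g w n k = 0 := fun w n => ⟨M + 1, by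
    simp only [g, hx M le_rfl, hy M le_rfl, hx (M + 1) (by omega), hy (M + 1) (by omega)]; omega⟩
  refine ⟨⟨fun z => (⟨ofRows (f z.1) (fanti z.1 z.2) (fz z.1), ?_⟩,
      ⟨z.1.rowLen 0 - max (x.rowLen 0) (y.rowLen 0), fun h => absurd rfl h⟩),
    fun w => ⟨ofRows (g w.1.1 w.2.1) (ganti w.1.1 w.1.2 w.2.1) (gz w.1.1 w.2.1), ?_⟩,
    ?_, ?_⟩, ?_⟩
  · rw [dn]
    intro i
    have h1 := (up z.1).1 z.2 i
    have h2 := (up z.1).1 z.2 (i + 1)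
    simp only [rowLen_ofRows, f]; omega
  · rw [up]
    intro i
    have h1 := (dn w.1.1).1 w.1.2 i
    rw [rowLen_ofRows, rowLen_ofRows]
    cases i with
    | zero => simp only [g]; omega
    | succ i =>
      have h3 := (dn w.1.1).1 w.1.2 i
      simp only [g]; omega
  · rintro ⟨z, hz⟩
    refine Subtype.ext (ext_rowLen fun i => ?_)
    rw [rowLen_ofRows]
    cases i with
    | zero => have := (up z).1 hz 0; simp only [g]; omega
    | succ i =>
      have := (up z).1 hz i; have := (up z).1 hz (i + 1)
      simp only [g, rowLen_ofRows, f]; omega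
  · rintro ⟨⟨w, hw⟩, n, hn⟩
    refine Prod.ext (Subtype.ext (ext_rowLen fun i => ?_)) (Subtype.ext ?_)
    · have := (dn w).1 hw i
      simp only [rowLen_ofRows, f, g]; omega
    · simp only [rowLen_ofRows, g]; omega
  · rintro ⟨z, hz⟩
    have h1 : z.rowLen (M + 1) = 0 := by
      have := ((up z).1 hz M).1.2; have := hx M le_rfl; omega
    have h2 : (ofRows (f z) (fanti z hz) (fz z)).rowLen M = 0 := by
      rw [rowLen_ofRows]
      simp only [f, hx M le_rfl, hy M le_rfl, hx (M + 1) (by omega), hy (M + 1) (by omega)]; omega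
    simp only [Equiv.coe_fn_mk]
    rw [card_eq_sum_rowLen z h1, card_eq_sum_rowLen _ h2,
      card_eq_sum_rowLen x (hx (M + 1) (by omega)), card_eq_sum_rowLen y (hy (M + 1) (by omega)),
      Finset.sum_range_succ', add_right_comm, ← Finset.sum_add_distrib, ← Finset.sum_add_distrib]
    -- Each sum of two rows is maximum plus minimum. The maximum in row `i + 1` is paired with the
    -- minimum in row `i`, the sum of the endpoints of the reflected interval; the last minimum is
    -- unpaired and vanishes for `N = M`.
    have h3 : ∀ N, ∑ i ∈ Finset.range (N + 1), (x.rowLen i + y.rowLen i) =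
        max (x.rowLen 0) (y.rowLen 0) + ∑ i ∈ Finset.range N,
          (max (x.rowLen (i + 1)) (y.rowLen (i + 1)) + min (x.rowLen i) (y.rowLen i))
          + min (x.rowLen N) (y.rowLen N) := by
      intro N
      induction N with
      | zero => simp
      | succ N ih => rw [Finset.sum_range_succ, ih, Finset.sum_range_succ]; omega
    rw [h3 M, hx M le_rfl, hy M le_rfl]
    have h4 : ∑ i ∈ Finset.range M, (z.rowLen (i + 1) + (ofRows (f z) (fanti z hz) (fz z)).rowLen i)
        = ∑ i ∈ Finset.range M,
          (max (x.rowLen (i + 1)) (y.rowLen (i + 1)) + min (x.rowLen i) (y.rowLen i)) := by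
      refine Finset.sum_congr rfl fun i _ => ?_
      have := (up z).1 hz i; have := (up z).1 hz (i + 1)
      simp only [rowLen_ofRows, f]; omega
    rw [h4]
    have := (up z).1 hz 0
    omega

theorem commutes_R_R (x y : YoungDiagram) : Commutes .R .R x y := by
  obtain ⟨φ, hφ⟩ := commutes_L_L x.transpose y.transpose
  let e₁ : {z // LR.R.Interlace x z ∧ LR.R.Interlace y z} ≃
      {z // LR.L.Interlace x.transpose z ∧ LR.L.Interlace y.transpose z} :=
    transposeOrderIso.toEquiv.subtypeEquiv fun z => by
      simp [transposeOrderIso, ← interlace_transpose]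
  let e₂ : {w // LR.R.Interlace w x ∧ LR.R.Interlace w y} ≃
      {w // LR.L.Interlace w x.transpose ∧ LR.L.Interlace w y.transpose} :=
    transposeOrderIso.toEquiv.subtypeEquiv fun z => by
      simp [transposeOrderIso, ← interlace_transpose]
  refine ⟨e₁.trans (φ.trans (Equiv.prodCongr e₂.symm
    (Equiv.subtypeEquivRight fun _ => by simp))), fun z => ?_⟩
  have := hφ (e₁ z)
  rw [card_transpose, card_transpose, show (e₁ z).1 = z.1.transpose from rfl, card_transpose,
    ← card_transpose (φ (e₁ z)).1.1] at this
  exact this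

/-- Every row of `z` exceeds the maximum of the rows of `x` and `y` by `0` or `1`, with a free
choice exactly at the rows in `E`; every row of `w` falls short of the minimum by `0` or `1`, with a
free choice exactly at the rows in `F`. As `E` has one element more than `F`, one binary choice
remains, and this is the multiplicity. -/
theorem commutes_L_R (x y : YoungDiagram) : Commutes .L .R x y := by
  obtain ⟨n, hn⟩ := x.exists_rowLen_eq_zero
  obtain ⟨n', hn'⟩ := y.exists_rowLen_eq_zero
  obtain ⟨M, hM, hM'⟩ : ∃ M, n ≤ M ∧ n' ≤ M := ⟨max n n', le_max_left _ _, le_max_right _ _⟩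
  have hx : ∀ i, M ≤ i → x.rowLen i = 0 := fun i hi => hn i (hM.trans hi)
  have hy : ∀ i, M ≤ i → y.rowLen i = 0 := fun i hi => hn' i (hM'.trans hi)
  have ax : ∀ i, x.rowLen (i + 1) ≤ x.rowLen i := fun i => x.rowLen_anti _ _ (Nat.le_succ i)
  have ay : ∀ i, y.rowLen (i + 1) ≤ y.rowLen i := fun i => y.rowLen_anti _ _ (Nat.le_succ i)
  have up : ∀ z, LR.L.Interlace x z ∧ LR.R.Interlace y z ↔ ∀ i,
      (x.rowLen i ≤ z.rowLen i ∧ z.rowLen (i + 1) ≤ x.rowLen i) ∧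
      (y.rowLen i ≤ z.rowLen i ∧ z.rowLen i ≤ y.rowLen i + 1) := by
    intro z; rw [interlace_L_iff, interlace_R_iff, ← forall_and]
  have dn : ∀ w, LR.R.Interlace w x ∧ LR.L.Interlace w y ↔ ∀ i,
      (w.rowLen i ≤ x.rowLen i ∧ x.rowLen i ≤ w.rowLen i + 1) ∧
      (w.rowLen i ≤ y.rowLen i ∧ y.rowLen (i + 1) ≤ w.rowLen i) := by
    intro w; rw [interlace_L_iff, interlace_R_iff, ← forall_and]
  -- These inequalities follow from the existence of `z` and also from that of `w`; when they fail,
  -- both sides are empty.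
  by_cases hc : ∀ i, x.rowLen i ≤ y.rowLen i + 1 ∧ y.rowLen (i + 1) ≤ x.rowLen i
  swap
  · have hA : IsEmpty {z // LR.L.Interlace x z ∧ LR.R.Interlace y z} :=
      ⟨fun z => hc fun i => by
        have := (up z.1).1 z.2 i; have := (up z.1).1 z.2 (i + 1); omega⟩
    have hB : IsEmpty {w // LR.R.Interlace w x ∧ LR.L.Interlace w y} :=
      ⟨fun w => hc fun i => by
        have := (dn w.1).1 w.2 i; have := (dn w.1).1 w.2 (i + 1); omega⟩
    exact ⟨Equiv.equivOfIsEmpty _ _, fun z => (hA.false z).elim⟩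
  let E := (Finset.range (M + 1)).filter fun i =>
    x.rowLen i ≤ y.rowLen i ∧ (i = 0 ∨ y.rowLen i < x.rowLen (i - 1))
  let F := (Finset.range (M + 1)).filter fun i =>
    x.rowLen i ≤ y.rowLen i ∧ y.rowLen (i + 1) < x.rowLen i
  have memE : ∀ i, i ∈ E ↔ x.rowLen i ≤ y.rowLen i ∧ (i = 0 ∨ y.rowLen i < x.rowLen (i - 1)) := by
    intro i
    simp only [E, Finset.mem_filter, Finset.mem_range, and_iff_right_iff_imp]
    rintro ⟨-, h⟩
    by_contra hi
    have := hx (i - 1) (by omega)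
    omega
  have memF : ∀ i, i ∈ F ↔ x.rowLen i ≤ y.rowLen i ∧ y.rowLen (i + 1) < x.rowLen i := by
    intro i
    simp only [F, Finset.mem_filter, Finset.mem_range, and_iff_right_iff_imp]
    rintro ⟨-, h⟩
    by_contra hi
    have := hx i (by omega)
    omega
  -- Truncated at row `N`, the two counts differ by `1` unless `y (N + 1) < x N`. At `N = M` the row
  -- of `x` is zero, so the difference is `1`.
  have hcard : E.card = F.card + 1 := by
    have key : ∀ N, ((Finset.range (N + 1)).filter fun i =>
          x.rowLen i ≤ y.rowLen i ∧ (i = 0 ∨ y.rowLen i < x.rowLen (i - 1))).card =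
        ((Finset.range (N + 1)).filter fun i =>
          x.rowLen i ≤ y.rowLen i ∧ y.rowLen (i + 1) < x.rowLen i).card +
        (if y.rowLen (N + 1) < x.rowLen N then 0 else 1) := by
      intro N
      simp only [Finset.card_filter]
      induction N with
      | zero =>
        have h1 := hc 0
        have h2 := ay 0
        simp only [zero_add, Finset.range_one, Finset.sum_singleton, true_or, and_true] at h1 h2 ⊢
        split_ifs <;> omega
      | succ N ih =>
        rw [Finset.sum_range_succ, ih, Finset.sum_range_succ _ (N + 1)]
        have := hc N; have := hc (N + 1); have := ax N; have := ay (N + 1)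
        simp only [Nat.add_sub_cancel, Nat.succ_ne_zero, false_or]
        split_ifs <;> omega
    have h := key M
    rw [hx M le_rfl, if_neg (Nat.not_lt_zero _)] at h
    exact h
  -- Any bijection will do, since sizes depend only on the sum of the choices. The choice at the
  -- image of `none` becomes the multiplicity.
  obtain ⟨ε⟩ : Nonempty (Option F ≃ E) := by
    refine ⟨Fintype.equivOfCardEq ?_⟩
    rw [Fintype.card_option, Fintype.card_coe, Fintype.card_coe, hcard]
  let T := {n : ℕ // LR.L ≠ LR.R → n ≤ 1}
  have hT : ∀ t : T, t.1 ≤ 1 := fun t => t.2 (by decide)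
  let g : (E → T) → ℕ → ℕ := fun t i =>
    max (x.rowLen i) (y.rowLen i) + if h : i ∈ E then (t ⟨i, h⟩).1 else 0
  let f : (F → T) → ℕ → ℕ := fun t i =>
    min (x.rowLen i) (y.rowLen i) - if h : i ∈ F then (t ⟨i, h⟩).1 else 0
  have gb : ∀ t i, g t i ≤ max (x.rowLen i) (y.rowLen i) + 1 ∧
      max (x.rowLen i) (y.rowLen i) ≤ g t i ∧ (i ∉ E → g t i = max (x.rowLen i) (y.rowLen i)) := by
    intro t i
    simp only [g]
    split_ifs with h
    · have := hT (t ⟨i, h⟩); exact ⟨by omega, by omega, fun h' => absurd h h'⟩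
    · exact ⟨by omega, by omega, fun _ => rfl⟩
  have fb : ∀ t i, f t i ≤ min (x.rowLen i) (y.rowLen i) ∧
      min (x.rowLen i) (y.rowLen i) ≤ f t i + 1 ∧
      (i ∉ F → f t i = min (x.rowLen i) (y.rowLen i)) := by
    intro t i
    simp only [f]
    split_ifs with h
    · have := hT (t ⟨i, h⟩); exact ⟨by omega, by omega, fun h' => absurd h h'⟩
    · exact ⟨by omega, by omega, fun _ => rfl⟩
  have gs : ∀ t i, (x.rowLen i ≤ g t i ∧ g t (i + 1) ≤ x.rowLen i) ∧
      (y.rowLen i ≤ g t i ∧ g t i ≤ y.rowLen i + 1) := by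
    intro t i
    have h1 := gb t i; have h2 := gb t (i + 1)
    have h3 := memE i; have h4 := memE (i + 1)
    have := hc i; have := hc (i + 1); have := ax i; have := ay i
    simp only [Nat.add_sub_cancel] at h4
    by_cases hE : i ∈ E <;> by_cases hE' : i + 1 ∈ E <;>
      simp only [hE, hE', true_iff, false_iff, not_true, not_false_iff, forall_const] at h1 h2 h3 h4
      <;> omega
  have fs : ∀ t i, (f t i ≤ x.rowLen i ∧ x.rowLen i ≤ f t i + 1) ∧
      (f t i ≤ y.rowLen i ∧ y.rowLen (i + 1) ≤ f t i) := by
    intro t i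
    have h1 := fb t i
    have h3 := memF i
    have := hc i; have := hc (i + 1); have := ax i; have := ay i
    by_cases hE : i ∈ F <;>
      simp only [hE, true_iff, false_iff, not_true, not_false_iff, forall_const] at h1 h3
      <;> omega
  have gz : ∀ t, ∃ k, g t k = 0 := fun t => ⟨M + 1, by
    have := (gs t M).1.2; have := hx M le_rfl; omega⟩
  have fz : ∀ t, ∃ k, f t k = 0 := fun t => ⟨M, by
    have := (fs t M).1.1; have := hx M le_rfl; omega⟩
  let A : {z // LR.L.Interlace x z ∧ LR.R.Interlace y z} ≃ (E → T) :=
    { toFun := fun z e => ⟨z.1.rowLen e - max (x.rowLen e) (y.rowLen e), fun _ => by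
        have := (up z.1).1 z.2 e; omega⟩
      invFun := fun t => ⟨ofRows (g t) (fun i => (gs t i).1.2.trans (gs t i).1.1) (gz t), by
        rw [up]; intro i; simp only [rowLen_ofRows]; exact gs t i⟩
      left_inv := by
        rintro ⟨z, hz⟩
        refine Subtype.ext (ext_rowLen fun i => ?_)
        simp only [rowLen_ofRows, g]
        have h1 := (up z).1 hz i
        split_ifs with h
        · omega
        · rw [memE] at h
          rcases i with _ | i
          · omega
          · have h2 := (up z).1 hz i
            simp only [Nat.add_sub_cancel] at h
            omega
      right_inv := by
        intro t
        funext e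
        refine Subtype.ext ?_
        simp only [rowLen_ofRows, g, e.2, dite_true]
        exact Nat.add_sub_cancel_left _ _ }
  let B : {w // LR.R.Interlace w x ∧ LR.L.Interlace w y} ≃ (F → T) :=
    { toFun := fun w e => ⟨min (x.rowLen e) (y.rowLen e) - w.1.rowLen e, fun _ => by
        have := (dn w.1).1 w.2 e; omega⟩
      invFun := fun t => ⟨ofRows (f t) (fun i => by
          have := fs t i; have := fs t (i + 1); omega) (fz t), by
        rw [dn]; intro i; simp only [rowLen_ofRows]; exact fs t i⟩
      left_inv := by
        rintro ⟨w, hw⟩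
        refine Subtype.ext (ext_rowLen fun i => ?_)
        simp only [rowLen_ofRows, f]
        have h1 := (dn w).1 hw i
        split_ifs with h
        · omega
        · rw [memF] at h
          omega
      right_inv := by
        intro t
        funext e
        refine Subtype.ext ?_
        have h1 := hT (t e)
        have h2 := (memF e).1 e.2
        simp only [rowLen_ofRows, f, e.2, dite_true]
        change _ - (_ - (t e).1) = (t e).1
        omega }
  let Ψ : (E → T) ≃ (F → T) × T :=
    ((Equiv.arrowCongr ε.symm (Equiv.refl T)).trans
      (Equiv.piOptionEquivProd (β := fun _ => T))).trans (Equiv.prodComm _ _)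
  have hΨ : ∀ t : E → T, ∑ e, (t e).1 = ∑ e, ((Ψ t).1 e).1 + (Ψ t).2.1 := by
    intro t
    rw [← Equiv.sum_comp ε, Fintype.sum_option, add_comm]
    rfl
  have cA : ∀ z : {z // LR.L.Interlace x z ∧ LR.R.Interlace y z}, z.1.card =
      ∑ i ∈ Finset.range (M + 1), max (x.rowLen i) (y.rowLen i) + ∑ e, (A z e).1 := by
    intro z
    have h1 : z.1.rowLen (M + 1) = 0 := by
      have := ((up z.1).1 z.2 M).1.2; have := hx M le_rfl; omega
    rw [card_eq_sum_rowLen _ h1]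
    change _ = _ + ∑ e : E, (z.1.rowLen e - max (x.rowLen e) (y.rowLen e))
    rw [Finset.sum_coe_sort E (fun i => z.1.rowLen i - max (x.rowLen i) (y.rowLen i)),
      Finset.sum_filter, ← Finset.sum_add_distrib]
    refine Finset.sum_congr rfl fun i _ => ?_
    have h2 := (up z.1).1 z.2 i
    split_ifs with h
    · omega
    · rcases i with _ | i
      · omega
      · have h2 := (up z.1).1 z.2 i
        simp only [Nat.add_sub_cancel] at h
        omega
  have cB : ∀ w : {w // LR.R.Interlace w x ∧ LR.L.Interlace w y}, w.1.card + ∑ e, (B w e).1 =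
      ∑ i ∈ Finset.range (M + 1), min (x.rowLen i) (y.rowLen i) := by
    intro w
    have h1 : w.1.rowLen (M + 1) = 0 := by
      have := ((dn w.1).1 w.2 (M + 1)).1.1; have := hx (M + 1) (by omega); omega
    rw [card_eq_sum_rowLen _ h1]
    change _ + ∑ e : F, (min (x.rowLen e) (y.rowLen e) - w.1.rowLen e) = _
    rw [Finset.sum_coe_sort F (fun i => min (x.rowLen i) (y.rowLen i) - w.1.rowLen i),
      Finset.sum_filter, ← Finset.sum_add_distrib]
    refine Finset.sum_congr rfl fun i _ => ?_
    have h2 := (dn w.1).1 w.2 i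
    split_ifs with h <;> omega
  refine ⟨A.trans (Ψ.trans (Equiv.prodCongr B.symm (Equiv.refl _))), fun z => ?_⟩
  have h1 := cA z
  have h2 := cB (B.symm (Ψ (A z)).1)
  have h3 := hΨ (A z)
  rw [Equiv.apply_symm_apply] at h2
  have h4 : ∑ i ∈ Finset.range (M + 1), max (x.rowLen i) (y.rowLen i) +
      ∑ i ∈ Finset.range (M + 1), min (x.rowLen i) (y.rowLen i) = x.card + y.card := by
    rw [card_eq_sum_rowLen x (hx (M + 1) (by omega)), card_eq_sum_rowLen y (hy (M + 1) (by omega)),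
      ← Finset.sum_add_distrib, ← Finset.sum_add_distrib]
    exact Finset.sum_congr rfl fun i _ => by omega
  change z.1.card + (B.symm (Ψ (A z)).1).1.card = x.card + y.card + (Ψ (A z)).2.1
  omega

theorem commutes (a a' : LR) (x y : YoungDiagram) : Commutes a a' x y := by
  cases a <;> cases a'
  · exact commutes_L_L x y
  · exact commutes_L_R x y
  · exact (commutes_L_R y x).symm
  · exact commutes_R_R x y

end LR

/-! ### Generating functions and the hook factors -/

/-- `f` is the generating function of the elements of `P` with respect to the weight `w`. -/
def IsGenFun {P : Type*} (w : P → ℤ) (f : PowerSeries ℤ) : Prop :=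
  (∀ x, 0 ≤ w x) ∧
    ∀ d : ℕ, {x | w x = d}.Finite ∧ PowerSeries.coeff d f = ({x | w x = d}.ncard : ℤ)

namespace IsGenFun

variable {P Q : Type*}

theorem of_equiv {w : P → ℤ} {w' : Q → ℤ} {f : PowerSeries ℤ} (h : IsGenFun w' f) (e : P ≃ Q)
    (he : ∀ x, w x = w' (e x)) : IsGenFun w f := by
  refine ⟨fun x => by rw [he]; exact h.1 _, fun d => ?_⟩
  have : {x | w x = d} = e ⁻¹' {y | w' y = d} := by ext x; simp [he]
  rw [this, (h.2 d).2, Set.ncard_preimage_of_injective_subset_range e.injective (by simp)]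
  exact ⟨(h.2 d).1.preimage e.injective.injOn, rfl⟩

theorem of_unique [Unique P] {w : P → ℤ} (h : w default = 0) : IsGenFun w 1 := by
  have hw : ∀ x, w x = 0 := fun x => by rw [Unique.eq_default x, h]
  refine ⟨fun x => (hw x).ge, fun d => ⟨Set.toFinite _, ?_⟩⟩
  rw [PowerSeries.coeff_one]
  split_ifs with hd
  · subst hd
    simp [hw, Set.ncard_univ]
  · have : {x | w x = d} = ∅ := by
      ext x
      simp only [hw, Set.mem_ofPred_eq, Set.mem_empty_iff_false, iff_false]
      omega
    simp [this]

theorem prod {w : P → ℤ} {w' : Q → ℤ} {f g : PowerSeries ℤ} (hf : IsGenFun w f)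
    (hg : IsGenFun w' g) : IsGenFun (fun x : P × Q => w x.1 + w' x.2) (f * g) := by
  refine ⟨fun x => add_nonneg (hf.1 _) (hg.1 _), fun d => ?_⟩
  have hU : {x : P × Q | w x.1 + w' x.2 = d} = ⋃ c ∈ Finset.HasAntidiagonal.antidiagonal d,
      {x | w x = (c.1 : ℕ)} ×ˢ {y | w' y = (c.2 : ℕ)} := by
    ext ⟨x, y⟩
    simp only [Set.mem_ofPred_eq, Finset.HasAntidiagonal.mem_antidiagonal, Set.mem_iUnion, Set.mem_prod,
      exists_prop, Prod.exists]
    constructor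
    · intro h
      have h1 := hf.1 x
      have h2 := hg.1 y
      exact ⟨(w x).toNat, (w' y).toNat, by omega, by omega, by omega⟩
    · rintro ⟨a, b, h, h1, h2⟩
      omega
  have hfin : ∀ c : ℕ × ℕ, ({x | w x = (c.1 : ℕ)} ×ˢ {y | w' y = (c.2 : ℕ)}).Finite :=
    fun c => (hf.2 _).1.prod (hg.2 _).1
  rw [hU]
  refine ⟨Set.Finite.biUnion (Finset.finite_toSet _) fun c _ => hfin c, ?_⟩
  rw [PowerSeries.coeff_mul]
  have := Set.ncard_iUnion_of_finite
    (s := fun c : Finset.HasAntidiagonal.antidiagonal d => {x | w x = (c.1.1 : ℕ)} ×ˢ {y | w' y = (c.1.2 : ℕ)})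
    (fun c => hfin c.1) (by
      rintro ⟨c, hc⟩ ⟨c', hc'⟩ hne
      rw [Function.onFun, Set.disjoint_left]
      rintro ⟨x, y⟩ ⟨h1, h2⟩ ⟨h3, h4⟩
      simp only [Set.mem_ofPred_eq] at h1 h2 h3 h4
      exact hne (Subtype.ext (Prod.ext (by simp only; omega) (by simp only; omega))))
  rw [← Set.iUnion_subtype (fun c => c ∈ Finset.HasAntidiagonal.antidiagonal d)
    (fun c => {x | w x = (c.1.1 : ℕ)} ×ˢ {y | w' y = (c.1.2 : ℕ)}), this,
    finsum_eq_sum_of_fintype, Nat.cast_sum, Finset.sum_coe_sort (Finset.HasAntidiagonal.antidiagonal d)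
      (fun c => ((({x | w x = (c.1 : ℕ)} ×ˢ {y | w' y = (c.2 : ℕ)}).ncard : ℕ) : ℤ))]
  refine Finset.sum_congr rfl fun c _ => ?_
  rw [(hf.2 _).2, (hg.2 _).2, Set.ncard_prod, Nat.cast_mul]

end IsGenFun

namespace RailYard

variable (G : RailYard)

open scoped Classical in
-- The geometric series allows every multiplicity and the binomial only `0` and `1`, as `LR.Mult`
-- does for equal and for distinct letters. Since `j - i` is positive, at most one multiplicity has
-- a given weight.
theorem isGenFun_hookFactor {i j : ℤ} (hij : i < j) :
    IsGenFun (fun n : LR.Mult (G.a i) (G.a j) => (n.1 : ℤ) * (j - i)) (G.hookFactor i j) := by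
  obtain ⟨c, hc⟩ : ∃ c : ℕ, j - i = c := ⟨(j - i).toNat, by omega⟩
  have hc0 : 0 < c := by omega
  refine ⟨fun n => mul_nonneg (by positivity) (by omega), fun d => ?_⟩
  have hinj : ∀ n m : LR.Mult (G.a i) (G.a j), n.1 * c = m.1 * c → n = m := fun n m h =>
    Subtype.ext (Nat.eq_of_mul_eq_mul_right hc0 h)
  have hset : {n : LR.Mult (G.a i) (G.a j) | (n.1 : ℤ) * (j - i) = d} =
      {n : LR.Mult (G.a i) (G.a j) | n.1 * c = d} := by
    ext n; rw [hc]; exact_mod_cast Iff.rfl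
  have hsub : {n : LR.Mult (G.a i) (G.a j) | n.1 * c = d}.Subsingleton :=
    fun n hn m hm => hinj n m (hn.trans hm.symm)
  rw [hset]
  refine ⟨hsub.finite, ?_⟩
  have hcard : ({n : LR.Mult (G.a i) (G.a j) | n.1 * c = d}.ncard : ℤ) =
      if ∃ n : LR.Mult (G.a i) (G.a j), n.1 * c = d then 1 else 0 := by
    split_ifs with h
    · obtain ⟨n, hn⟩ := h
      have : {n : LR.Mult (G.a i) (G.a j) | n.1 * c = d} = {n} :=
        hsub.eq_singleton_of_mem hn
      rw [this, Set.ncard_singleton, Nat.cast_one]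
    · have : {n : LR.Mult (G.a i) (G.a j) | n.1 * c = d} = ∅ := by
        ext n; simp only [Set.mem_ofPred_eq, Set.mem_empty_iff_false, iff_false]
        exact fun hn => h ⟨n, hn⟩
      rw [this, Set.ncard_empty, Nat.cast_zero]
  rw [hcard, hookFactor, hc, Int.toNat_natCast]
  by_cases ha : G.a i = G.a j
  · rw [if_neg (not_not.2 ha)]
    have hinv : PowerSeries.invOfUnit (1 - PowerSeries.X ^ c : PowerSeries ℤ) 1 =
        PowerSeries.mk fun d => if c ∣ d then 1 else 0 := by
      have h1 : (1 - PowerSeries.X ^ c : PowerSeries ℤ) *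
          PowerSeries.invOfUnit (1 - PowerSeries.X ^ c) 1 = 1 := by
        apply PowerSeries.mul_invOfUnit
        simp [hc0.ne']
      have h2 : (1 - PowerSeries.X ^ c : PowerSeries ℤ) *
          (PowerSeries.mk fun d => if c ∣ d then 1 else 0) = 1 := by
        ext e
        rw [sub_mul, one_mul, map_sub, PowerSeries.coeff_X_pow_mul', PowerSeries.coeff_mk,
          PowerSeries.coeff_one]
        by_cases he : c ≤ e
        · rw [if_pos he, PowerSeries.coeff_mk, if_neg (by omega : ¬ e = 0)]
          have : c ∣ e - c ↔ c ∣ e := by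
            rw [← Nat.dvd_add_right (dvd_refl c), Nat.add_sub_cancel' he]
          simp only [this, sub_self]
        · rw [if_neg he, sub_zero]
          by_cases h0 : e = 0
          · simp [h0]
          · rw [if_neg h0, if_neg]
            exact fun h => he (Nat.le_of_dvd (Nat.pos_of_ne_zero h0) h)
      have h3 : (1 - PowerSeries.X ^ c : PowerSeries ℤ) ≠ 0 := by
        intro h; rw [h, zero_mul] at h1; exact zero_ne_one h1
      exact mul_left_cancel₀ h3 (h1.trans h2.symm)
    rw [hinv, PowerSeries.coeff_mk]
    refine if_congr ⟨?_, ?_⟩ rfl rfl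
    · rintro ⟨k, rfl⟩
      exact ⟨⟨k, fun h => absurd ha h⟩, mul_comm _ _⟩
    · rintro ⟨n, rfl⟩
      exact Dvd.intro_left _ rfl
  · rw [if_pos ha, map_add, PowerSeries.coeff_one, PowerSeries.coeff_X_pow]
    by_cases h0 : d = 0
    · subst h0
      rw [if_pos rfl, if_neg hc0.ne, if_pos ⟨⟨0, fun _ => zero_le_one⟩, zero_mul _⟩, add_zero]
    · rw [if_neg h0, zero_add]
      refine if_congr ⟨?_, ?_⟩ rfl rfl
      · rintro rfl
        exact ⟨⟨1, fun _ => le_rfl⟩, one_mul _⟩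
      · rintro ⟨n, hn⟩
        have := n.2 ha
        obtain h | h : n.1 = 0 ∨ n.1 = 1 := by omega
        · rw [h, zero_mul] at hn; exact absurd hn.symm h0
        · rw [h, one_mul] at hn; exact hn.symm

end RailYard

/-! ### Interlacing sequences on a finite window and the sorting of columns -/

/-- The relation between the diagrams on the two sides of a column with the given letters. -/
def Sgn.Step (s : Sgn) (a : LR) (x y : YoungDiagram) : Prop :=
  match s with
  | .plus => a.Interlace x y
  | .minus => a.Interlace y x

/-- The bijection of `LR.commutes`, presented without dependent types. -/
theorem LR.exists_switch (a a' : LR) :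
    ∃ (F : YoungDiagram → YoungDiagram → YoungDiagram → YoungDiagram × ℕ)
      (F' : YoungDiagram → YoungDiagram → YoungDiagram × ℕ → YoungDiagram), ∀ x y,
      (∀ z, a.Interlace x z → a'.Interlace y z → a'.Interlace (F x y z).1 x ∧
        a.Interlace (F x y z).1 y ∧ (a ≠ a' → (F x y z).2 ≤ 1) ∧ F' x y (F x y z) = z ∧
        z.card + (F x y z).1.card = x.card + y.card + (F x y z).2) ∧
      ∀ w : YoungDiagram × ℕ, a'.Interlace w.1 x → a.Interlace w.1 y → (a ≠ a' → w.2 ≤ 1) →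
        a.Interlace x (F' x y w) ∧ a'.Interlace y (F' x y w) ∧ F x y (F' x y w) = w := by
  classical
  choose φ hφ using fun x y => LR.commutes a a' x y
  -- The default values outside the interlacing conditions are never reached in what follows.
  refine ⟨fun x y z => if h : a.Interlace x z ∧ a'.Interlace y z then
      ((φ x y ⟨z, h⟩).1.1, (φ x y ⟨z, h⟩).2.1) else (⊥, 0),
    fun x y w => if h : (a'.Interlace w.1 x ∧ a.Interlace w.1 y) ∧ (a ≠ a' → w.2 ≤ 1) then
      ((φ x y).symm (⟨w.1, h.1⟩, ⟨w.2, h.2⟩)).1 else ⊥, fun x y => ⟨fun z h1 h2 => ?_, ?_⟩⟩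
  · simp only [dif_pos (show a.Interlace x z ∧ a'.Interlace y z from ⟨h1, h2⟩)]
    have hw := (φ x y ⟨z, h1, h2⟩).1.2
    have hn := (φ x y ⟨z, h1, h2⟩).2.2
    refine ⟨hw.1, hw.2, hn, ?_, hφ x y ⟨z, h1, h2⟩⟩
    rw [dif_pos ⟨hw, hn⟩]
    simp
  · rintro ⟨w, n⟩ h1 h2 h3
    simp only [dif_pos (show (a'.Interlace w x ∧ a.Interlace w y) ∧ (a ≠ a' → n ≤ 1) from
      ⟨⟨h1, h2⟩, h3⟩)]
    have hz := ((φ x y).symm (⟨w, h1, h2⟩, ⟨n, h3⟩)).2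
    refine ⟨hz.1, hz.2, ?_⟩
    rw [dif_pos hz]
    simp

namespace RailYard

variable (G : RailYard)

/-- Sequences of diagrams, trivial outside `[l..r)`, that interlace according to the letters of `G`
at the integers of `[l..r]`, permuted by `σ`. -/
def IsSeq (σ : Equiv.Perm ℤ) (l r : ℤ) (Λ : ℤ → YoungDiagram) : Prop :=
  (∀ m, m < l ∨ r ≤ m → Λ m = ⊥) ∧
    ∀ m, l ≤ m → m ≤ r → (G.b (σ m)).Step (G.a (σ m)) (Λ (m - 1)) (Λ m)

/-- The weight of a sequence of diagrams. -/
noncomputable def seqWeight (σ : Equiv.Perm ℤ) (l r : ℤ) (Λ : ℤ → YoungDiagram) : ℤ :=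
  ∑ m ∈ Finset.Icc (l - 1) r, (σ (m + 1) - σ m) * ((Λ m).card : ℤ)

/-- The pairs `(i, j)` of integers of `[l..r]` such that `i` comes before `j` in the order given by
`σ`, and such that `i` has sign `+` and `j` has sign `-`. -/
noncomputable def hooksIn (σ : Equiv.Perm ℤ) (l r : ℤ) : Finset (ℤ × ℤ) :=
  (Finset.Icc l r ×ˢ Finset.Icc l r).filter fun p =>
    σ.symm p.1 < σ.symm p.2 ∧ G.b p.1 = .plus ∧ G.b p.2 = .minus

variable {G}

theorem mem_hooksIn {σ : Equiv.Perm ℤ} {l r : ℤ} {p : ℤ × ℤ} : p ∈ G.hooksIn σ l r ↔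
    ((l ≤ p.1 ∧ p.1 ≤ r) ∧ l ≤ p.2 ∧ p.2 ≤ r) ∧
      σ.symm p.1 < σ.symm p.2 ∧ G.b p.1 = .plus ∧ G.b p.2 = .minus := by
  simp only [hooksIn, Finset.mem_filter, Finset.mem_product, Finset.mem_Icc]

/-- Exchanging two neighbours alters the relative order of this pair only, and afterwards the minus
comes before the plus. -/
theorem hooksIn_mul_swap {σ : Equiv.Perm ℤ} {l r i : ℤ}
    (h1 : G.b (σ i) = .plus) (h2 : G.b (σ (i + 1)) = .minus) :
    G.hooksIn (σ * Equiv.swap i (i + 1)) l r = (G.hooksIn σ l r).erase (σ i, σ (i + 1)) := by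
  ext ⟨p, q⟩
  obtain ⟨u, rfl⟩ := σ.surjective p
  obtain ⟨v, rfl⟩ := σ.surjective q
  have hs : ∀ w, (σ * Equiv.swap i (i + 1)).symm (σ w) = Equiv.swap i (i + 1) w := by
    intro w
    rw [Equiv.symm_apply_eq]
    simp
  simp only [Finset.mem_erase, mem_hooksIn, hs, Equiv.symm_apply_apply, ne_eq, Prod.mk.injEq,
    EmbeddingLike.apply_eq_iff_eq]
  have hu : Equiv.swap i (i + 1) u = if u = i then i + 1 else if u = i + 1 then i else u :=
    Equiv.swap_apply_def _ _ _
  have hv : Equiv.swap i (i + 1) v = if v = i then i + 1 else if v = i + 1 then i else v :=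
    Equiv.swap_apply_def _ _ _
  rw [hu, hv]
  have hne : Sgn.plus ≠ Sgn.minus := by decide
  by_cases c1 : u = i + 1
  · subst c1
    simp [h2]
  by_cases c2 : v = i
  · subst c2
    simp [h1]
  have : (if u = i then i + 1 else if u = i + 1 then i else u) <
      (if v = i then i + 1 else if v = i + 1 then i else v) ↔
      ¬ (u = i ∧ v = i + 1) ∧ u < v := by
    split_ifs <;> omega
  rw [this]
  tauto

/-- By summation by parts, the weight of a sequence that is trivial at the ends is the sum over `m`
of `σ m` times the decrease in size from `Λ (m - 1)` to `Λ m`: each column keeps its label when it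
moves. Only the terms at `i - 1`, `i` and `i + 1` change under the exchange, and the size identity
of the local bijection evaluates the difference. -/
theorem seqWeight_swap {σ : Equiv.Perm ℤ} {l r i : ℤ} (hl : l ≤ i) (hr : i + 1 ≤ r)
    {Λ : ℤ → YoungDiagram} {w : YoungDiagram} {n : ℕ}
    (h : (Λ i).card + w.card = (Λ (i - 1)).card + (Λ (i + 1)).card + n) :
    seqWeight σ l r Λ = seqWeight (σ * Equiv.swap i (i + 1)) l r (Function.update Λ i w) +
      n * (σ (i + 1) - σ i) := by
  have hs : ∀ m, (σ * Equiv.swap i (i + 1)) m =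
      if m = i then σ (i + 1) else if m = i + 1 then σ i else σ m := by
    intro m
    rw [Equiv.Perm.mul_apply, Equiv.swap_apply_def]
    split_ifs <;> rfl
  rw [← sub_eq_iff_eq_add', seqWeight, seqWeight, ← Finset.sum_sub_distrib]
  -- The range of `seqWeight` starts at `l - 1` so that these three positions always belong to it,
  -- even for `i = l`.
  rw [← Finset.sum_subset (s₁ := {i - 1, i, i + 1})]
  · rw [Finset.sum_insert (by simp; omega), Finset.sum_insert (by simp), Finset.sum_singleton]
    have e1 : (Function.update Λ i w) (i - 1) = Λ (i - 1) :=
      Function.update_of_ne (by omega) _ _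
    have e2 : (Function.update Λ i w) (i + 1) = Λ (i + 1) :=
      Function.update_of_ne (by omega) _ _
    have e3 : (Function.update Λ i w) i = w := Function.update_self _ _ _
    have t1 : (σ * Equiv.swap i (i + 1)) (i - 1) = σ (i - 1) := by
      rw [hs, if_neg (by omega), if_neg (by omega)]
    have t2 : (σ * Equiv.swap i (i + 1)) i = σ (i + 1) := by rw [hs, if_pos rfl]
    have t3 : (σ * Equiv.swap i (i + 1)) (i + 1) = σ i := by
      rw [hs, if_neg (by omega), if_pos rfl]
    have t4 : (σ * Equiv.swap i (i + 1)) (i + 1 + 1) = σ (i + 1 + 1) := by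
      rw [hs, if_neg (by omega), if_neg (by omega)]
    rw [sub_add_cancel, e1, e2, e3, t1, t2, t3, t4]
    have h' : ((Λ i).card : ℤ) + w.card = (Λ (i - 1)).card + (Λ (i + 1)).card + n := by
      exact_mod_cast h
    linear_combination (σ (i + 1) - σ i) * h'
  · intro m
    simp only [Finset.mem_insert, Finset.mem_singleton, Finset.mem_Icc]
    omega
  · intro m _ hm
    simp only [Finset.mem_insert, Finset.mem_singleton, not_or] at hm
    rw [Function.update_of_ne hm.2.1, hs m, hs (m + 1), if_neg hm.2.1, if_neg hm.2.2,
      if_neg (by omega), if_neg (by omega), sub_self]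

/-- With its two neighbours fixed, `Λ i` contains both of them before the exchange and is contained
in both afterwards. The local bijection replaces the upper diagram by a lower one and a
multiplicity, whose weight `σ (i + 1) - σ i` per unit gives the hook factor. -/
theorem isGenFun_seqWeight_of_swap {σ : Equiv.Perm ℤ} {l r i : ℤ} (hl : l ≤ i) (hr : i + 1 ≤ r)
    (h1 : G.b (σ i) = .plus) (h2 : G.b (σ (i + 1)) = .minus) (h3 : σ i < σ (i + 1))
    {f : PowerSeries ℤ}
    (hf : IsGenFun (fun Λ : {Λ // G.IsSeq (σ * Equiv.swap i (i + 1)) l r Λ} =>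
      seqWeight (σ * Equiv.swap i (i + 1)) l r Λ.1) f) :
    IsGenFun (fun Λ : {Λ // G.IsSeq σ l r Λ} => seqWeight σ l r Λ.1)
      (f * G.hookFactor (σ i) (σ (i + 1))) := by
  obtain ⟨F, F', hF⟩ := LR.exists_switch (G.a (σ i)) (G.a (σ (i + 1)))
  have hs : ∀ m, (σ * Equiv.swap i (i + 1)) m =
      if m = i then σ (i + 1) else if m = i + 1 then σ i else σ m := by
    intro m
    rw [Equiv.Perm.mul_apply, Equiv.swap_apply_def]
    split_ifs <;> rfl
  have up1 : ∀ (Λ : ℤ → YoungDiagram) w, Function.update Λ i w (i - 1) = Λ (i - 1) :=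
    fun Λ w => Function.update_of_ne (by omega) _ _
  have up2 : ∀ (Λ : ℤ → YoungDiagram) w, Function.update Λ i w (i + 1) = Λ (i + 1) :=
    fun Λ w => Function.update_of_ne (by omega) _ _
  have dn : ∀ Λ, G.IsSeq σ l r Λ → (G.a (σ i)).Interlace (Λ (i - 1)) (Λ i) ∧
      (G.a (σ (i + 1))).Interlace (Λ (i + 1)) (Λ i) := by
    intro Λ hΛ
    have s1 := hΛ.2 i hl (by omega)
    have s2 := hΛ.2 (i + 1) (by omega) hr
    rw [h1] at s1
    rw [h2, add_sub_cancel_right] at s2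
    exact ⟨s1, s2⟩
  have dn' : ∀ Λ, G.IsSeq (σ * Equiv.swap i (i + 1)) l r Λ →
      (G.a (σ (i + 1))).Interlace (Λ i) (Λ (i - 1)) ∧
      (G.a (σ i)).Interlace (Λ i) (Λ (i + 1)) := by
    intro Λ hΛ
    have s1 := hΛ.2 i hl (by omega)
    have s2 := hΛ.2 (i + 1) (by omega) hr
    rw [hs, if_pos rfl, h2] at s1
    rw [hs, if_neg (by omega), if_pos rfl, h1, add_sub_cancel_right] at s2
    exact ⟨s1, s2⟩
  have mk : ∀ Λ w, G.IsSeq σ l r Λ → (G.a (σ (i + 1))).Interlace w (Λ (i - 1)) →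
      (G.a (σ i)).Interlace w (Λ (i + 1)) →
      G.IsSeq (σ * Equiv.swap i (i + 1)) l r (Function.update Λ i w) := by
    intro Λ w hΛ hw1 hw2
    refine ⟨fun m hm => ?_, fun m hm hm' => ?_⟩
    · rw [Function.update_of_ne (by omega), hΛ.1 m hm]
    · rw [hs]
      split_ifs with c1 c2
      · subst c1
        rw [h2, up1, Function.update_self]
        exact hw1
      · subst c2
        rw [h1, up2, add_sub_cancel_right, Function.update_self]
        exact hw2
      · rw [Function.update_of_ne c1, Function.update_of_ne (by omega)]
        exact hΛ.2 m hm hm'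
  have mk' : ∀ Λ z, G.IsSeq (σ * Equiv.swap i (i + 1)) l r Λ →
      (G.a (σ i)).Interlace (Λ (i - 1)) z → (G.a (σ (i + 1))).Interlace (Λ (i + 1)) z →
      G.IsSeq σ l r (Function.update Λ i z) := by
    intro Λ z hΛ hz1 hz2
    refine ⟨fun m hm => ?_, fun m hm hm' => ?_⟩
    · rw [Function.update_of_ne (by omega), hΛ.1 m hm]
    · by_cases c1 : m = i
      · subst c1
        rw [h1, up1, Function.update_self]
        exact hz1
      by_cases c2 : m = i + 1
      · subst c2
        rw [h2, up2, add_sub_cancel_right, Function.update_self]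
        exact hz2
      · rw [Function.update_of_ne c1, Function.update_of_ne (by omega)]
        have := hΛ.2 m hm hm'
        rwa [hs, if_neg c1, if_neg c2] at this
  let e : {Λ // G.IsSeq σ l r Λ} ≃ {Λ // G.IsSeq (σ * Equiv.swap i (i + 1)) l r Λ} ×
      LR.Mult (G.a (σ i)) (G.a (σ (i + 1))) :=
    { toFun := fun Λ =>
        have hz := dn Λ.1 Λ.2
        have hw := (hF (Λ.1 (i - 1)) (Λ.1 (i + 1))).1 (Λ.1 i) hz.1 hz.2
        (⟨Function.update Λ.1 i (F (Λ.1 (i - 1)) (Λ.1 (i + 1)) (Λ.1 i)).1,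
          mk Λ.1 _ Λ.2 hw.1 hw.2.1⟩,
        ⟨(F (Λ.1 (i - 1)) (Λ.1 (i + 1)) (Λ.1 i)).2, hw.2.2.1⟩)
      invFun := fun Λ =>
        have hz := dn' Λ.1.1 Λ.1.2
        have hw := (hF (Λ.1.1 (i - 1)) (Λ.1.1 (i + 1))).2 (Λ.1.1 i, Λ.2.1) hz.1 hz.2 Λ.2.2
        ⟨Function.update Λ.1.1 i (F' (Λ.1.1 (i - 1)) (Λ.1.1 (i + 1)) (Λ.1.1 i, Λ.2.1)),
          mk' Λ.1.1 _ Λ.1.2 hw.1 hw.2.1⟩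
      left_inv := by
        rintro ⟨Λ, hΛ⟩
        have hz := dn Λ hΛ
        have hw := (hF (Λ (i - 1)) (Λ (i + 1))).1 (Λ i) hz.1 hz.2
        refine Subtype.ext ?_
        simp only [up1, up2, Function.update_self, Function.update_idem, Prod.mk.eta, hw.2.2.2.1,
          Function.update_eq_self]
      right_inv := by
        rintro ⟨⟨Λ, hΛ⟩, n⟩
        have hz := dn' Λ hΛ
        have hw := (hF (Λ (i - 1)) (Λ (i + 1))).2 (Λ i, n.1) hz.1 hz.2 n.2
        refine Prod.ext (Subtype.ext ?_) (Subtype.ext ?_)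
        · simp only [up1, up2, Function.update_self, Function.update_idem, hw.2.2,
            Function.update_eq_self]
        · simp only [up1, up2, Function.update_self, hw.2.2] }
  refine (hf.prod (G.isGenFun_hookFactor h3)).of_equiv e fun Λ => ?_
  have hz := dn Λ.1 Λ.2
  have hw := (hF (Λ.1 (i - 1)) (Λ.1 (i + 1))).1 (Λ.1 i) hz.1 hz.2
  exact seqWeight_swap hl hr hw.2.2.2.2

theorem isSeq_bot {σ : Equiv.Perm ℤ} {l r : ℤ} : G.IsSeq σ l r fun _ => ⊥ := by
  refine ⟨fun _ _ => rfl, fun m _ _ => ?_⟩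
  have h : ∀ a : LR, a.Interlace ⊥ ⊥ := by
    intro a
    cases a <;> exact ⟨le_rfl, fun i j h => absurd h (YoungDiagram.notMem_bot _)⟩
  cases G.b (σ m) <;> exact h _

/-- When all minus signs precede all plus signs, the diagrams first shrink, starting from the empty
one, and then grow, ending at the empty one. -/
theorem IsSeq.eq_bot {σ : Equiv.Perm ℤ} {l r : ℤ} {Λ : ℤ → YoungDiagram} (hΛ : G.IsSeq σ l r Λ)
    (h : ∀ x y, l ≤ x → x ≤ y → y ≤ r → G.b (σ x) = .plus → G.b (σ y) = .plus) (m : ℤ) :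
    Λ m = ⊥ := by
  by_cases hm : m < l ∨ r ≤ m
  · exact hΛ.1 m hm
  rw [not_or, not_lt, not_le] at hm
  rw [← le_bot_iff]
  cases hb : G.b (σ m) with
  | plus =>
    have key : ∀ y, m ≤ y → y ≤ r → Λ m ≤ Λ y := by
      intro y hy
      induction y, hy using Int.leInduction with
      | base => exact fun _ => le_rfl
      | succ y hy ih =>
        intro hyr
        refine (ih (by omega)).trans ?_
        have := hΛ.2 (y + 1) (by omega) hyr
        rw [h m (y + 1) hm.1 (by omega) hyr hb, add_sub_cancel_right] at this
        exact LR.Interlace.le this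
    exact (key r hm.2.le le_rfl).trans (hΛ.1 r (Or.inr le_rfl)).le
  | minus =>
    have key : ∀ y, l - 1 ≤ y → y ≤ m → Λ y ≤ Λ (l - 1) := by
      intro y hy
      induction y, hy using Int.leInduction with
      | base => exact fun _ => le_rfl
      | succ y hy ih =>
        intro hym
        refine le_trans ?_ (ih (by omega))
        have := hΛ.2 (y + 1) (by omega) (by omega)
        have hb' : G.b (σ (y + 1)) = .minus := by
          cases hc : G.b (σ (y + 1)) with
          | plus =>
            have := h (y + 1) m (by omega) hym (by omega) hc
            rw [hb] at this
            exact absurd this (by decide)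
          | minus => rfl
        rw [hb', add_sub_cancel_right] at this
        exact LR.Interlace.le this
    exact (key m (by omega) le_rfl).trans (hΛ.1 _ (Or.inl (by omega))).le

/-- A bubble sort: as long as some plus is directly followed by a minus, exchanging them removes one
hook and pulls out its factor. Arbitrary `σ` are needed for the induction only, and the condition
`p.1 < p.2` keeps all exponents positive. Nonnegativity of the weight, which is not visible for a
general `σ`, also comes out of the induction. -/
theorem isGenFun_seqWeight_perm (n : ℕ) : ∀ (σ : Equiv.Perm ℤ) (l r : ℤ),
    (∀ m, l ≤ m ∧ m ≤ r → l ≤ σ m ∧ σ m ≤ r) → (∀ p ∈ G.hooksIn σ l r, p.1 < p.2) →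
    (G.hooksIn σ l r).card = n →
    IsGenFun (fun Λ : {Λ // G.IsSeq σ l r Λ} => seqWeight σ l r Λ.1)
      (∏ p ∈ G.hooksIn σ l r, G.hookFactor p.1 p.2) := by
  induction n using Nat.strong_induction_on with
  | _ n ih =>
  intro σ l r hσ hlt hn
  by_cases h : ∃ i, l ≤ i ∧ i + 1 ≤ r ∧ G.b (σ i) = .plus ∧ G.b (σ (i + 1)) = .minus
  · obtain ⟨i, hl, hr, h1, h2⟩ := h
    have hmem : (σ i, σ (i + 1)) ∈ G.hooksIn σ l r := by
      rw [mem_hooksIn]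
      exact ⟨⟨hσ i (by omega), hσ (i + 1) (by omega)⟩, by simp, h1, h2⟩
    have he := hooksIn_mul_swap (l := l) (r := r) h1 h2
    rw [← Finset.prod_erase_mul _ _ hmem, ← he]
    refine isGenFun_seqWeight_of_swap hl hr h1 h2 (hlt _ hmem) (ih _ ?_ _ l r ?_ ?_ rfl)
    · rw [he, ← hn]
      exact Finset.card_erase_lt_of_mem hmem
    · intro m hm
      rw [Equiv.Perm.mul_apply]
      apply hσ
      rw [Equiv.swap_apply_def]
      split_ifs <;> omega
    · intro p hp
      rw [he] at hp
      exact hlt p (Finset.mem_of_mem_erase hp)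
  · have hmono : ∀ x y, l ≤ x → x ≤ y → y ≤ r → G.b (σ x) = .plus → G.b (σ y) = .plus := by
      intro x y hx hxy
      induction y, hxy using Int.leInduction with
      | base => exact fun _ h => h
      | succ y hy ih =>
        intro hyr hb
        have := ih (by omega) hb
        cases hc : G.b (σ (y + 1)) with
        | plus => rfl
        | minus => exact absurd ⟨y, by omega, hyr, this, hc⟩ h
    have hempty : G.hooksIn σ l r = ∅ := by
      rw [Finset.eq_empty_iff_forall_notMem]
      rintro ⟨p, q⟩ hp
      -- An injective map of the finite interval into itself is onto, so labels in the window occur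
      -- only at positions in the window.
      have hfin : ∀ m, l ≤ σ m ∧ σ m ≤ r → l ≤ m ∧ m ≤ r := by
        intro m hm
        have hmaps : Set.MapsTo σ (Finset.Icc l r) (Finset.Icc l r) := by
          intro x hx
          simp only [Finset.coe_Icc, Set.mem_Icc] at hx ⊢
          exact hσ x hx
        have := Finset.surj_on_of_inj_on_of_card_le (s := Finset.Icc l r) (t := Finset.Icc l r)
          (fun x _ => σ x) (fun x hx => hmaps hx) (fun _ _ _ _ h => σ.injective h) le_rfl (σ m)
          (Finset.mem_Icc.2 hm)
        obtain ⟨x, hx, hxm⟩ := this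
        rw [σ.injective hxm]
        exact Finset.mem_Icc.1 hx
      obtain ⟨u, rfl⟩ := σ.surjective p
      obtain ⟨v, rfl⟩ := σ.surjective q
      simp only [mem_hooksIn, Equiv.symm_apply_apply] at hp
      have hu := hfin u hp.1.1
      have hv := hfin v hp.1.2
      have := hmono u v hu.1 hp.2.1.le hv.2 hp.2.2.1
      rw [hp.2.2.2] at this
      exact absurd this (by decide)
    rw [hempty, Finset.prod_empty]
    have : Unique {Λ // G.IsSeq σ l r Λ} :=
      { default := ⟨fun _ => ⊥, isSeq_bot⟩
        uniq := fun Λ => Subtype.ext (funext fun m => Λ.2.eq_bot hmono m) }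
    refine IsGenFun.of_unique ?_
    have hd : ((default : {Λ // G.IsSeq σ l r Λ}) : ℤ → YoungDiagram) = fun _ => ⊥ :=
      funext fun m => IsSeq.eq_bot (Subtype.prop _) hmono m
    rw [hd]
    refine Finset.sum_eq_zero fun m _ => ?_
    simp [YoungDiagram.card]

end RailYard

/-! ### Passage from finite windows to arbitrary bounds -/

namespace RailYard

variable {G : RailYard}

theorem mem_cols_of_le_of_le {l r m : ℤ} (hl : l ∈ G.cols) (hr : r ∈ G.cols) (h1 : l ≤ m)
    (h2 : m ≤ r) : m ∈ G.cols :=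
  ⟨hl.1.trans (WithBot.coe_le_coe.2 h1), (WithTop.coe_le_coe.2 h2).trans hr.2⟩

/-- Every finite set of columns is contained in a finite interval of columns. -/
theorem exists_window {S : Set ℤ} (hS : S.Finite) (hc : S ⊆ G.cols) :
    ∃ l r, l ≤ r ∧ l ∈ G.cols ∧ r ∈ G.cols ∧ ∀ m ∈ S, l ≤ m ∧ m ≤ r := by
  obtain ⟨m₀, hm₀⟩ := G.lo_le_hi
  have hT : (insert m₀ S).Finite := hS.insert _
  have hTc : insert m₀ S ⊆ G.cols := Set.insert_subset hm₀ hc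
  obtain ⟨l, hl, hl'⟩ := Set.exists_min_image _ id hT (Set.insert_nonempty _ _)
  obtain ⟨r, hr, hr'⟩ := Set.exists_max_image _ id hT (Set.insert_nonempty _ _)
  exact ⟨l, r, hl' r hr, hTc hl, hTc hr, fun m hm =>
    ⟨hl' m (Set.mem_insert_of_mem _ hm), hr' m (Set.mem_insert_of_mem _ hm)⟩⟩

variable (G) in
/-- The sequences of diagrams that encode the pure coverings of `G`. -/
structure IsState (Λ : ℤ → YoungDiagram) : Prop where
  finite : {m | Λ m ≠ ⊥}.Finite
  eq_bot : ∀ m, ¬ (m ∈ G.cols ∧ m + 1 ∈ G.cols) → Λ m = ⊥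
  step : ∀ m ∈ G.cols, (G.b m).Step (G.a m) (Λ (m - 1)) (Λ m)

/-- The total number of cells. -/
noncomputable def stateSize (Λ : ℤ → YoungDiagram) : ℕ := ∑ᶠ m, (Λ m).card

theorem card_bot : (⊥ : YoungDiagram).card = 0 := by simp [YoungDiagram.card]

theorem IsSeq.isState {l r : ℤ} (hl : l ∈ G.cols) (hr : r ∈ G.cols) {Λ : ℤ → YoungDiagram}
    (h : G.IsSeq (Equiv.refl ℤ) l r Λ) : G.IsState Λ := by
  have hne : ∀ m, Λ m ≠ ⊥ → l ≤ m ∧ m < r := by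
    intro m hm
    by_contra hc
    exact hm (h.1 m (by omega))
  refine ⟨(Set.finite_Icc l r).subset fun m hm => ⟨(hne m hm).1, (hne m hm).2.le⟩,
    fun m hm => ?_, fun m _ => ?_⟩
  · by_contra hc
    have := hne m hc
    exact hm ⟨mem_cols_of_le_of_le hl hr this.1 this.2.le,
      mem_cols_of_le_of_le hl hr (by omega) (by omega)⟩
  · by_cases hw : l ≤ m ∧ m ≤ r
    · exact h.2 m hw.1 hw.2
    · rw [h.1 (m - 1) (by omega), h.1 m (by omega)]
      exact (isSeq_bot (G := G) (σ := Equiv.refl ℤ) (l := m) (r := m)).2 m le_rfl le_rfl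

theorem IsState.isSeq {l r : ℤ} (hl : l ∈ G.cols) (hr : r ∈ G.cols) {Λ : ℤ → YoungDiagram}
    (h : G.IsState Λ) (hw : ∀ m, Λ m ≠ ⊥ → l ≤ m ∧ m < r) : G.IsSeq (Equiv.refl ℤ) l r Λ := by
  refine ⟨fun m hm => ?_, fun m h1 h2 => h.step m (mem_cols_of_le_of_le hl hr h1 h2)⟩
  by_contra hc
  have := hw m hc
  omega

theorem IsSeq.seqWeight_eq {l r : ℤ} {Λ : ℤ → YoungDiagram}
    (h : G.IsSeq (Equiv.refl ℤ) l r Λ) : seqWeight (Equiv.refl ℤ) l r Λ = stateSize Λ := by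
  rw [stateSize, finsum_eq_sum_of_support_subset (s := Finset.Icc (l - 1) r), seqWeight,
    Nat.cast_sum]
  · refine Finset.sum_congr rfl fun m _ => ?_
    simp
  · intro m hm
    rw [Finset.coe_Icc, Set.mem_Icc]
    by_contra hc
    refine hm ?_
    simp only [h.1 m (by omega), card_bot]

theorem X_pow_dvd_hookFactor_sub_one {i j : ℤ} {d : ℕ} (h : (d : ℤ) < j - i) :
    (PowerSeries.X ^ (d + 1) : PowerSeries ℤ) ∣ G.hookFactor i j - 1 := by
  have hd : d + 1 ≤ (j - i).toNat := by omega
  rw [hookFactor]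
  split_ifs
  · rw [add_sub_cancel_left]
    exact pow_dvd_pow _ hd
  · have h1 : (1 - PowerSeries.X ^ (j - i).toNat : PowerSeries ℤ) *
        PowerSeries.invOfUnit (1 - PowerSeries.X ^ (j - i).toNat) 1 = 1 := by
      apply PowerSeries.mul_invOfUnit
      simp [show (j - i).toNat ≠ 0 by omega]
    have h2 : PowerSeries.invOfUnit (1 - PowerSeries.X ^ (j - i).toNat) 1 - 1 =
        (PowerSeries.X ^ (j - i).toNat : PowerSeries ℤ) *
          PowerSeries.invOfUnit (1 - PowerSeries.X ^ (j - i).toNat) 1 := by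
      linear_combination h1
    rw [h2]
    exact (pow_dvd_pow _ hd).mul_right _

/-- The factors with `j - i > d` are congruent to `1` modulo `X ^ (d + 1)` and do not affect the
coefficient. -/
theorem coeff_prod_hookFactor {d : ℕ} {F F' : Finset G.hooks} (hF : F ⊆ F')
    (h : ∀ p : G.hooks, p.1.2 - p.1.1 ≤ d → p ∈ F) :
    PowerSeries.coeff d (∏ p ∈ F', G.hookFactor p.1.1 p.1.2) =
      PowerSeries.coeff d (∏ p ∈ F, G.hookFactor p.1.1 p.1.2) := by
  classical
  have h1 : (PowerSeries.X ^ (d + 1) : PowerSeries ℤ) ∣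
      ∏ p ∈ F' \ F, G.hookFactor p.1.1 p.1.2 - 1 := by
    refine Finset.prod_induction (fun p : G.hooks => G.hookFactor p.1.1 p.1.2)
      (fun f => (PowerSeries.X ^ (d + 1) : PowerSeries ℤ) ∣ f - 1) ?_ (by simp) ?_
    · intro f g hf hg
      have : f * g - 1 = (f - 1) * g + (g - 1) := by ring
      rw [this]
      exact dvd_add (hf.mul_right _) hg
    · intro p hp
      refine X_pow_dvd_hookFactor_sub_one ?_
      by_contra hc
      exact (Finset.mem_sdiff.1 hp).2 (h p (by omega))
  rw [← sub_eq_zero, ← map_sub, ← Finset.prod_sdiff hF, ← sub_one_mul]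
  exact PowerSeries.X_pow_dvd_iff.1 (h1.mul_right _) d (Nat.lt_succ_self d)

/-- Minus signs occur only from some `A` on, and plus signs only up to some `B`, either because the
bound of the graph is finite or by the finiteness condition. With `j - i ≤ d` this confines both
ends of a hook. -/
theorem FinitenessCondition.finite_hooks (hG : G.FinitenessCondition) (d : ℕ) :
    {p : G.hooks | p.1.2 - p.1.1 ≤ d}.Finite := by
  obtain ⟨A, hA⟩ : ∃ A : ℤ, ∀ j ∈ G.cols, G.b j = .minus → A ≤ j := by
    rcases hlo : G.lo with _ | l
    · obtain ⟨A, hA⟩ := hG.1 hlo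
      refine ⟨A, fun j hj hb => ?_⟩
      by_contra hc
      have := hA j hj (by omega)
      rw [hb] at this
      exact absurd this (by decide)
    · refine ⟨l, fun j hj _ => ?_⟩
      have := hj.1
      rw [hlo] at this
      exact WithBot.coe_le_coe.1 this
  obtain ⟨B, hB⟩ : ∃ B : ℤ, ∀ i ∈ G.cols, G.b i = .plus → i ≤ B := by
    rcases hhi : G.hi with _ | r
    · obtain ⟨B, hB⟩ := hG.2 hhi
      refine ⟨B, fun i hi hb => ?_⟩
      by_contra hc
      have := hB i hi (by omega)
      rw [hb] at this
      exact absurd this (by decide)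
    · refine ⟨r, fun i hi _ => ?_⟩
      have := hi.2
      rw [hhi] at this
      exact WithTop.coe_le_coe.1 this
  refine Set.Finite.of_injOn (f := Subtype.val) (t := Set.Icc (A - d) B ×ˢ Set.Icc A (B + d)) ?_
    Subtype.val_injective.injOn ((Set.finite_Icc _ _).prod (Set.finite_Icc _ _))
  rintro ⟨⟨i, j⟩, hi, hj, hij, hbi, hbj⟩ hd
  have h1 := hA j hj hbj
  have h2 := hB i hi hbi
  simp only [Set.mem_ofPred_eq] at hd
  simp only [Set.mem_prod, Set.mem_Icc]
  omega

/-- The states of a given size are counted by the coefficients of the product of hook factors. -/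
theorem FinitenessCondition.exists_coeff (hG : G.FinitenessCondition) (d : ℕ) :
    ∃ F : Finset G.hooks,
      (∀ F', F ⊆ F' → PowerSeries.coeff d (∏ p ∈ F', G.hookFactor p.1.1 p.1.2) =
        ({Λ | G.IsState Λ ∧ stateSize Λ = d}.ncard : ℤ)) ∧
      {Λ | G.IsState Λ ∧ stateSize Λ = d}.Finite := by
  classical
  have hfin := hG.finite_hooks d
  set F : Finset G.hooks := hfin.toFinset with hF
  have hFmem : ∀ p : G.hooks, p.1.2 - p.1.1 ≤ d → p ∈ F := fun p hp => by
    rw [hF, Set.Finite.mem_toFinset]; exact hp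
  let S : Set ℤ := (fun p : G.hooks => p.1.1) '' F ∪ (fun p : G.hooks => p.1.2) '' F
  have hSfin : S.Finite := ((Finset.finite_toSet F).image _).union ((Finset.finite_toSet F).image _)
  have hSc : S ⊆ G.cols := by
    rintro m (⟨p, -, rfl⟩ | ⟨p, -, rfl⟩)
    · exact p.2.1
    · exact p.2.2.1
  obtain ⟨l₀, r₀, hlr₀, hl₀, hr₀, hS⟩ := exists_window hSfin hSc
  let A : ℤ → ℤ → Set (ℤ → YoungDiagram) := fun l r =>
    {Λ | G.IsSeq (Equiv.refl ℤ) l r Λ ∧ stateSize Λ = d}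
  -- On every window that contains the hooks of length at most `d`, the number of sequences with `d`
  -- cells is one and the same coefficient.
  have key : ∀ l r, l ∈ G.cols → r ∈ G.cols → l ≤ l₀ → r₀ ≤ r → (A l r).Finite ∧
      PowerSeries.coeff d (∏ p ∈ F, G.hookFactor p.1.1 p.1.2) = ((A l r).ncard : ℤ) := by
    intro l r hl hr hll hrr
    have hgen := isGenFun_seqWeight_perm (G := G) _ (Equiv.refl ℤ) l r (fun m hm => hm)
      (fun p hp => (mem_hooksIn.1 hp).2.1) rfl
    have hA : A l r = Subtype.val '' {Λ : {Λ // G.IsSeq (Equiv.refl ℤ) l r Λ} |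
        seqWeight (Equiv.refl ℤ) l r Λ.1 = d} := by
      ext Λ
      constructor
      · rintro ⟨h1, h2⟩
        exact ⟨⟨Λ, h1⟩, by rw [Set.mem_ofPred_eq, h1.seqWeight_eq, h2], rfl⟩
      · rintro ⟨⟨Λ, h1⟩, h2, rfl⟩
        rw [Set.mem_ofPred_eq, h1.seqWeight_eq] at h2
        exact ⟨h1, by exact_mod_cast h2⟩
    have hprod : ∏ p ∈ G.hooksIn (Equiv.refl ℤ) l r, G.hookFactor p.1 p.2 =
        ∏ p ∈ (G.hooksIn (Equiv.refl ℤ) l r).subtype (· ∈ G.hooks),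
          G.hookFactor p.1.1 p.1.2 := by
      rw [Finset.prod_subtype_of_mem (fun p : ℤ × ℤ => G.hookFactor p.1 p.2)]
      intro p hp
      rw [mem_hooksIn] at hp
      exact ⟨mem_cols_of_le_of_le hl hr hp.1.1.1 hp.1.1.2,
        mem_cols_of_le_of_le hl hr hp.1.2.1 hp.1.2.2, hp.2.1, hp.2.2⟩
    rw [hA, Set.ncard_image_of_injective _ Subtype.val_injective, ← (hgen.2 d).2, hprod]
    refine ⟨(hgen.2 d).1.image _, (coeff_prod_hookFactor ?_ hFmem).symm⟩
    intro p hp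
    rw [Finset.mem_subtype, mem_hooksIn]
    have h1 := hS p.1.1 (Or.inl ⟨p, hp, rfl⟩)
    have h2 := hS p.1.2 (Or.inr ⟨p, hp, rfl⟩)
    exact ⟨⟨⟨by omega, by omega⟩, by omega, by omega⟩, p.2.2.2.1, p.2.2.2.2⟩
  have heq : {Λ | G.IsState Λ ∧ stateSize Λ = d} = A l₀ r₀ := by
    ext Λ
    constructor
    · rintro ⟨h1, h2⟩
      -- The shifted support is included because a sequence on `[l..r]` must be trivial at `r`
      -- itself.
      have hT : ({l₀, r₀} ∪ {m | Λ m ≠ ⊥} ∪ (· + 1) '' {m | Λ m ≠ ⊥}).Finite :=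
        ((Set.toFinite _).union h1.finite).union (h1.finite.image _)
      have hTc : {l₀, r₀} ∪ {m | Λ m ≠ ⊥} ∪ (· + 1) '' {m | Λ m ≠ ⊥} ⊆ G.cols := by
        have hne : ∀ m, Λ m ≠ ⊥ → m ∈ G.cols ∧ m + 1 ∈ G.cols := fun m hm => by
          by_contra hc
          exact hm (h1.eq_bot m hc)
        rintro m (((rfl | rfl) | hm) | ⟨m, hm, rfl⟩)
        · exact hl₀
        · exact hr₀
        · exact (hne m hm).1
        · exact (hne m hm).2
      obtain ⟨l, r, hlr, hl, hr, hw⟩ := exists_window hT hTc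
      have e1 := hw l₀ (by simp)
      have e2 := hw r₀ (by simp)
      have hk₀ := key l₀ r₀ hl₀ hr₀ le_rfl le_rfl
      have hk := key l r hl hr e1.1 e2.2
      -- Enlarging the window to contain a given state does not change the finite number of
      -- sequences with `d` cells, so the inclusion is an equality and the state already lives on
      -- `[l₀..r₀]`.
      have hsub : A l₀ r₀ ⊆ A l r := by
        rintro M ⟨hM, hM'⟩
        refine ⟨(hM.isState hl₀ hr₀).isSeq hl hr fun m hm => ?_, hM'⟩
        by_contra hc
        exact hm (hM.1 m (by omega))
      have hle : (A l r).ncard ≤ (A l₀ r₀).ncard := by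
        have := hk.2.symm.trans hk₀.2
        exact_mod_cast this.le
      rw [Set.eq_of_subset_of_ncard_le hsub hle hk.1]
      refine ⟨h1.isSeq hl hr fun m hm => ?_, h2⟩
      have e3 := hw m (Or.inl (Or.inr hm))
      have e4 := hw (m + 1) (Or.inr ⟨m, hm, rfl⟩)
      omega
    · rintro ⟨h1, h2⟩
      exact ⟨h1.isState hl₀ hr₀, h2⟩
  have hk₀ := key l₀ r₀ hl₀ hr₀ le_rfl le_rfl
  rw [heq]
  exact ⟨F, fun F' hF' => (coeff_prod_hookFactor hF' hFmem).trans hk₀.2, hk₀.1⟩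

/-- The generating function of objects that are in bijection with the states. -/
theorem FinitenessCondition.hasSum_and_hasProd (hG : G.FinitenessCondition) {P : Type*}
    (e : P ≃ {Λ // G.IsState Λ}) {v : P → ℕ} (hv : ∀ x, v x = stateSize (e x).1) :
    ∃ Z : PowerSeries ℤ, HasSum (fun x => (PowerSeries.X : PowerSeries ℤ) ^ v x) Z ∧
      HasProd (fun p : G.hooks => G.hookFactor p.1.1 p.1.2) Z := by
  classical
  choose F hF hfin using hG.exists_coeff
  refine ⟨PowerSeries.mk fun d => ({Λ | G.IsState Λ ∧ stateSize Λ = d}.ncard : ℤ), ?_, ?_⟩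
  · rw [PowerSeries.WithPiTopology.hasSum_iff_hasSum_coeff]
    intro d
    rw [PowerSeries.coeff_mk]
    have himg : {Λ | G.IsState Λ ∧ stateSize Λ = d} =
        (fun x => (e x).1) '' {x | v x = d} := by
      ext Λ
      constructor
      · rintro ⟨h1, h2⟩
        exact ⟨e.symm ⟨Λ, h1⟩, by simp [hv, h2], by simp⟩
      · rintro ⟨x, hx, rfl⟩
        exact ⟨(e x).2, (hv x).symm.trans hx⟩
    have hinj : Function.Injective fun x => (e x).1 := Subtype.val_injective.comp e.injective
    have hfin' : {x | v x = d}.Finite := by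
      have := hfin d
      rw [himg] at this
      exact this.of_finite_image hinj.injOn
    rw [himg, Set.ncard_image_of_injective _ hinj, Set.ncard_eq_toFinset_card _ hfin',
      Finset.card_eq_sum_ones, Nat.cast_sum]
    have : ∀ x ∈ hfin'.toFinset, ((1 : ℕ) : ℤ) =
        PowerSeries.coeff d ((PowerSeries.X : PowerSeries ℤ) ^ v x) := by
      intro x hx
      rw [Set.Finite.mem_toFinset, Set.mem_ofPred_eq] at hx
      rw [hx, PowerSeries.coeff_X_pow_self, Nat.cast_one]
    rw [Finset.sum_congr rfl this]
    refine hasSum_sum_of_ne_finset_zero fun x hx => ?_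
    rw [Set.Finite.mem_toFinset, Set.mem_ofPred_eq] at hx
    rw [PowerSeries.coeff_X_pow, if_neg (Ne.symm hx)]
  · rw [HasProd, SummationFilter.unconditional_filter,
      PowerSeries.WithPiTopology.tendsto_iff_coeff_tendsto]
    intro d
    refine tendsto_const_nhds.congr' ?_
    -- Each coefficient of the partial products is eventually constant, which is convergence because
    -- coefficients are discrete.
    filter_upwards [Filter.eventually_ge_atTop (F d)] with F' hF'
    rw [hF d F' hF', PowerSeries.coeff_mk]

end RailYard

/-! ### Height functions of Young diagrams -/

namespace YoungDiagram

/-- The height function of a diagram: the number of particles at the levels `≥ k` in the Maya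
diagram that encodes `x`. -/
def height (x : YoungDiagram) (k : ℤ) : ℤ :=
  max 0 (-k) + ((x.cells.filter fun c => (c.2 : ℤ) - c.1 = k).card : ℤ)

theorem mem_iff_lt_card_of_lower {s : Finset ℕ} (hs : ∀ n ∈ s, ∀ m ≤ n, m ∈ s) (n : ℕ) :
    n ∈ s ↔ n < s.card := by
  constructor
  · intro hn
    have : Finset.range (n + 1) ⊆ s := fun m hm => hs n hn m (by simpa [Nat.lt_succ_iff] using hm)
    simpa using Finset.card_le_card this
  · intro hn
    by_contra hc
    have : s ⊆ Finset.range n := fun m hm => by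
      rw [Finset.mem_range]
      by_contra hmn
      exact hc (hs m hm n (by omega))
    have := Finset.card_le_card this
    rw [Finset.card_range] at this
    omega

/-- The cells of a diagram with content `k = j - i` fill an initial part of their diagonal, on which
`(i, j)` has rank `min i j`, counted from `0`. Finally `i = max 0 (-k) + min i j`. -/
theorem mem_iff_lt_height {x : YoungDiagram} {i j : ℕ} :
    (i, j) ∈ x ↔ (i : ℤ) < x.height (j - i) := by
  classical
  set D := x.cells.filter fun c => (c.2 : ℤ) - c.1 = (j : ℤ) - i with hD
  have hDmem : ∀ c : ℕ × ℕ, c ∈ D ↔ c ∈ x ∧ (c.2 : ℤ) - c.1 = (j : ℤ) - i := fun c => by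
    rw [hD, Finset.mem_filter, mem_cells]
  have hinj : Set.InjOn (fun c : ℕ × ℕ => min c.1 c.2) D := by
    rintro ⟨p, q⟩ hc ⟨p', q'⟩ hc' h
    rw [Finset.mem_coe, hDmem] at hc hc'
    have h1 := hc.2
    have h2 := hc'.2
    simp only at h h1 h2
    simp only [Prod.mk.injEq]
    omega
  have hlow : ∀ n ∈ D.image (fun c : ℕ × ℕ => min c.1 c.2), ∀ m ≤ n,
      m ∈ D.image (fun c : ℕ × ℕ => min c.1 c.2) := by
    intro n hn m hm
    obtain ⟨⟨p, q⟩, hc, rfl⟩ := Finset.mem_image.1 hn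
    rw [hDmem] at hc
    simp only at hm hc
    refine Finset.mem_image.2 ⟨(p - (min p q - m), q - (min p q - m)), ?_, ?_⟩
    · rw [hDmem]
      exact ⟨x.up_left_mem (Nat.sub_le _ _) (Nat.sub_le _ _) hc.1, by simp only; omega⟩
    · simp only; omega
  have hmem : (i, j) ∈ x ↔ min i j ∈ D.image (fun c : ℕ × ℕ => min c.1 c.2) := by
    constructor
    · intro h
      exact Finset.mem_image.2 ⟨(i, j), (hDmem _).2 ⟨h, rfl⟩, rfl⟩
    · intro h
      obtain ⟨⟨p, q⟩, hc, hpq⟩ := Finset.mem_image.1 h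
      rw [hDmem] at hc
      have h1 := hc.2
      simp only at hpq h1
      have e1 : p = i := by omega
      have e2 : q = j := by omega
      rw [← e1, ← e2]
      exact hc.1
  rw [hmem, mem_iff_lt_card_of_lower hlow, Finset.card_image_of_injOn hinj, height, ← hD]
  omega

theorem height_nonneg (x : YoungDiagram) (k : ℤ) : 0 ≤ x.height k :=
  add_nonneg (le_max_left _ _) (Nat.cast_nonneg _)

theorem neg_le_height (x : YoungDiagram) (k : ℤ) : -k ≤ x.height k :=
  (le_max_right _ _).trans (le_add_of_nonneg_right (Nat.cast_nonneg _))

theorem height_bot (k : ℤ) : (⊥ : YoungDiagram).height k = max 0 (-k) := by simp [height]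

theorem lt_height_iff {x : YoungDiagram} {h k : ℤ} (h0 : 0 ≤ h) (hk : 0 ≤ h + k) :
    h < x.height k ↔ (h.toNat, (h + k).toNat) ∈ x := by
  rw [mem_iff_lt_height, Int.toNat_of_nonneg h0, Int.toNat_of_nonneg hk, add_sub_cancel_left]

theorem height_succ_le (x : YoungDiagram) (k : ℤ) : x.height (k + 1) ≤ x.height k := by
  by_contra! hc
  have h0 := x.height_nonneg k
  have h1 := x.neg_le_height k
  rw [lt_height_iff h0 (by omega)] at hc
  exact lt_irrefl _ ((lt_height_iff h0 (by omega)).2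
    (x.up_left_mem le_rfl (Int.toNat_le_toNat (by omega)) hc))

theorem height_le_succ (x : YoungDiagram) (k : ℤ) : x.height k ≤ x.height (k + 1) + 1 := by
  by_contra! hc
  have h0 := x.height_nonneg (k + 1)
  have h1 := x.neg_le_height (k + 1)
  rw [lt_height_iff (by omega) (by omega)] at hc
  exact lt_irrefl _ ((lt_height_iff h0 (by omega)).2
    (x.up_left_mem (Int.toNat_le_toNat (by omega)) (Int.toNat_le_toNat (by omega)) hc))

theorem le_iff_height {x y : YoungDiagram} : x ≤ y ↔ ∀ k, x.height k ≤ y.height k := by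
  constructor
  · intro h k
    by_contra! hc
    have h0 := y.height_nonneg k
    have h1 := y.neg_le_height k
    rw [lt_height_iff h0 (by omega)] at hc
    exact lt_irrefl _ ((lt_height_iff h0 (by omega)).2 (h hc))
  · rintro h ⟨i, j⟩ hx
    exact mem_iff_lt_height.2 ((mem_iff_lt_height.1 hx).trans_le (h _))

theorem height_injective : Function.Injective height := fun _ _ h =>
  le_antisymm (le_iff_height.2 fun k => (congrFun h k).le)
    (le_iff_height.2 fun k => (congrFun h k).ge)

/-- The slopes of `N` say that `N k` decreases and `N k + k` increases, so the cells with `i < N (j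
- i)` form a lower set. Comparison with far levels, where `N` is the vacuum height, shows that `N`
is nowhere below that height. -/
theorem exists_height_eq {N : ℤ → ℤ} (h1 : ∀ k, N (k + 1) ≤ N k) (h2 : ∀ k, N k ≤ N (k + 1) + 1)
    (hf : {k | N k ≠ max 0 (-k)}.Finite) : ∃ x : YoungDiagram, x.height = N := by
  have hanti : Antitone N := antitone_int_of_succ_le h1
  have hmono : Monotone fun k => N k + k := monotone_int_of_le_succ fun k => by
    have := h2 k; omega
  have hge : ∀ k, 0 ≤ N k ∧ -k ≤ N k := by
    intro k
    obtain ⟨A, hA⟩ := hf.bddAbove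
    obtain ⟨B, hB⟩ := hf.bddBelow
    have e1 : N (max k (max 0 (A + 1))) = max 0 (-(max k (max 0 (A + 1)))) := by
      by_contra hc
      have := hA hc
      omega
    have e2 : N (min k (min 0 (B - 1))) = max 0 (-(min k (min 0 (B - 1)))) := by
      by_contra hc
      have := hB hc
      omega
    have e3 := hanti (le_max_left k (max 0 (A + 1)))
    have e4 := hmono (min_le_left k (min 0 (B - 1)))
    simp only at e4
    omega
  have hfin : {c : ℕ × ℕ | (c.1 : ℤ) < N (c.2 - c.1)}.Finite := by
    -- Since `i` is at least `max 0 (i - j)`, such a cell can occur only at contents where `N`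
    -- differs from the vacuum height.
    refine (hf.biUnion (t := fun k => (fun i : ℕ => (i, ((i : ℤ) + k).toNat)) ''
      Set.Iio (N k).toNat) fun k _ => (Set.finite_Iio _).image _).subset ?_
    rintro ⟨i, j⟩ h
    simp only [Set.mem_ofPred_eq] at h
    simp only [Set.mem_iUnion]
    refine ⟨(j : ℤ) - i, ?_, i, ?_, ?_⟩
    · intro hc
      omega
    · rw [Set.mem_Iio]; omega
    · simp
  refine ⟨⟨hfin.toFinset, ?_⟩, funext fun k => ?_⟩
  · rintro ⟨i, j⟩ ⟨i', j'⟩ ⟨hi, hj⟩ h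
    simp only [Set.Finite.coe_toFinset, Set.mem_ofPred_eq] at h ⊢
    simp only at hi hj
    have e1 : N ((j : ℤ) - i') ≤ N (j' - i') := hanti (by omega)
    have e2 := hmono (show (j : ℤ) - i ≤ j - i' by omega)
    simp only at e2
    omega
  · set x : YoungDiagram := ⟨hfin.toFinset, _⟩ with hx
    have hmem : ∀ h, 0 ≤ h → 0 ≤ h + k → (h < x.height k ↔ h < N k) := by
      intro h h0 hk
      rw [lt_height_iff h0 hk, hx, mem_mk, Set.Finite.mem_toFinset, Set.mem_ofPred_eq]
      simp only [Int.toNat_of_nonneg h0, Int.toNat_of_nonneg hk, add_sub_cancel_left]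
    have a1 := x.height_nonneg k
    have a2 := x.neg_le_height k
    have a3 := hge k
    have a4 := hmem _ a1 (by omega)
    have a5 := hmem (N k) a3.1 (by omega)
    have : x.height k = N k := by omega
    exact this

end YoungDiagram

namespace LR

open YoungDiagram

/-- Going from `(i, j)` to `(i + 1, j)` lowers the content by one and raises the row index by one,
whence the shift of `k` and the added `1`. In the vertical case `R`, the move along a row shifts the
content only. -/
theorem interlace_L_iff_height {x y : YoungDiagram} : LR.L.Interlace x y ↔
    ∀ k, x.height k ≤ y.height k ∧ y.height k ≤ x.height (k + 1) + 1 := by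
  rw [Interlace, le_iff_height, forall_and]
  refine and_congr_right fun _ => ⟨fun h k => ?_, fun h i j hy => ?_⟩
  · by_contra! hc
    have h0 := x.height_nonneg (k + 1)
    have h1 := x.neg_le_height (k + 1)
    rw [lt_height_iff (by omega) (by omega)] at hc
    have e1 : (x.height (k + 1) + 1).toNat = (x.height (k + 1)).toNat + 1 := by omega
    rw [e1] at hc
    have := h _ _ hc
    refine lt_irrefl (x.height (k + 1)) ((lt_height_iff h0 (by omega)).2 ?_)
    convert this using 3
    omega
  · rw [mem_iff_lt_height] at hy ⊢
    have := h ((j : ℤ) - (i + 1 : ℕ))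
    have e : (j : ℤ) - (i + 1 : ℕ) + 1 = j - i := by push_cast; ring
    rw [e] at this
    push_cast at hy this ⊢
    omega

theorem interlace_R_iff_height {x y : YoungDiagram} : LR.R.Interlace x y ↔
    ∀ k, x.height k ≤ y.height k ∧ y.height (k + 1) ≤ x.height k := by
  rw [Interlace, le_iff_height, forall_and]
  refine and_congr_right fun _ => ⟨fun h k => ?_, fun h i j hy => ?_⟩
  · by_contra! hc
    have h0 := x.height_nonneg k
    have h1 := x.neg_le_height k
    rw [lt_height_iff h0 (by omega)] at hc
    have e1 : (x.height k + (k + 1)).toNat = (x.height k + k).toNat + 1 := by omega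
    rw [e1] at hc
    exact lt_irrefl _ ((lt_height_iff h0 (by omega)).2 (h _ _ hc))
  · rw [mem_iff_lt_height] at hy ⊢
    have := h ((j : ℤ) - i)
    have e : (j : ℤ) - i + 1 = (j + 1 : ℕ) - i := by push_cast; ring
    rw [e] at this
    omega

end LR

/-! ### Edges of rail yard graphs and degrees of vertices -/

namespace RailYard

variable (G : RailYard)

/-- The left horizontal edge at the even vertex `(2m, k)`. -/
def leftEdge (m k : ℤ) : RYEdge := ((2 * m, k), (2 * m - 1, k))

/-- The right horizontal edge at the even vertex `(2m, k)`. -/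
def rightEdge (m k : ℤ) : RYEdge := ((2 * m, k), (2 * m + 1, k))

/-- The diagonal edge at the even vertex `(2m, k)`. -/
def diagEdge (m k : ℤ) : RYEdge := ((2 * m, k), G.diagEnd m k)

/-- The edges of all rail yard graphs with the sequences of `G`. -/
def allEdges : Set RYEdge := {e | ∃ m, e ∈ G.columnEdges m}

variable {G}

theorem edges_subset_allEdges : G.edges ⊆ G.allEdges := fun _ ⟨m, _, h⟩ => ⟨m, h⟩

theorem diagEnd_of_L {m : ℤ} (h : G.a m = .L) (k : ℤ) :
    G.diagEnd m k = (2 * m - 1, k + (G.b m).toInt) := by rw [diagEnd, h]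

theorem diagEnd_of_R {m : ℤ} (h : G.a m = .R) (k : ℤ) :
    G.diagEnd m k = (2 * m + 1, k + (G.b m).toInt) := by rw [diagEnd, h]

theorem _root_.Sgn.toInt_eq (s : Sgn) : s.toInt = 1 ∨ s.toInt = -1 := by
  cases s
  · exact Or.inl rfl
  · exact Or.inr rfl

theorem diagEnd_snd (m k : ℤ) : (G.diagEnd m k).2 = k + (G.b m).toInt := by
  rw [diagEnd]; cases G.a m <;> rfl

theorem not_isHorizontal_diagEdge (m k : ℤ) : ¬ (G.diagEdge m k).IsHorizontal := by
  rw [RYEdge.IsHorizontal, diagEdge]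
  simp only [diagEnd_snd]
  have := (G.b m).toInt_eq
  omega

theorem isHorizontal_leftEdge (m k : ℤ) : (leftEdge m k).IsHorizontal := rfl

theorem isHorizontal_rightEdge (m k : ℤ) : (rightEdge m k).IsHorizontal := rfl

theorem leftEdge_ne_diagEdge (m k m' k' : ℤ) : leftEdge m k ≠ G.diagEdge m' k' := fun h =>
  not_isHorizontal_diagEdge m' k' (h ▸ isHorizontal_leftEdge m k)

theorem rightEdge_ne_diagEdge (m k m' k' : ℤ) : rightEdge m k ≠ G.diagEdge m' k' := fun h =>
  not_isHorizontal_diagEdge m' k' (h ▸ isHorizontal_rightEdge m k)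

theorem leftEdge_ne_rightEdge (m k m' k' : ℤ) : leftEdge m k ≠ rightEdge m' k' := by
  simp only [leftEdge, rightEdge, ne_eq, Prod.mk.injEq]
  omega

theorem leftEdge_inj {m k m' k' : ℤ} : leftEdge m k = leftEdge m' k' ↔ m = m' ∧ k = k' := by
  simp only [leftEdge, Prod.mk.injEq]
  omega

theorem rightEdge_inj {m k m' k' : ℤ} : rightEdge m k = rightEdge m' k' ↔ m = m' ∧ k = k' := by
  simp only [rightEdge, Prod.mk.injEq]
  omega

theorem diagEdge_inj {m k m' k' : ℤ} :
    G.diagEdge m k = G.diagEdge m' k' ↔ m = m' ∧ k = k' := by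
  constructor
  · intro h
    have := congrArg Prod.fst h
    simp only [diagEdge, Prod.mk.injEq] at this
    omega
  · rintro ⟨rfl, rfl⟩; rfl

theorem fst_of_mem_columnEdges {m : ℤ} {e : RYEdge} (h : e ∈ G.columnEdges m) :
    e.1.1 = 2 * m := by
  obtain ⟨k, rfl | rfl | rfl⟩ := h <;> rfl

theorem leftEdge_mem_columnEdges {m m' k : ℤ} : leftEdge m k ∈ G.columnEdges m' ↔ m = m' := by
  constructor
  · intro h; have := fst_of_mem_columnEdges h; simp only [leftEdge] at this; omega
  · rintro rfl; exact ⟨k, Or.inl rfl⟩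

theorem rightEdge_mem_columnEdges {m m' k : ℤ} : rightEdge m k ∈ G.columnEdges m' ↔ m = m' := by
  constructor
  · intro h; have := fst_of_mem_columnEdges h; simp only [rightEdge] at this; omega
  · rintro rfl; exact ⟨k, Or.inr (Or.inl rfl)⟩

theorem diagEdge_mem_columnEdges {m m' k : ℤ} : G.diagEdge m k ∈ G.columnEdges m' ↔ m = m' := by
  constructor
  · intro h; have := fst_of_mem_columnEdges h; simp only [diagEdge] at this; omega
  · rintro rfl; exact ⟨k, Or.inr (Or.inr rfl)⟩

theorem eq_of_fst_eq {m k : ℤ} {e : RYEdge} (he : e ∈ G.allEdges) (h : e.1 = (2 * m, k)) :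
    e = leftEdge m k ∨ e = rightEdge m k ∨ e = G.diagEdge m k := by
  obtain ⟨m', k', he⟩ := he
  have : (2 * m', k') = (2 * m, k) := by
    rw [← h]; rcases he with rfl | rfl | rfl <;> rfl
  rw [Prod.mk.injEq] at this
  obtain ⟨h1, rfl⟩ := this
  obtain rfl : m' = m := by omega
  exact he

theorem snd_eq_iff {m k : ℤ} {e : RYEdge} (he : e ∈ G.allEdges) :
    e.2 = (2 * m + 1, k) ↔
      e = rightEdge m k ∨ (G.a m = .R ∧ e = G.diagEdge m (k - (G.b m).toInt)) ∨
      e = leftEdge (m + 1) k ∨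
      (G.a (m + 1) = .L ∧ e = G.diagEdge (m + 1) (k - (G.b (m + 1)).toInt)) := by
  constructor
  · intro h
    obtain ⟨m', k', rfl | rfl | rfl⟩ := he
    · simp only [Prod.mk.injEq] at h
      obtain rfl : m' = m + 1 := by omega
      exact Or.inr (Or.inr (Or.inl (by rw [leftEdge, h.2])))
    · simp only [Prod.mk.injEq] at h
      obtain rfl : m' = m := by omega
      exact Or.inl (by rw [rightEdge, h.2])
    · cases ha : G.a m' with
      | L =>
        simp only [diagEnd_of_L ha, Prod.mk.injEq] at h
        obtain rfl : m' = m + 1 := by omega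
        exact Or.inr (Or.inr (Or.inr ⟨ha, by rw [diagEdge, ← h.2, add_sub_cancel_right]⟩))
      | R =>
        simp only [diagEnd_of_R ha, Prod.mk.injEq] at h
        obtain rfl : m' = m := by omega
        exact Or.inr (Or.inl ⟨ha, by rw [diagEdge, ← h.2, add_sub_cancel_right]⟩)
  · rintro (rfl | ⟨ha, rfl⟩ | rfl | ⟨ha, rfl⟩)
    · rfl
    · rw [diagEdge, diagEnd_of_R ha, sub_add_cancel]
    · exact Prod.ext (show 2 * (m + 1) - 1 = 2 * m + 1 by ring) rfl
    · rw [diagEdge, diagEnd_of_L ha, sub_add_cancel]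
      exact Prod.ext (show 2 * (m + 1) - 1 = 2 * m + 1 by ring) rfl

open scoped Classical in
/-- The indicator function of a set of edges. -/
noncomputable def ind (C : Set RYEdge) (e : RYEdge) : ℤ := if e ∈ C then 1 else 0

theorem ind_of_mem {C : Set RYEdge} {e : RYEdge} (h : e ∈ C) : ind C e = 1 := if_pos h

theorem ind_of_notMem {C : Set RYEdge} {e : RYEdge} (h : e ∉ C) : ind C e = 0 := if_neg h

theorem ind_eq_one {C : Set RYEdge} {e : RYEdge} : ind C e = 1 ↔ e ∈ C := by
  by_cases h : e ∈ C <;> simp [ind, h]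

theorem ind_mem (C : Set RYEdge) (e : RYEdge) : ind C e = 0 ∨ ind C e = 1 := by
  by_cases h : e ∈ C <;> simp [ind, h]

variable (G) in
/-- The number of edges of `C` at the even vertex `(2m, k)`. -/
noncomputable def evenDeg (C : Set RYEdge) (m k : ℤ) : ℤ :=
  ind C (leftEdge m k) + ind C (rightEdge m k) + ind C (G.diagEdge m k)

variable (G) in
/-- The number of edges of `C` that join `(2m - 1, k)` to the column `m`. -/
noncomputable def leftDeg (C : Set RYEdge) (m k : ℤ) : ℤ :=
  ind C (leftEdge m k) + if G.a m = .L then ind C (G.diagEdge m (k - (G.b m).toInt)) else 0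

variable (G) in
/-- The number of edges of `C` that join `(2m + 1, k)` to the column `m`. -/
noncomputable def rightDeg (C : Set RYEdge) (m k : ℤ) : ℤ :=
  ind C (rightEdge m k) + if G.a m = .R then ind C (G.diagEdge m (k - (G.b m).toInt)) else 0

theorem leftDeg_add_rightDeg (C : Set RYEdge) (m k : ℤ) :
    G.leftDeg C m k + G.rightDeg C m k = ind C (leftEdge m k) + ind C (rightEdge m k) +
      ind C (G.diagEdge m (k - (G.b m).toInt)) := by
  rw [leftDeg, rightDeg]
  cases G.a m
  · rw [if_pos rfl, if_neg (by decide)]; ring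
  · rw [if_pos rfl, if_neg (by decide)]; ring

theorem leftDeg_nonneg (C : Set RYEdge) (m k : ℤ) : 0 ≤ G.leftDeg C m k := by
  have h1 := ind_mem C (leftEdge m k)
  have h2 := ind_mem C (G.diagEdge m (k - (G.b m).toInt))
  rw [leftDeg]
  split_ifs <;> omega

theorem rightDeg_nonneg (C : Set RYEdge) (m k : ℤ) : 0 ≤ G.rightDeg C m k := by
  have h1 := ind_mem C (rightEdge m k)
  have h2 := ind_mem C (G.diagEdge m (k - (G.b m).toInt))
  rw [rightDeg]
  split_ifs <;> omega

theorem fst_ne_odd {e : RYEdge} (he : e ∈ G.allEdges) (m k : ℤ) : e.1 ≠ (2 * m + 1, k) := by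
  intro h
  obtain ⟨m', h'⟩ := he
  have := fst_of_mem_columnEdges h'
  rw [h] at this
  simp only at this
  omega

theorem snd_ne_even {e : RYEdge} (he : e ∈ G.allEdges) (m k : ℤ) : e.2 ≠ (2 * m, k) := by
  intro h
  obtain ⟨m', k', rfl | rfl | rfl⟩ := he
  · simp only [Prod.mk.injEq] at h; omega
  · simp only [Prod.mk.injEq] at h; omega
  · cases ha : G.a m' with
    | L => simp only [diagEnd_of_L ha, Prod.mk.injEq] at h; omega
    | R => simp only [diagEnd_of_R ha, Prod.mk.injEq] at h; omega

theorem covers_even_iff {C : Set RYEdge} (hC : C ⊆ G.allEdges) {m k : ℤ} :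
    RYCovers C (2 * m, k) ↔ 1 ≤ G.evenDeg C m k := by
  have h1 := ind_mem C (leftEdge m k)
  have h2 := ind_mem C (rightEdge m k)
  have h3 := ind_mem C (G.diagEdge m k)
  rw [evenDeg]
  constructor
  · rintro ⟨e, he, h | h⟩
    · rcases eq_of_fst_eq (hC he) h with rfl | rfl | rfl
      all_goals have := ind_of_mem he; omega
    · exact absurd h (snd_ne_even (hC he) m k)
  · intro h
    obtain h | h | h : ind C (leftEdge m k) = 1 ∨ ind C (rightEdge m k) = 1 ∨
      ind C (G.diagEdge m k) = 1 := by omega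
    all_goals exact ⟨_, ind_eq_one.1 h, Or.inl rfl⟩

theorem covers_odd_iff {C : Set RYEdge} (hC : C ⊆ G.allEdges) {m k : ℤ} :
    RYCovers C (2 * m + 1, k) ↔ 1 ≤ G.rightDeg C m k + G.leftDeg C (m + 1) k := by
  have h1 := ind_mem C (rightEdge m k)
  have h2 := ind_mem C (G.diagEdge m (k - (G.b m).toInt))
  have h3 := ind_mem C (leftEdge (m + 1) k)
  have h4 := ind_mem C (G.diagEdge (m + 1) (k - (G.b (m + 1)).toInt))
  have h5 := G.rightDeg_nonneg C m k
  have h6 := G.leftDeg_nonneg C (m + 1) k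
  constructor
  · rintro ⟨e, he, h | h⟩
    · exact absurd h (fst_ne_odd (hC he) m k)
    · rcases (snd_eq_iff (hC he)).1 h with rfl | ⟨ha, rfl⟩ | rfl | ⟨ha, rfl⟩
      · have := ind_of_mem he
        have : 1 ≤ G.rightDeg C m k := by rw [rightDeg]; split_ifs <;> omega
        omega
      · have := ind_of_mem he
        have : 1 ≤ G.rightDeg C m k := by rw [rightDeg, if_pos ha]; omega
        omega
      · have := ind_of_mem he
        have : 1 ≤ G.leftDeg C (m + 1) k := by rw [leftDeg]; split_ifs <;> omega
        omega
      · have := ind_of_mem he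
        have : 1 ≤ G.leftDeg C (m + 1) k := by rw [leftDeg, if_pos ha]; omega
        omega
  · intro h
    obtain h | h | h | h : ind C (rightEdge m k) = 1 ∨
        (G.a m = .R ∧ ind C (G.diagEdge m (k - (G.b m).toInt)) = 1) ∨
        ind C (leftEdge (m + 1) k) = 1 ∨
        (G.a (m + 1) = .L ∧ ind C (G.diagEdge (m + 1) (k - (G.b (m + 1)).toInt)) = 1) := by
      rw [rightDeg, leftDeg] at h
      split_ifs at h with c1 c2
      all_goals simp only [true_and, false_and, *]
      all_goals omega
    · exact ⟨_, ind_eq_one.1 h, Or.inr rfl⟩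
    · have he := ind_eq_one.1 h.2
      exact ⟨_, he, Or.inr ((snd_eq_iff (hC he)).2 (Or.inr (Or.inl ⟨h.1, rfl⟩)))⟩
    · have he := ind_eq_one.1 h
      exact ⟨_, he, Or.inr ((snd_eq_iff (hC he)).2 (Or.inr (Or.inr (Or.inl rfl))))⟩
    · have he := ind_eq_one.1 h.2
      exact ⟨_, he, Or.inr ((snd_eq_iff (hC he)).2 (Or.inr (Or.inr (Or.inr ⟨h.1, rfl⟩))))⟩

/-- Every edge has one even and one odd endpoint, so matchings are described by linear inequalities
between indicators, in a form suited to integer arithmetic. -/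
theorem isMatching_iff {C : Set RYEdge} (hC : C ⊆ G.allEdges) : RYIsMatching C ↔
    (∀ m k, G.evenDeg C m k ≤ 1) ∧ ∀ m k, G.rightDeg C m k + G.leftDeg C (m + 1) k ≤ 1 := by
  constructor
  · intro h
    refine ⟨fun m k => ?_, fun m k => ?_⟩
    · have h1 := ind_mem C (leftEdge m k)
      have h2 := ind_mem C (rightEdge m k)
      have h3 := ind_mem C (G.diagEdge m k)
      have n1 : ¬ (ind C (leftEdge m k) = 1 ∧ ind C (rightEdge m k) = 1) := fun ⟨p, q⟩ =>
        leftEdge_ne_rightEdge _ _ _ _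
          (h _ (ind_eq_one.1 p) _ (ind_eq_one.1 q) (2 * m, k) (Or.inl rfl) (Or.inl rfl))
      have n2 : ¬ (ind C (leftEdge m k) = 1 ∧ ind C (G.diagEdge m k) = 1) := fun ⟨p, q⟩ =>
        leftEdge_ne_diagEdge _ _ _ _
          (h _ (ind_eq_one.1 p) _ (ind_eq_one.1 q) (2 * m, k) (Or.inl rfl) (Or.inl rfl))
      have n3 : ¬ (ind C (rightEdge m k) = 1 ∧ ind C (G.diagEdge m k) = 1) := fun ⟨p, q⟩ =>
        rightEdge_ne_diagEdge _ _ _ _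
          (h _ (ind_eq_one.1 p) _ (ind_eq_one.1 q) (2 * m, k) (Or.inl rfl) (Or.inl rfl))
      rw [evenDeg]
      omega
    · have key : ∀ e f : RYEdge, e ∈ C → f ∈ C → e.2 = (2 * m + 1, k) → f.2 = (2 * m + 1, k) →
          e = f := fun e f he hf h1 h2 => h e he f hf _ (Or.inr h1) (Or.inr h2)
      have e1 : (rightEdge m k).2 = (2 * m + 1, k) := rfl
      have e2 : G.a m = .R → (G.diagEdge m (k - (G.b m).toInt)).2 = (2 * m + 1, k) := fun ha =>
        (snd_eq_iff ⟨_, diagEdge_mem_columnEdges.2 rfl⟩).2 (Or.inr (Or.inl ⟨ha, rfl⟩))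
      have e3 : (leftEdge (m + 1) k).2 = (2 * m + 1, k) :=
        (snd_eq_iff ⟨_, leftEdge_mem_columnEdges.2 rfl⟩ (G := G)).2 (Or.inr (Or.inr (Or.inl rfl)))
      have e4 : G.a (m + 1) = .L →
          (G.diagEdge (m + 1) (k - (G.b (m + 1)).toInt)).2 = (2 * m + 1, k) := fun ha =>
        (snd_eq_iff ⟨_, diagEdge_mem_columnEdges.2 rfl⟩).2 (Or.inr (Or.inr (Or.inr ⟨ha, rfl⟩)))
      have h1 := ind_mem C (rightEdge m k)
      have h2 := ind_mem C (G.diagEdge m (k - (G.b m).toInt))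
      have h3 := ind_mem C (leftEdge (m + 1) k)
      have h4 := ind_mem C (G.diagEdge (m + 1) (k - (G.b (m + 1)).toInt))
      have n13 : ¬ (ind C (rightEdge m k) = 1 ∧ ind C (leftEdge (m + 1) k) = 1) := fun ⟨p, q⟩ =>
        leftEdge_ne_rightEdge _ _ _ _ (key _ _ (ind_eq_one.1 q) (ind_eq_one.1 p) e3 e1)
      have n12 : G.a m = .R → ¬ (ind C (rightEdge m k) = 1 ∧
          ind C (G.diagEdge m (k - (G.b m).toInt)) = 1) := fun ha ⟨p, q⟩ =>
        rightEdge_ne_diagEdge _ _ _ _ (key _ _ (ind_eq_one.1 p) (ind_eq_one.1 q) e1 (e2 ha))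
      have n14 : G.a (m + 1) = .L → ¬ (ind C (rightEdge m k) = 1 ∧
          ind C (G.diagEdge (m + 1) (k - (G.b (m + 1)).toInt)) = 1) := fun ha ⟨p, q⟩ =>
        rightEdge_ne_diagEdge _ _ _ _ (key _ _ (ind_eq_one.1 p) (ind_eq_one.1 q) e1 (e4 ha))
      have n23 : G.a m = .R → ¬ (ind C (leftEdge (m + 1) k) = 1 ∧
          ind C (G.diagEdge m (k - (G.b m).toInt)) = 1) := fun ha ⟨p, q⟩ =>
        leftEdge_ne_diagEdge _ _ _ _ (key _ _ (ind_eq_one.1 p) (ind_eq_one.1 q) e3 (e2 ha))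
      have n34 : G.a (m + 1) = .L → ¬ (ind C (leftEdge (m + 1) k) = 1 ∧
          ind C (G.diagEdge (m + 1) (k - (G.b (m + 1)).toInt)) = 1) := fun ha ⟨p, q⟩ =>
        leftEdge_ne_diagEdge _ _ _ _ (key _ _ (ind_eq_one.1 p) (ind_eq_one.1 q) e3 (e4 ha))
      have n24 : G.a m = .R → G.a (m + 1) = .L →
          ¬ (ind C (G.diagEdge m (k - (G.b m).toInt)) = 1 ∧
          ind C (G.diagEdge (m + 1) (k - (G.b (m + 1)).toInt)) = 1) := fun ha ha' ⟨p, q⟩ => by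
        have := (diagEdge_inj.1
          (key _ _ (ind_eq_one.1 p) (ind_eq_one.1 q) (e2 ha) (e4 ha'))).1
        omega
      rw [rightDeg, leftDeg]
      split_ifs with c1 c2
      · have := n12 c1; have := n14 c2; have := n23 c1; have := n34 c2; have := n24 c1 c2
        omega
      · have := n12 c1; have := n23 c1
        omega
      · rename_i c2
        have := n14 c2; have := n34 c2
        omega
      · omega
  · rintro ⟨hE, hO⟩ e he f hf v hev hfv
    obtain ⟨x, k⟩ := v
    obtain ⟨m, rfl | rfl⟩ : ∃ m, x = 2 * m ∨ x = 2 * m + 1 := ⟨x / 2, by omega⟩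
    · have h1 := hev.resolve_right (snd_ne_even (hC he) m k)
      have h2 := hfv.resolve_right (snd_ne_even (hC hf) m k)
      have hd := hE m k
      have i1 := ind_mem C (leftEdge m k)
      have i2 := ind_mem C (rightEdge m k)
      have i3 := ind_mem C (G.diagEdge m k)
      rw [evenDeg] at hd
      rcases eq_of_fst_eq (hC he) h1 with rfl | rfl | rfl <;>
        rcases eq_of_fst_eq (hC hf) h2 with rfl | rfl | rfl <;>
        first
          | rfl
          | (exfalso; have := ind_of_mem he; have := ind_of_mem hf; omega)
    · have h1 := hev.resolve_left (fst_ne_odd (hC he) m k)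
      have h2 := hfv.resolve_left (fst_ne_odd (hC hf) m k)
      have hd := hO m k
      have i1 := ind_mem C (rightEdge m k)
      have i2 := ind_mem C (G.diagEdge m (k - (G.b m).toInt))
      have i3 := ind_mem C (leftEdge (m + 1) k)
      have i4 := ind_mem C (G.diagEdge (m + 1) (k - (G.b (m + 1)).toInt))
      rw [rightDeg, leftDeg] at hd
      rcases (snd_eq_iff (hC he)).1 h1 with rfl | ⟨ha, rfl⟩ | rfl | ⟨ha, rfl⟩ <;>
        rcases (snd_eq_iff (hC hf)).1 h2 with rfl | ⟨ha', rfl⟩ | rfl | ⟨ha', rfl⟩ <;>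
        first
          | rfl
          | (exfalso
             have := ind_of_mem he
             have := ind_of_mem hf
             split_ifs at hd <;> omega)

end RailYard

/-! ### From height functions to pure coverings -/

namespace RailYard

variable (G : RailYard)

/-- The height function of the vacuum. -/
def vac (k : ℤ) : ℤ := max 0 (-k)

/-- The indicator of a particle at `(2m + 1, k)`. -/
def occ (N : ℤ → ℤ → ℤ) (m k : ℤ) : ℤ := N m k - N m (k + 1)

/-- The indicator of the diagonal edge at `(2m, k)`, in terms of the heights. -/
def diagVal (N : ℤ → ℤ → ℤ) (m k : ℤ) : ℤ :=
  match G.b m with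
  | .plus => N m (k + 1) - N (m - 1) (k + 1)
  | .minus => N (m - 1) k - N m k

/-- The indicator of the left horizontal edge at `(2m, k)`, in terms of the heights. -/
def leftVal (N : ℤ → ℤ → ℤ) (m k : ℤ) : ℤ :=
  1 - occ N (m - 1) k - if G.a m = .L then G.diagVal N m (k - (G.b m).toInt) else 0

/-- The indicator of the right horizontal edge at `(2m, k)`, in terms of the heights. -/
def rightVal (N : ℤ → ℤ → ℤ) (m k : ℤ) : ℤ :=
  occ N m k - if G.a m = .R then G.diagVal N m (k - (G.b m).toInt) else 0

/-- The functions that are the heights of a pure covering. -/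
structure IsHeight (N : ℤ → ℤ → ℤ) : Prop where
  occ_nonneg : ∀ m k, 0 ≤ occ N m k
  occ_le_one : ∀ m k, occ N m k ≤ 1
  diagVal_nonneg : ∀ m ∈ G.cols, ∀ k, 0 ≤ G.diagVal N m k
  leftVal_nonneg : ∀ m ∈ G.cols, ∀ k, 0 ≤ G.leftVal N m k
  rightVal_nonneg : ∀ m ∈ G.cols, ∀ k, 0 ≤ G.rightVal N m k
  finite : {p : ℤ × ℤ | N p.1 p.2 ≠ vac p.2}.Finite
  eq_vac : ∀ m, ¬ (m ∈ G.cols ∧ m + 1 ∈ G.cols) → N m = vac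

/-- The covering with given heights. -/
def covering (N : ℤ → ℤ → ℤ) : Set RYEdge :=
  {e | ∃ m ∈ G.cols, ∃ k, (e = leftEdge m k ∧ G.leftVal N m k = 1) ∨
    (e = rightEdge m k ∧ G.rightVal N m k = 1) ∨ (e = G.diagEdge m k ∧ G.diagVal N m k = 1)}

variable {G}

/-- Conservation of particles: the diagonal edges that arrive at level `k` and leave from it account
for the change of occupation across the column. -/
theorem diagVal_sub (N : ℤ → ℤ → ℤ) (m k : ℤ) :
    G.diagVal N m (k - (G.b m).toInt) - G.diagVal N m k = occ N m k - occ N (m - 1) k := by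
  rw [diagVal, diagVal, occ, occ]
  cases G.b m
  · simp only [Sgn.toInt, sub_add_cancel]; ring
  · simp only [Sgn.toInt, sub_neg_eq_add]; ring

/-- The conservation law makes this independent of the letter of the column. Degree one at even
vertices is thus automatic, and `IsHeight` has to require only nonnegativity of the three values. -/
theorem vals_add (N : ℤ → ℤ → ℤ) (m k : ℤ) :
    G.leftVal N m k + G.rightVal N m k + G.diagVal N m k = 1 := by
  have := G.diagVal_sub N m k
  rw [leftVal, rightVal]
  cases G.a m
  · rw [if_pos rfl, if_neg (by decide)]; linarith
  · rw [if_pos rfl, if_neg (by decide)]; linarith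

theorem occ_vac {N : ℤ → ℤ → ℤ} {m : ℤ} (h : N m = vac) (k : ℤ) :
    occ N m k = if k < 0 then 1 else 0 := by
  rw [occ, h, vac, vac]
  split_ifs <;> omega

theorem leftEdge_mem_covering {N : ℤ → ℤ → ℤ} {m k : ℤ} :
    leftEdge m k ∈ G.covering N ↔ m ∈ G.cols ∧ G.leftVal N m k = 1 := by
  constructor
  · rintro ⟨m', hm', k', ⟨h, h1⟩ | ⟨h, -⟩ | ⟨h, -⟩⟩
    · obtain ⟨rfl, rfl⟩ := leftEdge_inj.1 h
      exact ⟨hm', h1⟩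
    · exact absurd h (leftEdge_ne_rightEdge _ _ _ _)
    · exact absurd h (leftEdge_ne_diagEdge _ _ _ _)
  · rintro ⟨hm, h⟩
    exact ⟨m, hm, k, Or.inl ⟨rfl, h⟩⟩

theorem rightEdge_mem_covering {N : ℤ → ℤ → ℤ} {m k : ℤ} :
    rightEdge m k ∈ G.covering N ↔ m ∈ G.cols ∧ G.rightVal N m k = 1 := by
  constructor
  · rintro ⟨m', hm', k', ⟨h, -⟩ | ⟨h, h1⟩ | ⟨h, -⟩⟩
    · exact absurd h.symm (leftEdge_ne_rightEdge _ _ _ _)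
    · obtain ⟨rfl, rfl⟩ := rightEdge_inj.1 h
      exact ⟨hm', h1⟩
    · exact absurd h (rightEdge_ne_diagEdge _ _ _ _)
  · rintro ⟨hm, h⟩
    exact ⟨m, hm, k, Or.inr (Or.inl ⟨rfl, h⟩)⟩

theorem diagEdge_mem_covering {N : ℤ → ℤ → ℤ} {m k : ℤ} :
    G.diagEdge m k ∈ G.covering N ↔ m ∈ G.cols ∧ G.diagVal N m k = 1 := by
  constructor
  · rintro ⟨m', hm', k', ⟨h, -⟩ | ⟨h, -⟩ | ⟨h, h1⟩⟩
    · exact absurd h.symm (leftEdge_ne_diagEdge _ _ _ _)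
    · exact absurd h.symm (rightEdge_ne_diagEdge _ _ _ _)
    · obtain ⟨rfl, rfl⟩ := diagEdge_inj.1 h
      exact ⟨hm', h1⟩
  · rintro ⟨hm, h⟩
    exact ⟨m, hm, k, Or.inr (Or.inr ⟨rfl, h⟩)⟩

theorem covering_subset (N : ℤ → ℤ → ℤ) : G.covering N ⊆ G.edges := by
  rintro e ⟨m, hm, k, ⟨rfl, -⟩ | ⟨rfl, -⟩ | ⟨rfl, -⟩⟩
  · exact ⟨m, hm, k, Or.inl rfl⟩
  · exact ⟨m, hm, k, Or.inr (Or.inl rfl)⟩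
  · exact ⟨m, hm, k, Or.inr (Or.inr rfl)⟩

theorem mem_cols_of_mem_edges {e : RYEdge} {m : ℤ} (he : e ∈ G.edges) (h : e ∈ G.columnEdges m) :
    m ∈ G.cols := by
  obtain ⟨m', hm', he'⟩ := he
  have h1 := fst_of_mem_columnEdges h
  have h2 := fst_of_mem_columnEdges he'
  obtain rfl : m = m' := by omega
  exact hm'

section NotMem

variable {C : Set RYEdge} (hC : C ⊆ G.edges) {m : ℤ} (hm : m ∉ G.cols)
include hC hm

theorem ind_eq_zero_of_notMem_cols {e : RYEdge} (h : e ∈ G.columnEdges m) : ind C e = 0 :=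
  ind_of_notMem fun he => hm (mem_cols_of_mem_edges (hC he) h)

theorem leftDeg_eq_zero (k : ℤ) : G.leftDeg C m k = 0 := by
  rw [leftDeg, ind_eq_zero_of_notMem_cols hC hm (leftEdge_mem_columnEdges.2 rfl),
    ind_eq_zero_of_notMem_cols hC hm (diagEdge_mem_columnEdges.2 rfl), ite_self, add_zero]

theorem rightDeg_eq_zero (k : ℤ) : G.rightDeg C m k = 0 := by
  rw [rightDeg, ind_eq_zero_of_notMem_cols hC hm (rightEdge_mem_columnEdges.2 rfl),
    ind_eq_zero_of_notMem_cols hC hm (diagEdge_mem_columnEdges.2 rfl), ite_self, add_zero]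

theorem evenDeg_eq_zero (k : ℤ) : G.evenDeg C m k = 0 := by
  rw [evenDeg, ind_eq_zero_of_notMem_cols hC hm (leftEdge_mem_columnEdges.2 rfl),
    ind_eq_zero_of_notMem_cols hC hm (rightEdge_mem_columnEdges.2 rfl),
    ind_eq_zero_of_notMem_cols hC hm (diagEdge_mem_columnEdges.2 rfl), add_zero, add_zero]

end NotMem

namespace IsHeight

variable {N : ℤ → ℤ → ℤ} (hN : G.IsHeight N)
include hN

theorem vals_le {m : ℤ} (hm : m ∈ G.cols) (k : ℤ) : G.leftVal N m k ≤ 1 ∧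
    G.rightVal N m k ≤ 1 ∧ G.diagVal N m k ≤ 1 := by
  have := G.vals_add N m k
  have := hN.diagVal_nonneg m hm k
  have := hN.leftVal_nonneg m hm k
  have := hN.rightVal_nonneg m hm k
  omega

theorem ind_leftEdge {m : ℤ} (hm : m ∈ G.cols) (k : ℤ) :
    ind (G.covering N) (leftEdge m k) = G.leftVal N m k := by
  have h1 := hN.leftVal_nonneg m hm k
  have h2 := hN.vals_le hm k
  by_cases h : G.leftVal N m k = 1
  · rw [h, ind_of_mem (leftEdge_mem_covering.2 ⟨hm, h⟩)]
  · rw [ind_of_notMem fun hc => h (leftEdge_mem_covering.1 hc).2]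
    omega

theorem ind_rightEdge {m : ℤ} (hm : m ∈ G.cols) (k : ℤ) :
    ind (G.covering N) (rightEdge m k) = G.rightVal N m k := by
  have h1 := hN.rightVal_nonneg m hm k
  have h2 := hN.vals_le hm k
  by_cases h : G.rightVal N m k = 1
  · rw [h, ind_of_mem (rightEdge_mem_covering.2 ⟨hm, h⟩)]
  · rw [ind_of_notMem fun hc => h (rightEdge_mem_covering.1 hc).2]
    omega

theorem ind_diagEdge {m : ℤ} (hm : m ∈ G.cols) (k : ℤ) :
    ind (G.covering N) (G.diagEdge m k) = G.diagVal N m k := by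
  have h1 := hN.diagVal_nonneg m hm k
  have h2 := hN.vals_le hm k
  by_cases h : G.diagVal N m k = 1
  · rw [h, ind_of_mem (diagEdge_mem_covering.2 ⟨hm, h⟩)]
  · rw [ind_of_notMem fun hc => h (diagEdge_mem_covering.1 hc).2]
    omega

theorem evenDeg_covering {m : ℤ} (hm : m ∈ G.cols) (k : ℤ) :
    G.evenDeg (G.covering N) m k = 1 := by
  rw [evenDeg, hN.ind_leftEdge hm, hN.ind_rightEdge hm, hN.ind_diagEdge hm, vals_add]

theorem leftDeg_covering {m : ℤ} (hm : m ∈ G.cols) (k : ℤ) :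
    G.leftDeg (G.covering N) m k = 1 - occ N (m - 1) k := by
  rw [leftDeg, hN.ind_leftEdge hm, hN.ind_diagEdge hm, leftVal, sub_add_cancel]

theorem rightDeg_covering {m : ℤ} (hm : m ∈ G.cols) (k : ℤ) :
    G.rightDeg (G.covering N) m k = occ N m k := by
  rw [rightDeg, hN.ind_rightEdge hm, hN.ind_diagEdge hm, rightVal, sub_add_cancel]

theorem isMatching_covering : RYIsMatching (G.covering N) := by
  have hC := G.covering_subset N
  rw [isMatching_iff (hC.trans edges_subset_allEdges)]
  refine ⟨fun m k => ?_, fun m k => ?_⟩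
  · by_cases hm : m ∈ G.cols
    · exact (hN.evenDeg_covering hm k).le
    · rw [evenDeg_eq_zero hC hm]; exact zero_le_one
  · have h1 := hN.occ_nonneg m k
    have h2 := hN.occ_le_one m k
    by_cases hm : m ∈ G.cols
    · rw [hN.rightDeg_covering hm]
      by_cases hm' : m + 1 ∈ G.cols
      · rw [hN.leftDeg_covering hm', add_sub_cancel_right]; omega
      · rw [leftDeg_eq_zero hC hm']; omega
    · rw [rightDeg_eq_zero hC hm]
      by_cases hm' : m + 1 ∈ G.cols
      · rw [hN.leftDeg_covering hm', add_sub_cancel_right]; omega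
      · rw [leftDeg_eq_zero hC hm']; omega

theorem isInnerCovering_covering : G.IsInnerCovering (G.covering N) := by
  have hC := (G.covering_subset N).trans edges_subset_allEdges
  refine ⟨G.covering_subset N, hN.isMatching_covering, fun m k hm => ?_, fun m k hm hm' => ?_⟩
  · rw [covers_even_iff hC, hN.evenDeg_covering hm]
  · rw [covers_odd_iff hC, hN.rightDeg_covering hm, hN.leftDeg_covering hm', add_sub_cancel_right,
      add_sub_cancel]

end IsHeight

/-- The degrees of the restriction of `C` to a strip. -/
theorem ind_inter_stripEdges {C : Set RYEdge} {l r m : ℤ} {e : RYEdge} (he : e ∈ G.columnEdges m) :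
    ind (C ∩ G.stripEdges l r) e = if l ≤ m ∧ m ≤ r then ind C e else 0 := by
  have h : e ∈ G.stripEdges l r ↔ l ≤ m ∧ m ≤ r := by
    constructor
    · rintro ⟨m', hm', he'⟩
      have h1 := fst_of_mem_columnEdges he
      have h2 := fst_of_mem_columnEdges he'
      obtain rfl : m = m' := by omega
      exact hm'
    · exact fun h => ⟨m, h, he⟩
  by_cases hC : e ∈ C
  · by_cases hs : l ≤ m ∧ m ≤ r
    · rw [if_pos hs, ind_of_mem hC, ind_of_mem (show e ∈ C ∩ G.stripEdges l r from ⟨hC, h.2 hs⟩)]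
    · rw [if_neg hs, ind_of_notMem fun hc => hs (h.1 hc.2)]
  · rw [ind_of_notMem hC, ind_of_notMem fun hc => hC hc.1, ite_self]

theorem evenDeg_inter (C : Set RYEdge) (l r m k : ℤ) :
    G.evenDeg (C ∩ G.stripEdges l r) m k = if l ≤ m ∧ m ≤ r then G.evenDeg C m k else 0 := by
  rw [evenDeg, ind_inter_stripEdges (leftEdge_mem_columnEdges.2 rfl),
    ind_inter_stripEdges (rightEdge_mem_columnEdges.2 rfl),
    ind_inter_stripEdges (diagEdge_mem_columnEdges.2 rfl), evenDeg]
  split_ifs <;> ring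

theorem leftDeg_inter (C : Set RYEdge) (l r m k : ℤ) :
    G.leftDeg (C ∩ G.stripEdges l r) m k = if l ≤ m ∧ m ≤ r then G.leftDeg C m k else 0 := by
  rw [leftDeg, ind_inter_stripEdges (leftEdge_mem_columnEdges.2 rfl),
    ind_inter_stripEdges (diagEdge_mem_columnEdges.2 rfl), leftDeg]
  split_ifs <;> ring

theorem rightDeg_inter (C : Set RYEdge) (l r m k : ℤ) :
    G.rightDeg (C ∩ G.stripEdges l r) m k = if l ≤ m ∧ m ≤ r then G.rightDeg C m k else 0 := by
  rw [rightDeg, ind_inter_stripEdges (rightEdge_mem_columnEdges.2 rfl),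
    ind_inter_stripEdges (diagEdge_mem_columnEdges.2 rfl), rightDeg]
  split_ifs <;> ring

theorem IsHeight.exists_heights_window {N : ℤ → ℤ → ℤ} (hN : G.IsHeight N) : ∃ l r, l ≤ r ∧
    l ∈ G.cols ∧ r ∈ G.cols ∧ ∀ m, m < l ∨ r ≤ m → N m = vac := by
  have hS : {m | N m ≠ vac}.Finite := by
    refine (hN.finite.image Prod.fst).subset fun m hm => ?_
    obtain ⟨k, hk⟩ := Function.ne_iff.1 hm
    exact ⟨(m, k), hk, rfl⟩
  have hT : {m | N m ≠ vac} ∪ (· + 1) '' {m | N m ≠ vac} ⊆ G.cols := by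
    have hne : ∀ m, N m ≠ vac → m ∈ G.cols ∧ m + 1 ∈ G.cols := fun m hm => by
      by_contra hc
      exact hm (hN.eq_vac m hc)
    rintro m (hm | ⟨m, hm, rfl⟩)
    · exact (hne m hm).1
    · exact (hne m hm).2
  obtain ⟨l, r, hlr, hl, hr, hw⟩ := exists_window (hS.union (hS.image _)) hT
  refine ⟨l, r, hlr, hl, hr, fun m hm => ?_⟩
  by_contra hc
  have h1 := hw m (Or.inl hc)
  have h2 := hw (m + 1) (Or.inr ⟨m, hc, rfl⟩)
  omega

theorem diagVal_eq_zero {N : ℤ → ℤ → ℤ} {m : ℤ} (h : N (m - 1) = N m) (k : ℤ) :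
    G.diagVal N m k = 0 := by
  rw [diagVal, h]
  cases G.b m <;> simp

theorem IsHeight.finite_diag {N : ℤ → ℤ → ℤ} (hN : G.IsHeight N) :
    {e ∈ G.covering N | ¬ e.IsHorizontal}.Finite := by
  let T := {p : ℤ × ℤ | N p.1 p.2 ≠ vac p.2}
  have hT : T.Finite := hN.finite
  refine (((hT.image fun p => G.diagEdge p.1 p.2).union
    (hT.image fun p => G.diagEdge p.1 (p.2 - 1))).union
    ((hT.image fun p => G.diagEdge (p.1 + 1) p.2).union
    (hT.image fun p => G.diagEdge (p.1 + 1) (p.2 - 1)))).subset ?_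
  rintro e ⟨⟨m, hm, k, ⟨rfl, -⟩ | ⟨rfl, -⟩ | ⟨rfl, h⟩⟩, hh⟩
  · exact absurd (isHorizontal_leftEdge m k) hh
  · exact absurd (isHorizontal_rightEdge m k) hh
  · rw [diagVal] at h
    cases hb : G.b m <;> simp only [hb] at h
    · by_cases h1 : (m, k + 1) ∈ T
      · exact Or.inl (Or.inr ⟨_, h1, by simp⟩)
      · have h2 : (m - 1, k + 1) ∈ T := fun hc => by
          simp only [T, Set.mem_ofPred_eq, not_not] at h1 hc
          omega
        exact Or.inr (Or.inr ⟨_, h2, by simp⟩)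
    · by_cases h1 : (m, k) ∈ T
      · exact Or.inl (Or.inl ⟨_, h1, by simp⟩)
      · have h2 : (m - 1, k) ∈ T := fun hc => by
          simp only [T, Set.mem_ofPred_eq, not_not] at h1 hc
          omega
        exact Or.inr (Or.inl ⟨_, h2, by simp⟩)

theorem IsHeight.isPure_covering {N : ℤ → ℤ → ℤ} (hN : G.IsHeight N) :
    G.IsPure (G.covering N) := by
  obtain ⟨l, r, hlr, hl, hr, hw⟩ := hN.exists_heights_window
  have hC : G.covering N ∩ G.stripEdges l r ⊆ G.allEdges :=
    Set.inter_subset_left.trans ((G.covering_subset N).trans edges_subset_allEdges)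
  -- Beyond the window the heights are those of the vacuum, whose particles sit exactly at the
  -- negative levels; this gives the pure boundary condition on both sides.
  have hleft : ∀ k, RYCovers (G.covering N ∩ G.stripEdges l r) (2 * l - 1, k) ↔ 0 ≤ k := by
    intro k
    rw [show 2 * l - 1 = 2 * (l - 1) + 1 by ring, covers_odd_iff hC, rightDeg_inter,
      leftDeg_inter, if_neg (by omega), if_pos (by omega), sub_add_cancel, zero_add,
      hN.leftDeg_covering hl, occ_vac (hw _ (Or.inl (by omega)))]
    split_ifs <;> omega
  have hright : ∀ k, RYCovers (G.covering N ∩ G.stripEdges l r) (2 * r + 1, k) ↔ k < 0 := by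
    intro k
    rw [covers_odd_iff hC, rightDeg_inter, leftDeg_inter, if_pos (by omega), if_neg (by omega),
      add_zero, hN.rightDeg_covering hr, occ_vac (hw _ (Or.inr le_rfl))]
    split_ifs <;> omega
  refine ⟨hN.isInnerCovering_covering, l, r, hlr, hl, hr, ⟨Set.inter_subset_right,
    fun e he f hf => hN.isMatching_covering e he.1 f hf.1, fun x k h1 h2 => ?_, fun k hk => ?_,
    fun k hk => ?_, fun k hk => ?_, fun k hk => ?_,
    hN.finite_diag.subset fun e he => ⟨he.1.1, he.2⟩⟩, ?_⟩
  · obtain ⟨m, rfl | rfl⟩ : ∃ m, x = 2 * m ∨ x = 2 * m + 1 := ⟨x / 2, by omega⟩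
    · rw [covers_even_iff hC, evenDeg_inter, if_pos (by omega),
        hN.evenDeg_covering (mem_cols_of_le_of_le hl hr (by omega) (by omega))]
    · rw [covers_odd_iff hC, rightDeg_inter, leftDeg_inter, if_pos (by omega), if_pos (by omega),
        hN.rightDeg_covering (mem_cols_of_le_of_le hl hr (by omega) (by omega)),
        hN.leftDeg_covering (mem_cols_of_le_of_le hl hr (by omega) (by omega)),
        add_sub_cancel_right, add_sub_cancel]
  · rw [hleft]; simpa using hk
  · rw [hleft]; simpa using hk
  · rw [hright]; simpa using hk
  · rw [hright]; simpa using hk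
  · rintro e ⟨m, hm, k, ⟨rfl, -⟩ | ⟨rfl, -⟩ | ⟨rfl, h⟩⟩ hs
    · exact isHorizontal_leftEdge m k
    · exact isHorizontal_rightEdge m k
    · have hm' : ¬ (l ≤ m ∧ m ≤ r) := fun hc =>
        hs ⟨m, hc, diagEdge_mem_columnEdges.2 rfl⟩
      rw [diagVal_eq_zero (by rw [hw m (by omega), hw (m - 1) (by omega)])] at h
      exact absurd h zero_ne_one

/-! ### From pure coverings to height functions -/

/-- The change of height at level `k` across the column `m`. -/
noncomputable def heightJump (G : RailYard) (C : Set RYEdge) (m k : ℤ) : ℤ :=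
  match G.b m with
  | .plus => ind C (G.diagEdge m (k - 1))
  | .minus => -ind C (G.diagEdge m k)

namespace IsInnerCovering

variable {C : Set RYEdge} (hC : G.IsInnerCovering C)
include hC

theorem evenDeg_eq_one {m : ℤ} (hm : m ∈ G.cols) (k : ℤ) : G.evenDeg C m k = 1 :=
  have hall := hC.subset.trans edges_subset_allEdges
  le_antisymm (((isMatching_iff hall).1 hC.matching).1 m k)
    ((covers_even_iff hall).1 (hC.covers_even m k hm))

theorem oddDeg_le_one (m k : ℤ) : G.rightDeg C m k + G.leftDeg C (m + 1) k ≤ 1 :=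
  ((isMatching_iff (hC.subset.trans edges_subset_allEdges)).1 hC.matching).2 m k

theorem oddDeg_eq_one {m : ℤ} (hm : m ∈ G.cols) (hm' : m + 1 ∈ G.cols) (k : ℤ) :
    G.rightDeg C m k + G.leftDeg C (m + 1) k = 1 :=
  le_antisymm (hC.oddDeg_le_one m k) ((covers_odd_iff
    (hC.subset.trans edges_subset_allEdges)).1 (hC.covers_odd m k hm hm'))

theorem leftDeg_le_one (m k : ℤ) : G.leftDeg C m k ≤ 1 := by
  have h1 := hC.oddDeg_le_one (m - 1) k
  have h2 := G.rightDeg_nonneg C (m - 1) k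
  rw [sub_add_cancel] at h1
  omega

theorem rightDeg_le_one (m k : ℤ) : G.rightDeg C m k ≤ 1 := by
  have h1 := hC.oddDeg_le_one m k
  have h2 := G.leftDeg_nonneg C (m + 1) k
  omega

/-- The conservation law read on the covering itself: the degree condition at `(2m, k)` trades the
two horizontal edges for `1` minus the diagonal one. -/
theorem heightJump_sub {m : ℤ} (hm : m ∈ G.cols) (k : ℤ) :
    G.heightJump C m k - G.heightJump C m (k + 1) =
      G.leftDeg C m k + G.rightDeg C m k - 1 := by
  have h1 := hC.evenDeg_eq_one hm k
  rw [evenDeg] at h1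
  rw [leftDeg_add_rightDeg, heightJump, heightJump]
  cases G.b m
  · simp only [Sgn.toInt, add_sub_cancel_right]; linarith
  · simp only [Sgn.toInt, sub_neg_eq_add]; linarith

end IsInnerCovering

/-- The heights are integrated from the vacuum on the left, by adding up the jumps across the
columns. The main point is that their occupation numbers are the right degrees of `C` in every
column; the indicators of all edges can then be recovered from them. -/
theorem IsPure.exists_height {C : Set RYEdge} (hC : G.IsPure C) :
    ∃ N, G.IsHeight N ∧ C = G.covering N := by
  obtain ⟨hin, l, r, hlr, hl, hr, hst, hhor⟩ := hC
  have hsub := hin.subset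
  have hsall : C ∩ G.stripEdges l r ⊆ G.allEdges :=
    Set.inter_subset_left.trans (hsub.trans edges_subset_allEdges)
  have hE : ∀ m ∈ G.cols, ∀ k, G.evenDeg C m k = 1 := fun m hm k => hin.evenDeg_eq_one hm k
  have hO' := hin.oddDeg_le_one
  have hO : ∀ m ∈ G.cols, m + 1 ∈ G.cols → ∀ k,
      G.rightDeg C m k + G.leftDeg C (m + 1) k = 1 := fun m hm hm' k => hin.oddDeg_eq_one hm hm' k
  have hd : ∀ m k, ¬ (l ≤ m ∧ m ≤ r) → ind C (G.diagEdge m k) = 0 := fun m k hm => by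
    refine ind_of_notMem fun hc => not_isHorizontal_diagEdge m k (hhor _ hc ?_)
    rintro ⟨m', hm', he⟩
    obtain rfl := diagEdge_mem_columnEdges.1 he
    exact hm hm'
  have hL : ∀ k, G.leftDeg C l k = 1 - if k < 0 then 1 else 0 := fun k => by
    have h1 := hst.left_covered k
    have h2 := hst.left_uncovered k
    rw [show 2 * l - 1 = 2 * (l - 1) + 1 by ring, covers_odd_iff hsall, rightDeg_inter,
      leftDeg_inter, if_neg (by omega), if_pos (by omega), sub_add_cancel, zero_add] at h1 h2
    have h3 := hO' (l - 1) k
    rw [sub_add_cancel] at h3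
    have h4 := G.rightDeg_nonneg C (l - 1) k
    have h5 := G.leftDeg_nonneg C l k
    push_cast at h1 h2
    split_ifs <;> omega
  have hR : ∀ k, G.rightDeg C r k = if k < 0 then 1 else 0 := fun k => by
    have h1 := hst.right_covered k
    have h2 := hst.right_uncovered k
    rw [covers_odd_iff hsall, rightDeg_inter, leftDeg_inter, if_pos (by omega),
      if_neg (by omega), add_zero] at h1 h2
    have h3 := hO' r k
    have h4 := G.leftDeg_nonneg C (r + 1) k
    have h5 := G.rightDeg_nonneg C r k
    push_cast at h1 h2
    split_ifs <;> omega
  have hJ : ∀ m ∈ G.cols, ∀ k, G.heightJump C m k - G.heightJump C m (k + 1) =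
      G.leftDeg C m k + G.rightDeg C m k - 1 := fun m hm k => hin.heightJump_sub hm k
  have hJ0 : ∀ m k, ¬ (l ≤ m ∧ m ≤ r) → G.heightJump C m k = 0 := fun m k hm => by
    rw [heightJump, hd m _ hm, hd m _ hm]
    cases G.b m <;> simp
  let N : ℤ → ℤ → ℤ := fun m k => vac k + ∑ i ∈ Finset.Icc l m, G.heightJump C i k
  have hNl : ∀ m, m < l → N m = vac := fun m hm => by
    funext k
    simp only [N, Finset.Icc_eq_empty (not_le.2 hm), Finset.sum_empty, add_zero]
  have hNs : ∀ m k, N m k = N (m - 1) k + G.heightJump C m k := fun m k => by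
    by_cases hm : l ≤ m
    · have : Finset.Icc l m = insert m (Finset.Icc l (m - 1)) := by
        ext x; simp only [Finset.mem_Icc, Finset.mem_insert]; omega
      simp only [N, this]
      rw [Finset.sum_insert (by simp)]
      ring
    · rw [hNl m (by omega), hNl (m - 1) (by omega), hJ0 m k (by omega), add_zero]
  -- From the left boundary condition to the right: the jumps carry the occupation across a column,
  -- and the odd vertices, covered exactly once, carry it to the next column.
  have hocc1 : ∀ m, l ≤ m → m ∈ G.cols → ∀ k, G.rightDeg C m k = occ N m k := by
    intro m hm
    have hstep : ∀ m ∈ G.cols, ∀ k, occ N m k = occ N (m - 1) k +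
        (G.leftDeg C m k + G.rightDeg C m k - 1) := fun m hm k => by
      rw [← hJ m hm k, occ, occ, hNs m k, hNs m (k + 1)]; ring
    induction m, hm using Int.leInduction with
    | base =>
      intro _ k
      rw [hstep l hl, occ_vac (hNl (l - 1) (by omega)), hL k]; ring
    | succ m hm ih =>
      intro hm' k
      have hmc : m ∈ G.cols := mem_cols_of_le_of_le hl hm' hm (by omega)
      have h1 := ih hmc k
      have h2 := hO m hmc hm' k
      rw [hstep _ hm' k, add_sub_cancel_right]
      omega
  -- To the left of the strip all edges are horizontal, so the vacuum at its left boundary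
  -- propagates unchanged.
  have hocc2 : ∀ m, m ≤ l - 1 → m ∈ G.cols → ∀ k, G.rightDeg C m k = occ N m k := by
    have hdiag : ∀ m ∈ G.cols, m < l → ∀ k, G.leftDeg C m k + G.rightDeg C m k = 1 := by
      intro m hm hml k
      have h1 := hE m hm k
      rw [evenDeg, hd m _ (by omega)] at h1
      rw [leftDeg_add_rightDeg, hd m _ (by omega)]
      exact h1
    intro m hm
    induction m, hm using Int.leInductionDown with
    | base =>
      intro hm k
      have h1 := hO (l - 1) hm (by rwa [sub_add_cancel]) k
      rw [sub_add_cancel] at h1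
      rw [occ_vac (hNl (l - 1) (by omega))]
      have := hL k
      omega
    | pred m hm ih =>
      intro hm' k
      have hmc : m ∈ G.cols := mem_cols_of_le_of_le hm' hl (by omega) (by omega)
      have h1 := hO (m - 1) hm' (by rwa [sub_add_cancel]) k
      rw [sub_add_cancel] at h1
      have h2 := ih hmc k
      have h3 := hdiag m hmc (by omega) k
      rw [occ_vac (hNl (m - 1) (by omega))]
      rw [occ_vac (hNl m (by omega))] at h2
      omega
  have hright : ∀ m ∈ G.cols, ∀ k, G.rightDeg C m k = occ N m k := fun m hm k => by
    rcases lt_or_ge m l with h | h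
    · exact hocc2 m (by omega) hm k
    · exact hocc1 m h hm k
  have hleft : ∀ m ∈ G.cols, ∀ k, G.leftDeg C m k = 1 - occ N (m - 1) k := fun m hm k => by
    have h1 := hJ m hm k
    have h2 := hright m hm k
    rw [occ, hNs m k, hNs m (k + 1)] at h2
    rw [occ]
    omega
  have hdv : ∀ m k, G.diagVal N m k = ind C (G.diagEdge m k) := fun m k => by
    have h1 := hNs m k
    have h2 := hNs m (k + 1)
    rw [heightJump] at h1 h2
    rw [diagVal]
    cases hb : G.b m <;> simp only [hb, add_sub_cancel_right] at h1 h2 ⊢ <;> omega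
  have hrv : ∀ m ∈ G.cols, ∀ k, G.rightVal N m k = ind C (rightEdge m k) := fun m hm k => by
    rw [rightVal, ← hright m hm, hdv, rightDeg, add_sub_cancel_right]
  have hlv : ∀ m ∈ G.cols, ∀ k, G.leftVal N m k = ind C (leftEdge m k) := fun m hm k => by
    rw [leftVal, ← hleft m hm, hdv, leftDeg, add_sub_cancel_right]
  have hfin : {k | ∃ m, G.heightJump C m k ≠ 0}.Finite := by
    refine ((hst.finite_diagonal.image fun e => e.1.2).union
      (hst.finite_diagonal.image fun e => e.1.2 + 1)).subset ?_
    rintro k ⟨m, hm⟩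
    have hm' : l ≤ m ∧ m ≤ r := by
      by_contra hc
      exact hm (hJ0 m k hc)
    rw [heightJump] at hm
    have key : ∀ k', ind C (G.diagEdge m k') ≠ 0 →
        G.diagEdge m k' ∈ {e ∈ C ∩ G.stripEdges l r | ¬ e.IsHorizontal} := fun k' hk' =>
      ⟨⟨by by_contra hc; exact hk' (ind_of_notMem hc),
        m, hm', diagEdge_mem_columnEdges.2 rfl⟩, not_isHorizontal_diagEdge m k'⟩
    cases hb : G.b m <;> simp only [hb] at hm
    · exact Or.inr ⟨_, key _ hm, by simp [diagEdge]⟩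
    · exact Or.inl ⟨_, key _ (by simpa using hm), by simp [diagEdge]⟩
  have hNfin : ∀ m k, N m k ≠ vac k → k ∈ {k | ∃ m, G.heightJump C m k ≠ 0} := by
    intro m k h
    by_contra hc
    simp only [Set.mem_ofPred_eq, not_exists, not_not] at hc
    refine h ?_
    simp only [N]
    rw [Finset.sum_eq_zero fun i _ => hc i, add_zero]
  -- The right boundary condition gives `N r` the increments of the vacuum height. The two agree at
  -- high levels, as there are finitely many diagonal edges in the strip, so they agree everywhere.
  have hNr0 : N r = vac := by
    obtain ⟨A, hA⟩ := hfin.bddAbove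
    obtain ⟨B, hB⟩ := hfin.bddBelow
    have hocc : ∀ k, occ N r k = vac k - vac (k + 1) := fun k => by
      rw [← hright r hr k, hR k, vac, vac]
      split_ifs <;> omega
    have hup : ∀ k, A + 1 ≤ k → N r k = vac k := fun k hk => by
      by_contra hc
      have := hA (hNfin r k hc)
      omega
    funext k
    rcases le_total (A + 1) k with hk | hk
    · exact hup k hk
    · induction k, hk using Int.leInductionDown with
      | base => exact hup _ le_rfl
      | pred k hk ih =>
        have h1 := hocc (k - 1)
        rw [occ, sub_add_cancel] at h1
        linarith
  have hNr : ∀ m, r ≤ m → N m = vac := by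
    intro m hm
    induction m, hm using Int.leInduction with
    | base => exact hNr0
    | succ m hm ih =>
      funext k
      rw [hNs, add_sub_cancel_right, ih, hJ0 _ k (by omega), add_zero]
  have hNout : ∀ m, ¬ (m ∈ G.cols ∧ m + 1 ∈ G.cols) → N m = vac := by
    intro m hm
    by_cases h : m < l ∨ r ≤ m
    · exact h.elim (hNl m) (hNr m)
    · exact absurd ⟨mem_cols_of_le_of_le hl hr (by omega) (by omega),
        mem_cols_of_le_of_le hl hr (by omega) (by omega)⟩ hm
  have hocc01 : ∀ m k, 0 ≤ occ N m k ∧ occ N m k ≤ 1 := by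
    intro m k
    by_cases hm : m ∈ G.cols
    · rw [← hright m hm k]
      have h1 := hO' m k
      have h2 := G.leftDeg_nonneg C (m + 1) k
      exact ⟨G.rightDeg_nonneg C m k, by omega⟩
    · rw [occ_vac (hNout m fun h => hm h.1)]
      split_ifs <;> simp
  have hind : ∀ e, 0 ≤ ind C e := fun e => by
    have := ind_mem C e
    omega
  refine ⟨N, ⟨fun m k => (hocc01 m k).1, fun m k => (hocc01 m k).2,
    fun m _ k => by rw [hdv]; exact hind _, fun m hm k => by rw [hlv m hm]; exact hind _,
    fun m hm k => by rw [hrv m hm]; exact hind _, ?_, hNout⟩, ?_⟩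
  · refine ((Set.finite_Icc l r).prod hfin).subset ?_
    rintro ⟨m, k⟩ h
    simp only [Set.mem_ofPred_eq] at h
    refine ⟨?_, hNfin m k h⟩
    by_contra hc
    have : m < l ∨ r ≤ m := by
      simp only [Set.mem_Icc] at hc
      omega
    exact h (congrFun (this.elim (hNl m) (hNr m)) k)
  · ext e
    constructor
    · intro he
      obtain ⟨m, hm, k, rfl | rfl | rfl⟩ := hsub he
      · exact leftEdge_mem_covering.2 ⟨hm, by rw [hlv m hm]; exact ind_of_mem he⟩
      · exact rightEdge_mem_covering.2 ⟨hm, by rw [hrv m hm]; exact ind_of_mem he⟩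
      · exact diagEdge_mem_covering.2 ⟨hm, by rw [hdv]; exact ind_of_mem he⟩
    · rintro ⟨m, hm, k, ⟨rfl, h⟩ | ⟨rfl, h⟩ | ⟨rfl, h⟩⟩
      · rw [hlv m hm] at h; exact ind_eq_one.1 h
      · rw [hrv m hm] at h; exact ind_eq_one.1 h
      · rw [hdv] at h; exact ind_eq_one.1 h

/-- The diagonal edges determine the change of height across each column, and the heights on the far
left are those of the vacuum. -/
theorem IsHeight.covering_injective {N N' : ℤ → ℤ → ℤ} (hN : G.IsHeight N) (hN' : G.IsHeight N')
    (h : G.covering N = G.covering N') : N = N' := by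
  have hstep : ∀ m, N (m - 1) = N' (m - 1) → N m = N' m := by
    intro m hm
    by_cases hc : m ∈ G.cols
    · have key : ∀ k, G.diagVal N m k = G.diagVal N' m k := fun k => by
        rw [← hN.ind_diagEdge hc, ← hN'.ind_diagEdge hc, h]
      funext k
      have h1 := key k
      have h2 := key (k - 1)
      rw [diagVal, diagVal] at h1 h2
      cases hb : G.b m <;> simp only [hb, hm, sub_add_cancel] at h1 h2 <;> omega
    · rw [hN.eq_vac m fun h => hc h.1, hN'.eq_vac m fun h => hc h.1]
  obtain ⟨l, r, -, -, -, hw⟩ := hN.exists_heights_window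
  obtain ⟨l', r', -, -, -, hw'⟩ := hN'.exists_heights_window
  funext m
  by_cases hm : m < min l l'
  · rw [hw m (by omega), hw' m (by omega)]
  · have hm' : min l l' - 1 ≤ m := by omega
    clear hm
    induction m, hm' using Int.leInduction with
    | base => rw [hw _ (by omega), hw' _ (by omega)]
    | succ m hm ih => exact hstep _ (by rw [add_sub_cancel_right]; exact ih)

end RailYard

/-! ### Removal of a corner and its effect on interlacing -/

namespace YoungDiagram

/-- Removal of a corner from a diagram. -/
theorem exists_erase {x : YoungDiagram} {i j : ℕ} (h : (i, j) ∈ x) (h1 : (i + 1, j) ∉ x)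
    (h2 : (i, j + 1) ∉ x) : ∃ y : YoungDiagram, (∀ c, c ∈ y ↔ c ∈ x ∧ c ≠ (i, j)) ∧
      y.card + 1 = x.card ∧
      ∀ k, y.height k = x.height k - if k = (j : ℤ) - i then 1 else 0 := by
  have hlow : IsLowerSet (↑(x.cells.erase (i, j)) : Set (ℕ × ℕ)) := by
    rintro ⟨p, q⟩ ⟨p', q'⟩ ⟨hp, hq⟩ hc
    simp only [Finset.coe_erase, Set.mem_sdiff, Finset.mem_coe, mem_cells, Set.mem_singleton_iff,
      Prod.mk.injEq] at hc ⊢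
    simp only at hp hq
    refine ⟨x.up_left_mem hp hq hc.1, ?_⟩
    rintro ⟨rfl, rfl⟩
    obtain h3 | h3 | h3 : (p = p' ∧ q = q') ∨ p' + 1 ≤ p ∨ q' + 1 ≤ q := by omega
    · exact hc.2 h3
    · exact h1 (x.up_left_mem h3 hq hc.1)
    · exact h2 (x.up_left_mem hp h3 hc.1)
  refine ⟨⟨_, hlow⟩, fun c => ?_, ?_, fun k => ?_⟩
  · rw [mem_mk, Finset.mem_erase, mem_cells, and_comm]
  · exact Finset.card_erase_add_one ((mem_cells _).2 h)
  · rw [height, height, add_sub_assoc]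
    congr 1
    simp only
    rw [Finset.filter_erase]
    split_ifs with hk
    · have : (i, j) ∈ x.cells.filter fun c => (c.2 : ℤ) - c.1 = k :=
        Finset.mem_filter.2 ⟨(mem_cells _).2 h, hk.symm⟩
      have := Finset.card_erase_add_one this
      omega
    · rw [Finset.erase_eq_of_notMem, sub_zero]
      exact fun hc => hk (Finset.mem_filter.1 hc).2.symm

theorem finite_height_ne (x : YoungDiagram) : {k | x.height k ≠ RailYard.vac k}.Finite := by
  refine ((Finset.finite_toSet x.cells).image fun c => (c.2 : ℤ) - c.1).subset fun k hk => ?_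
  by_contra hc
  refine hk ?_
  rw [height, RailYard.vac, Finset.filter_false_of_mem, Finset.card_empty, Nat.cast_zero, add_zero]
  exact fun c hc' hk' => hc ⟨c, hc', hk'⟩

end YoungDiagram

namespace LR

theorem Interlace.erase_upper {a : LR} {x y z : YoungDiagram} {c : ℕ × ℕ}
    (hy : ∀ d, d ∈ y ↔ d ∈ x ∧ d ≠ c) (h : a.Interlace z x) (hc : c ∉ z) : a.Interlace z y := by
  have hle : z ≤ y := fun d hd => (hy d).2 ⟨h.le hd, fun he => hc (he ▸ hd)⟩
  cases a
  · exact ⟨hle, fun i j hd => h.2 i j ((hy _).1 hd).1⟩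
  · exact ⟨hle, fun i j hd => h.2 i j ((hy _).1 hd).1⟩

theorem Interlace.erase_lower {a : LR} {x y z : YoungDiagram} {i j : ℕ}
    (hy : ∀ d, d ∈ y ↔ d ∈ x ∧ d ≠ (i, j)) (h : a.Interlace x z) (h1 : (i + 1, j) ∉ z)
    (h2 : (i, j + 1) ∉ z) : a.Interlace y z := by
  have hle : y ≤ z := fun d hd => h.le ((hy d).1 hd).1
  cases a
  · refine ⟨hle, fun p q hd => (hy _).2 ⟨h.2 p q hd, ?_⟩⟩
    rintro ⟨⟩
    exact h1 hd
  · refine ⟨hle, fun p q hd => (hy _).2 ⟨h.2 p q hd, ?_⟩⟩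
    rintro ⟨⟩
    exact h2 hd

end LR

/-! ### Pure coverings as interlacing sequences; removable cells -/

namespace RailYard

open YoungDiagram

variable {G : RailYard}

/-- The heights of a sequence of diagrams. -/
def heights (Λ : ℤ → YoungDiagram) (m k : ℤ) : ℤ := (Λ m).height k

theorem heights_eq_vac {Λ : ℤ → YoungDiagram} {m : ℤ} (h : Λ m = ⊥) : heights Λ m = vac := by
  funext k
  rw [heights, h, height_bot, vac]

/-- Nonnegativity of the diagonal value is the inclusion of diagrams, and that of the horizontal
value on the side of the diagonal edges is the strip condition. The other horizontal value is
nonnegative for any diagrams, because heights have slope `0` or `-1`. -/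
theorem step_iff_vals_nonneg {Λ : ℤ → YoungDiagram} {m : ℤ} :
    (G.b m).Step (G.a m) (Λ (m - 1)) (Λ m) ↔ ∀ k, 0 ≤ G.diagVal (heights Λ) m k ∧
      0 ≤ G.leftVal (heights Λ) m k ∧ 0 ≤ G.rightVal (heights Λ) m k := by
  have p1 := (Λ m).height_succ_le
  have p2 := (Λ m).height_le_succ
  have q1 := (Λ (m - 1)).height_succ_le
  have q2 := (Λ (m - 1)).height_le_succ
  simp only [leftVal, rightVal, diagVal, occ, heights]
  cases G.b m <;> cases G.a m <;>
    simp only [Sgn.Step, LR.interlace_L_iff_height, LR.interlace_R_iff_height, Sgn.toInt, if_true,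
      reduceCtorEq, if_false, sub_add_cancel, sub_neg_eq_add] <;>
    constructor <;> intro h k <;> have h0 := h k <;> have h1 := h (k + 1) <;>
    have h2 := h (k - 1) <;> simp only [sub_add_cancel] at h0 h1 h2 <;>
    have := p1 k <;> have := p2 k <;> have := q1 k <;> have := q2 k <;> omega

theorem IsState.isHeight {Λ : ℤ → YoungDiagram} (h : G.IsState Λ) : G.IsHeight (heights Λ) := by
  have hstep := fun m hm => step_iff_vals_nonneg.1 (h.step m hm)
  refine ⟨fun m k => ?_, fun m k => ?_, fun m hm k => (hstep m hm k).1,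
    fun m hm k => (hstep m hm k).2.1, fun m hm k => (hstep m hm k).2.2, ?_,
    fun m hm => heights_eq_vac (h.eq_bot m hm)⟩
  · have := (Λ m).height_succ_le k
    rw [occ, heights, heights]; omega
  · have := (Λ m).height_le_succ k
    rw [occ, heights, heights]; omega
  · refine (h.finite.biUnion (t := fun m => Prod.mk m '' {k | (Λ m).height k ≠ vac k})
      fun m _ => (Λ m).finite_height_ne.image _).subset ?_
    rintro ⟨m, k⟩ hmk
    simp only [Set.mem_iUnion]
    exact ⟨m, fun hc => hmk (congrFun (heights_eq_vac hc) k), k, hmk, rfl⟩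

theorem IsHeight.exists_state {N : ℤ → ℤ → ℤ} (h : G.IsHeight N) :
    ∃ Λ, G.IsState Λ ∧ heights Λ = N := by
  have hex : ∀ m, ∃ x : YoungDiagram, x.height = N m := fun m => by
    refine exists_height_eq (fun k => ?_) (fun k => ?_) ?_
    · have := h.occ_nonneg m k
      rw [occ] at this; omega
    · have := h.occ_le_one m k
      rw [occ] at this; omega
    · exact Set.Finite.of_injOn (f := fun k => (m, k)) (t := {p : ℤ × ℤ | N p.1 p.2 ≠ vac p.2})
        (fun k hk => hk) (fun _ _ _ _ h => (Prod.ext_iff.1 h).2) h.finite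
  choose Λ hΛ using hex
  have hheights : heights Λ = N := funext hΛ
  have hbot : ∀ m, N m = vac → Λ m = ⊥ := fun m hm => height_injective (by
    rw [hΛ, hm]
    funext k
    rw [height_bot, vac])
  refine ⟨Λ, ⟨?_, fun m hm => hbot m (h.eq_vac m hm), fun m hm => ?_⟩, hheights⟩
  · refine (h.finite.image Prod.fst).subset fun m hm => ?_
    obtain ⟨k, hk⟩ := Function.ne_iff.1 (mt (hbot m) hm)
    exact ⟨(m, k), hk, rfl⟩
  · rw [step_iff_vals_nonneg, hheights]
    exact fun k => ⟨h.diagVal_nonneg m hm k, h.leftVal_nonneg m hm k, h.rightVal_nonneg m hm k⟩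

theorem heights_injective : Function.Injective heights := fun _ _ h =>
  funext fun m => height_injective (congrFun h m)

/-- Pure coverings correspond to states. -/
theorem exists_stateEquiv (G : RailYard) : ∃ e : {C : Set RYEdge // G.IsPure C} ≃ {Λ // G.IsState Λ},
    ∀ C, C.1 = G.covering (heights (e C).1) := by
  let f : {Λ // G.IsState Λ} → {C : Set RYEdge // G.IsPure C} := fun Λ =>
    ⟨G.covering (heights Λ.1), Λ.2.isHeight.isPure_covering⟩
  have hf : Function.Bijective f := by
    constructor
    · rintro ⟨Λ, hΛ⟩ ⟨Λ', hΛ'⟩ h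
      exact Subtype.ext (heights_injective
        (hΛ.isHeight.covering_injective hΛ'.isHeight (congrArg Subtype.val h)))
    · rintro ⟨C, hC⟩
      obtain ⟨N, hN, rfl⟩ := hC.exists_height
      obtain ⟨Λ, hΛ, rfl⟩ := hN.exists_state
      exact ⟨⟨Λ, hΛ⟩, rfl⟩
  refine ⟨(Equiv.ofBijective f hf).symm, fun C => ?_⟩
  exact (congrArg Subtype.val ((Equiv.ofBijective f hf).apply_symm_apply C)).symm

theorem stateSize_update {Λ : ℤ → YoungDiagram} (h : {m | Λ m ≠ ⊥}.Finite) {m : ℤ}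
    {y : YoungDiagram} (hy : y.card + 1 = (Λ m).card) :
    stateSize (Function.update Λ m y) + 1 = stateSize Λ := by
  have hm : m ∈ h.toFinset := by
    rw [Set.Finite.mem_toFinset]
    intro hc
    rw [hc, card_bot] at hy
    omega
  rw [stateSize, stateSize, finsum_eq_sum_of_support_subset (s := h.toFinset),
    finsum_eq_sum_of_support_subset (s := h.toFinset), ← Finset.add_sum_erase _ _ hm,
    ← Finset.add_sum_erase _ (fun m => (Λ m).card) hm, Function.update_self, ← hy,
    Finset.sum_congr rfl fun i hi => by rw [Function.update_of_ne (Finset.ne_of_mem_erase hi)]]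
  · ring
  · intro i hi
    rw [Set.Finite.coe_toFinset]
    intro hc
    exact hi (by simp only [hc, card_bot])
  · intro i hi
    rw [Set.Finite.coe_toFinset]
    intro hc
    by_cases him : i = m
    · subst him
      rw [Set.Finite.mem_toFinset] at hm
      exact hm hc
    · exact hi (by simp only [Function.update_of_ne him, hc, card_bot])

/-- Every nontrivial state has a removable cell. -/
theorem IsState.exists_removal {Λ : ℤ → YoungDiagram} (hΛ : G.IsState Λ) {m₀ : ℤ}
    (h0 : Λ m₀ ≠ ⊥) : ∃ Λ' m κ, G.IsState Λ' ∧ stateSize Λ' + 1 = stateSize Λ ∧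
      m ∈ G.cols ∧ m + 1 ∈ G.cols ∧
      ∀ m' k, heights Λ' m' k = heights Λ m' k - if m' = m ∧ k = κ then 1 else 0 := by
  obtain ⟨l, hl⟩ := hΛ.finite.bddBelow
  -- The cell to remove maximizes `2 (i + j) - s m`, where `s` is the partial sum of signs. Its
  -- removal can be blocked by `(i + 1, j)` or `(i, j + 1)` in the same diagram or in a larger
  -- neighbour, or by `(i, j)` in a smaller neighbour. Such a cell would raise the value by `2`, by
  -- `2 - 1` or by `1`, respectively, against maximality.
  let s : ℤ → ℤ := fun m => ∑ i ∈ Finset.Icc l m, (G.b i).toInt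
  have hs : ∀ m, l ≤ m → s m = s (m - 1) + (G.b m).toInt := fun m hm => by
    have : Finset.Icc l m = insert m (Finset.Icc l (m - 1)) := by
      ext x; simp only [Finset.mem_Icc, Finset.mem_insert]; omega
    simp only [s, this]
    rw [Finset.sum_insert (by simp)]
    ring
  let S : Set (ℤ × (ℕ × ℕ)) := {p | p.2 ∈ Λ p.1}
  have hS : S.Finite := by
    refine (hΛ.finite.biUnion (t := fun m => Prod.mk m '' ((Λ m).cells : Set (ℕ × ℕ)))
      fun m _ => (Finset.finite_toSet _).image _).subset ?_
    rintro ⟨m, c⟩ hc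
    simp only [Set.mem_iUnion]
    refine ⟨m, fun hb => ?_, c, hc, rfl⟩
    simp only [S, Set.mem_ofPred_eq, hb] at hc
    exact notMem_bot _ hc
  have hSne : S.Nonempty := by
    by_contra hc
    refine h0 (le_bot_iff.1 fun c hc' => ?_)
    exact absurd ⟨(m₀, c), hc'⟩ hc
  obtain ⟨⟨m, i, j⟩, hmem, hmax⟩ := Set.exists_max_image S
    (fun p => 2 * ((p.2.1 : ℤ) + p.2.2) - s p.1) hS hSne
  have hmax' : ∀ m' i' j', (i', j') ∈ Λ m' →
      2 * ((i' : ℤ) + j') - s m' ≤ 2 * ((i : ℤ) + j) - s m :=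
    fun m' i' j' h => hmax (m', i', j') h
  have hmem' : (i, j) ∈ Λ m := hmem
  have hne : ∀ m' c, c ∈ Λ m' → l ≤ m' := fun m' c hc => hl fun hb => by
    rw [hb] at hc; exact notMem_bot _ hc
  have hlm := hne m _ hmem'
  have hcol : m ∈ G.cols ∧ m + 1 ∈ G.cols := by
    by_contra hc
    rw [hΛ.eq_bot m hc] at hmem'
    exact notMem_bot _ hmem'
  obtain ⟨y, hy, hcard, hheight⟩ := exists_erase hmem'
    (fun h => by have := hmax' _ _ _ h; push_cast at this; omega)
    (fun h => by have := hmax' _ _ _ h; push_cast at this; omega)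
  have hsm := hs m hlm
  have hsm' := hs (m + 1) (by omega)
  rw [add_sub_cancel_right] at hsm'
  refine ⟨Function.update Λ m y, m, (j : ℤ) - i, ⟨?_, fun m' hm' => ?_, fun m' hm' => ?_⟩,
    stateSize_update hΛ.finite hcard, hcol.1, hcol.2, fun m' k => ?_⟩
  · refine (hΛ.finite.insert m).subset fun m' hm' => ?_
    by_cases h : m' = m
    · exact Or.inl h
    · refine Or.inr ?_
      rw [Set.mem_ofPred_eq, Function.update_of_ne h] at hm'
      exact hm'
  · rw [Function.update_of_ne, hΛ.eq_bot m' hm']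
    rintro rfl
    exact hm' hcol
  · have hst := hΛ.step m' hm'
    by_cases h : m' = m
    · subst h
      rw [Function.update_self, Function.update_of_ne (by omega)]
      cases hb : G.b m' with
      | plus =>
        rw [hb] at hst hsm
        simp only [Sgn.toInt] at hsm
        refine LR.Interlace.erase_upper hy hst fun hc => ?_
        have := hmax' _ _ _ hc
        omega
      | minus =>
        rw [hb] at hst hsm
        simp only [Sgn.toInt] at hsm
        refine LR.Interlace.erase_lower hy hst (fun hc => ?_) (fun hc => ?_) <;>
          · have := hmax' _ _ _ hc
            push_cast at this
            omega
    · by_cases h' : m' = m + 1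
      · subst h'
        rw [add_sub_cancel_right] at hst ⊢
        rw [Function.update_self, Function.update_of_ne (by omega)]
        cases hb : G.b (m + 1) with
        | plus =>
          rw [hb] at hst hsm'
          simp only [Sgn.toInt] at hsm'
          refine LR.Interlace.erase_lower hy hst (fun hc => ?_) (fun hc => ?_) <;>
            · have := hmax' _ _ _ hc
              push_cast at this
              omega
        | minus =>
          rw [hb] at hst hsm'
          simp only [Sgn.toInt] at hsm'
          refine LR.Interlace.erase_upper hy hst fun hc => ?_
          have := hmax' _ _ _ hc
          omega
      · rwa [Function.update_of_ne h, Function.update_of_ne (by omega)]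
  · rw [heights, heights]
    by_cases h : m' = m
    · subst h
      rw [Function.update_self, hheight]
      simp
    · rw [Function.update_of_ne h, if_neg fun hc => h hc.1, sub_zero]

end RailYard

/-! ### Faces and the effect of a flip on heights -/

namespace RailYard

variable {G : RailYard}

theorem halfFace_right (m k : ℤ) : G.halfFace m (2 * m + 1) k =
    match G.a m, G.b m with
    | .L, .plus => {rightEdge m k, G.diagEdge m k, leftEdge m (k + 1), rightEdge m (k + 1)}
    | .L, .minus => {rightEdge m k, leftEdge m k, G.diagEdge m (k + 1), rightEdge m (k + 1)}
    | .R, .plus => {rightEdge m k, G.diagEdge m k}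
    | .R, .minus => {G.diagEdge m (k + 1), rightEdge m (k + 1)} := by
  have h : 4 * m - (2 * m + 1) = 2 * m - 1 := by ring
  have h' : 2 * m - 1 ≠ 2 * m + 1 := by omega
  rw [halfFace]
  cases ha : G.a m <;> cases hb : G.b m <;>
    simp [diagEnd, diagEdge, leftEdge, rightEdge, ha, hb, h, h', Sgn.toInt]

theorem halfFace_left (m k : ℤ) : G.halfFace m (2 * m - 1) k =
    match G.a m, G.b m with
    | .R, .plus => {leftEdge m k, G.diagEdge m k, rightEdge m (k + 1), leftEdge m (k + 1)}
    | .R, .minus => {leftEdge m k, rightEdge m k, G.diagEdge m (k + 1), leftEdge m (k + 1)}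
    | .L, .plus => {leftEdge m k, G.diagEdge m k}
    | .L, .minus => {G.diagEdge m (k + 1), leftEdge m (k + 1)} := by
  have h : 4 * m - (2 * m - 1) = 2 * m + 1 := by ring
  have h' : 2 * m + 1 ≠ 2 * m - 1 := by omega
  rw [halfFace]
  cases ha : G.a m <;> cases hb : G.b m <;>
    simp [diagEnd, diagEdge, leftEdge, rightEdge, ha, hb, h, h', Sgn.toInt]

theorem face_eq (m k : ℤ) : G.face m k =
    G.halfFace m (2 * m + 1) k ∪ G.halfFace (m + 1) (2 * (m + 1) - 1) k := by
  rw [face, show 2 * (m + 1) - 1 = 2 * m + 1 by ring]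

theorem leftEdge_mem_face {m k i j : ℤ} : leftEdge i j ∈ G.face m k ↔
    (i = m ∧ G.a m = .L ∧ (G.b m = .plus ∧ j = k + 1 ∨ G.b m = .minus ∧ j = k)) ∨
    (i = m + 1 ∧ (G.a (m + 1) = .R ∧ (j = k ∨ j = k + 1) ∨ G.a (m + 1) = .L ∧
      (G.b (m + 1) = .plus ∧ j = k ∨ G.b (m + 1) = .minus ∧ j = k + 1))) := by
  rw [face_eq, Finset.mem_union, halfFace_right, halfFace_left]
  refine or_congr ?_ ?_
  · cases ha : G.a m <;> cases hb : G.b m <;>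
      simp [leftEdge_ne_rightEdge, leftEdge_ne_diagEdge, leftEdge_inj]
  · cases ha : G.a (m + 1) <;> cases hb : G.b (m + 1) <;>
      simp [leftEdge_ne_rightEdge, leftEdge_ne_diagEdge, leftEdge_inj] <;> tauto

theorem rightEdge_mem_face {m k i j : ℤ} : rightEdge i j ∈ G.face m k ↔
    (i = m ∧ (G.a m = .L ∧ (j = k ∨ j = k + 1) ∨ G.a m = .R ∧
      (G.b m = .plus ∧ j = k ∨ G.b m = .minus ∧ j = k + 1))) ∨
    (i = m + 1 ∧ G.a (m + 1) = .R ∧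
      (G.b (m + 1) = .plus ∧ j = k + 1 ∨ G.b (m + 1) = .minus ∧ j = k)) := by
  rw [face_eq, Finset.mem_union, halfFace_right, halfFace_left]
  refine or_congr ?_ ?_
  · cases ha : G.a m <;> cases hb : G.b m <;>
      simp [(leftEdge_ne_rightEdge _ _ _ _).symm, rightEdge_ne_diagEdge, rightEdge_inj] <;> tauto
  · cases ha : G.a (m + 1) <;> cases hb : G.b (m + 1) <;>
      simp [(leftEdge_ne_rightEdge _ _ _ _).symm, rightEdge_ne_diagEdge, rightEdge_inj]

/-- For either letter, each of the two columns of a face contributes exactly one diagonal edge, the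
one that joins the levels `k` and `k + 1`. -/
theorem diagEdge_mem_face {m k i j : ℤ} : G.diagEdge i j ∈ G.face m k ↔
    (i = m ∨ i = m + 1) ∧ (G.b i = .plus ∧ j = k ∨ G.b i = .minus ∧ j = k + 1) := by
  rw [face_eq, Finset.mem_union, halfFace_right, halfFace_left, or_and_right]
  refine or_congr ?_ ?_
  · by_cases hi : i = m
    · subst hi
      cases ha : G.a i <;> cases hb : G.b i <;>
        simp [(leftEdge_ne_diagEdge _ _ _ _).symm, (rightEdge_ne_diagEdge _ _ _ _).symm,
          diagEdge_inj]
    · cases ha : G.a m <;> cases hb : G.b m <;>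
        simp [(leftEdge_ne_diagEdge _ _ _ _).symm, (rightEdge_ne_diagEdge _ _ _ _).symm,
          diagEdge_inj, hi]
  · by_cases hi : i = m + 1
    · subst hi
      cases ha : G.a (m + 1) <;> cases hb : G.b (m + 1) <;>
        simp [(leftEdge_ne_diagEdge _ _ _ _).symm, (rightEdge_ne_diagEdge _ _ _ _).symm,
          diagEdge_inj]
    · cases ha : G.a (m + 1) <;> cases hb : G.b (m + 1) <;>
        simp [(leftEdge_ne_diagEdge _ _ _ _).symm, (rightEdge_ne_diagEdge _ _ _ _).symm,
          diagEdge_inj, hi]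

/-- The effect of a flip on the indicator of an edge. -/
theorem ind_flip (C : Set RYEdge) (F : Finset RYEdge) (e : RYEdge) :
    e ∈ F ∧ ind ((C \ ↑F) ∪ (↑F \ C)) e = 1 - ind C e ∨
      e ∉ F ∧ ind ((C \ ↑F) ∪ (↑F \ C)) e = ind C e := by
  by_cases h1 : e ∈ F <;> by_cases h2 : e ∈ C <;> simp [ind, h1, h2]

/-- For either sign, the diagonal edge of the face in a column is the one that governs the jump at
level `k + 1`, and it is the only one toggled there. -/
theorem heightJump_flip (C : Set RYEdge) (m k i j : ℤ) :
    (((i = m ∨ i = m + 1) ∧ j = k + 1) →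
      G.heightJump ((C \ ↑(G.face m k)) ∪ (↑(G.face m k) \ C)) i j - G.heightJump C i j = 1 ∨
      G.heightJump ((C \ ↑(G.face m k)) ∪ (↑(G.face m k) \ C)) i j - G.heightJump C i j = -1) ∧
    (¬ ((i = m ∨ i = m + 1) ∧ j = k + 1) →
      G.heightJump ((C \ ↑(G.face m k)) ∪ (↑(G.face m k) \ C)) i j = G.heightJump C i j) := by
  rw [heightJump, heightJump]
  have h1 := ind_flip C (G.face m k) (G.diagEdge i (j - 1))
  have h2 := ind_flip C (G.face m k) (G.diagEdge i j)
  have h3 := ind_mem C (G.diagEdge i (j - 1))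
  have h4 := ind_mem C (G.diagEdge i j)
  rw [diagEdge_mem_face] at h1 h2
  cases hb : G.b i <;> simp only [hb, true_and, false_and, or_false, false_or, reduceCtorEq]
    at h1 h2 ⊢ <;> constructor <;> intro h <;> omega

/-- For the letter `R` the face does not reach the abscissa `2m - 1`. For `L` it does so at one
vertex, with two edges there; both are toggled, and as the degree is at most one before and after,
exactly one of them is present each time. -/
theorem leftDeg_flip {C : Set RYEdge} {m k : ℤ} (hC : G.IsInnerCovering C)
    (hC' : G.IsInnerCovering ((C \ ↑(G.face m k)) ∪ (↑(G.face m k) \ C))) (j : ℤ) :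
    G.leftDeg ((C \ ↑(G.face m k)) ∪ (↑(G.face m k) \ C)) m j = G.leftDeg C m j := by
  have h1 := ind_flip C (G.face m k) (leftEdge m j)
  have h2 := ind_flip C (G.face m k) (G.diagEdge m (j - (G.b m).toInt))
  have h3 := ind_mem C (leftEdge m j)
  have h4 := ind_mem C (G.diagEdge m (j - (G.b m).toInt))
  have h5 := hC.leftDeg_le_one m j
  have h6 := hC'.leftDeg_le_one m j
  rw [leftEdge_mem_face] at h1
  rw [diagEdge_mem_face] at h2
  rw [leftDeg] at h5 h6 ⊢
  rw [leftDeg]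
  have hm : m ≠ m + 1 := by omega
  cases ha : G.a m <;> cases hb : G.b m <;>
    simp only [ha, hb, true_and, false_and, and_false, or_false, false_or, reduceCtorEq,
      Sgn.toInt, if_true, if_false, hm, sub_neg_eq_add] at h1 h2 h4 h5 h6 ⊢ <;> omega

theorem rightDeg_flip {C : Set RYEdge} {m k : ℤ} (hC : G.IsInnerCovering C)
    (hC' : G.IsInnerCovering ((C \ ↑(G.face m k)) ∪ (↑(G.face m k) \ C))) (j : ℤ) :
    G.rightDeg ((C \ ↑(G.face m k)) ∪ (↑(G.face m k) \ C)) (m + 1) j =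
      G.rightDeg C (m + 1) j := by
  have h1 := ind_flip C (G.face m k) (rightEdge (m + 1) j)
  have h2 := ind_flip C (G.face m k) (G.diagEdge (m + 1) (j - (G.b (m + 1)).toInt))
  have h3 := ind_mem C (rightEdge (m + 1) j)
  have h4 := ind_mem C (G.diagEdge (m + 1) (j - (G.b (m + 1)).toInt))
  have h5 := hC.rightDeg_le_one (m + 1) j
  have h6 := hC'.rightDeg_le_one (m + 1) j
  rw [rightEdge_mem_face] at h1
  rw [diagEdge_mem_face] at h2
  rw [rightDeg] at h5 h6 ⊢
  rw [rightDeg]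
  have hm : m + 1 ≠ m := by omega
  cases ha : G.a (m + 1) <;> cases hb : G.b (m + 1) <;>
    simp only [ha, hb, true_and, false_and, and_false, or_false, false_or, reduceCtorEq,
      Sgn.toInt, if_true, if_false, hm, sub_neg_eq_add] at h1 h2 h4 h5 h6 ⊢ <;> omega

/-- A flip changes the height at one point, by `1` or `-1`. -/
theorem exists_heightJump_flip {C : Set RYEdge} {m k : ℤ} (hm : m ∈ G.cols) (hm' : m + 1 ∈ G.cols)
    (hC : G.IsInnerCovering C)
    (hC' : G.IsInnerCovering ((C \ ↑(G.face m k)) ∪ (↑(G.face m k) \ C))) :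
    ∃ c : ℤ, (c = 1 ∨ c = -1) ∧ ∀ i j,
      G.heightJump ((C \ ↑(G.face m k)) ∪ (↑(G.face m k) \ C)) i j = G.heightJump C i j +
        ((if (i, j) = (m, k + 1) then c else 0) - if (i, j) = (m + 1, k + 1) then c else 0) := by
  have hJ := heightJump_flip (G := G) C m k
  have hL := leftDeg_flip hC hC' (k + 1)
  have hR := rightDeg_flip hC hC' (k + 1)
  set C' := (C \ ↑(G.face m k)) ∪ (↑(G.face m k) \ C)
  -- The outer degrees and the jumps at level `k + 2` do not change, so the two jumps at level `k +
  -- 1` change as the two degrees at the odd vertex `(2m + 1, k + 1)` do. These add up to `1` before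
  -- and after, so the changes are opposite.
  have e1 := hC.heightJump_sub hm (k + 1)
  have e2 := hC'.heightJump_sub hm (k + 1)
  have e3 := hC.heightJump_sub hm' (k + 1)
  have e4 := hC'.heightJump_sub hm' (k + 1)
  have e5 := hC.oddDeg_eq_one hm hm' (k + 1)
  have e6 := hC'.oddDeg_eq_one hm hm' (k + 1)
  have e7 := (hJ m (k + 1 + 1)).2 (by omega)
  have e8 := (hJ (m + 1) (k + 1 + 1)).2 (by omega)
  refine ⟨G.heightJump C' m (k + 1) - G.heightJump C m (k + 1),
    (hJ m (k + 1)).1 ⟨Or.inl rfl, rfl⟩, fun i j => ?_⟩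
  simp only [Prod.mk.injEq]
  by_cases h : (i = m ∨ i = m + 1) ∧ j = k + 1
  · obtain ⟨rfl | rfl, rfl⟩ := h
    · simp
    · simp; omega
  · rw [(hJ i j).2 h, if_neg (by omega), if_neg (by omega)]; ring

end RailYard

/-! ### The volume and the flip distance -/

namespace RailYard

variable {G : RailYard}

theorem IsPure.isAdmissible {C : Set RYEdge} (hC : G.IsPure C) : G.IsAdmissible C := by
  obtain ⟨h, l, r, h1, h2, h3, h4, h5⟩ := hC
  exact ⟨h, l, r, h1, h2, h3, ⟨0, h4⟩, h5⟩

/-- The volume of a covering relative to the fundamental one, a signed sum over its diagonal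
edges. -/
noncomputable def volume (G : RailYard) (C : Set RYEdge) : ℤ :=
  ∑ᶠ p : ℤ × ℤ, -p.1 * G.heightJump C p.1 p.2

theorem IsAdmissible.finite_heightJump {C : Set RYEdge} (hC : G.IsAdmissible C) :
    {p : ℤ × ℤ | G.heightJump C p.1 p.2 ≠ 0}.Finite := by
  obtain ⟨-, l, r, -, -, -, ⟨n, hst⟩, hhor⟩ := hC
  have hfin : {e ∈ C | ¬ e.IsHorizontal}.Finite := hst.finite_diagonal.subset fun e he =>
    ⟨⟨he.1, by by_contra hc; exact he.2 (hhor e he.1 hc)⟩, he.2⟩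
  refine ((hfin.image fun e => (e.1.1 / 2, e.1.2)).union
    (hfin.image fun e => (e.1.1 / 2, e.1.2 + 1))).subset ?_
  rintro ⟨m, k⟩ hm
  have key : ∀ k', ind C (G.diagEdge m k') ≠ 0 → G.diagEdge m k' ∈ {e ∈ C | ¬ e.IsHorizontal} :=
    fun k' hk' => ⟨by by_contra hc; exact hk' (ind_of_notMem hc), not_isHorizontal_diagEdge m k'⟩
  rw [Set.mem_ofPred_eq, heightJump] at hm
  cases hb : G.b m <;> simp only [hb] at hm
  · exact Or.inr ⟨_, key _ hm, by simp [diagEdge]⟩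
  · exact Or.inl ⟨_, key _ (by simpa using hm), by simp [diagEdge]⟩

theorem IsFundamental.volume_eq_zero {C : Set RYEdge} (hC : G.IsFundamental C) :
    G.volume C = 0 := by
  rw [volume, ← finsum_zero]
  refine finsum_congr fun p => ?_
  have h : ∀ k, ind C (G.diagEdge p.1 k) = 0 := fun k =>
    ind_of_notMem fun hc => not_isHorizontal_diagEdge _ _ (hC.2 _ hc)
  rw [heightJump, h, h]
  cases G.b p.1 <;> simp

/-- The coefficient `-m` in the volume comes from summation by parts: a change of height by `c` at
abscissa `2m + 1` gives the jumps `c` and `-c` in columns `m` and `m + 1`, and `-m * c + (m + 1) * c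
= c`. -/
theorem volume_eq_add {C C' : Set RYEdge} (hC : G.IsAdmissible C) {m k c : ℤ}
    (h : ∀ i j, G.heightJump C' i j = G.heightJump C i j +
      ((if (i, j) = (m, k) then c else 0) - if (i, j) = (m + 1, k) then c else 0)) :
    G.volume C' = G.volume C + c := by
  have h1 : ∀ p : ℤ × ℤ, -p.1 * G.heightJump C' p.1 p.2 = -p.1 * G.heightJump C p.1 p.2 +
      ((if p = (m, k) then -m * c else 0) + if p = (m + 1, k) then (m + 1) * c else 0) := by
    rintro ⟨i, j⟩
    rw [h]
    split_ifs with h1 h2 h2 <;> simp only [Prod.mk.injEq] at h1 h2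
    · omega
    · rw [h1.1]; ring
    · rw [h2.1]; ring
    · ring
  have hfin : ∀ (q : ℤ × ℤ) (d : ℤ),
      (Function.support fun p => if p = q then d else 0).Finite := fun q d =>
    (Set.finite_singleton q).subset fun p hp => by
      by_contra hc
      exact hp (if_neg hc)
  have hsum : ∀ (q : ℤ × ℤ) (d : ℤ), ∑ᶠ p, (if p = q then d else 0) = d := fun q d => by
    rw [finsum_eq_single _ q fun p hp => if_neg hp, if_pos rfl]
  rw [volume, finsum_congr h1, finsum_add_distrib, finsum_add_distrib (hfin _ _) (hfin _ _),
    hsum, hsum, volume]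
  · ring
  · refine hC.finite_heightJump.subset fun p hp hc => hp ?_
    simp only [hc, mul_zero]
  · exact ((hfin _ _).union (hfin _ _)).subset (Function.support_add _ _)

/-- Purity plays no role here. This matters because the flip distance allows paths through all
admissible coverings. -/
theorem volume_of_adj {C C' : Set RYEdge} (h : G.flipGraph.Adj C C') :
    G.volume C' = G.volume C + 1 ∨ G.volume C' = G.volume C - 1 := by
  obtain ⟨h1, h2, m, k, hm, hm', -, rfl⟩ := h
  obtain ⟨c, hc, hJ⟩ := exists_heightJump_flip hm hm' h1.1 h2.1
  have := volume_eq_add h1 hJ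
  omega

theorem volume_sub_le_dist {C C' : Set RYEdge} (h : G.flipGraph.Reachable C C') :
    G.volume C' - G.volume C ≤ G.flipGraph.dist C C' := by
  obtain ⟨w, hw⟩ := h.exists_walk_length_eq_dist
  rw [← hw]
  clear hw h
  induction w with
  | nil => simp
  | cons hadj w ih =>
    have := volume_of_adj hadj
    rw [SimpleGraph.Walk.length_cons]
    push_cast
    omega

/-- Each edge of `F` contributes `1` or `-1` according to whether it belongs to `C`. -/
theorem two_mul_ncard_inter {C : Set RYEdge} {F : Finset RYEdge}
    (h : ∑ e ∈ F, (2 * ind C e - 1) = 0) : 2 * (C ∩ ↑F).ncard = F.card := by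
  classical
  have h1 : C ∩ ↑F = ↑(F.filter (· ∈ C)) := by
    ext e
    simp [and_comm]
  have h2 : ∑ e ∈ F, ind C e = ((F.filter (· ∈ C)).card : ℤ) := by
    simp [ind, Finset.sum_boole]
  rw [h1, Set.ncard_coe_finset]
  rw [Finset.sum_sub_distrib, ← Finset.mul_sum, h2] at h
  simp at h
  omega

theorem sum_face (m k : ℤ) (f : RYEdge → ℤ) : ∑ e ∈ G.face m k, f e =
    ∑ e ∈ G.halfFace m (2 * m + 1) k, f e +
      ∑ e ∈ G.halfFace (m + 1) (2 * (m + 1) - 1) k, f e := by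
  rw [face_eq, Finset.sum_union]
  rw [Finset.disjoint_left, halfFace_right, halfFace_left]
  have h1 : m ≠ m + 1 := by omega
  have h2 : m + 1 ≠ m := by omega
  intro e he he'
  have e1 : e.1.1 = 2 * m := by
    cases ha : G.a m <;> cases hb : G.b m <;> simp only [ha, hb, Finset.mem_insert,
      Finset.mem_singleton] at he <;> rcases he with rfl | rfl | rfl | rfl <;> rfl
  have e2 : e.1.1 = 2 * (m + 1) := by
    cases ha : G.a (m + 1) <;> cases hb : G.b (m + 1) <;> simp only [ha, hb, Finset.mem_insert,
      Finset.mem_singleton] at he' <;> rcases he' with rfl | rfl | rfl | rfl <;> rfl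
  omega

theorem sum_halfFace_right (m k : ℤ) (f : RYEdge → ℤ) : ∑ e ∈ G.halfFace m (2 * m + 1) k, f e =
    match G.a m, G.b m with
    | .L, .plus => f (rightEdge m k) + f (G.diagEdge m k) + f (leftEdge m (k + 1)) +
        f (rightEdge m (k + 1))
    | .L, .minus => f (rightEdge m k) + f (leftEdge m k) + f (G.diagEdge m (k + 1)) +
        f (rightEdge m (k + 1))
    | .R, .plus => f (rightEdge m k) + f (G.diagEdge m k)
    | .R, .minus => f (G.diagEdge m (k + 1)) + f (rightEdge m (k + 1)) := by
  have n1 := fun m k m' k' => (leftEdge_ne_rightEdge m k m' k').symm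
  have n2 := fun m k m' k' => (leftEdge_ne_diagEdge m k m' k' (G := G)).symm
  have n3 := fun m k m' k' => (rightEdge_ne_diagEdge m k m' k' (G := G)).symm
  rw [halfFace_right]
  cases ha : G.a m <;> cases hb : G.b m <;> simp only <;> repeat rw [Finset.sum_insert]
  all_goals simp [leftEdge_ne_rightEdge, leftEdge_ne_diagEdge, rightEdge_ne_diagEdge, n1, n2, n3,
    rightEdge_inj, add_assoc]

theorem sum_halfFace_left (m k : ℤ) (f : RYEdge → ℤ) : ∑ e ∈ G.halfFace m (2 * m - 1) k, f e =
    match G.a m, G.b m with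
    | .R, .plus => f (leftEdge m k) + f (G.diagEdge m k) + f (rightEdge m (k + 1)) +
        f (leftEdge m (k + 1))
    | .R, .minus => f (leftEdge m k) + f (rightEdge m k) + f (G.diagEdge m (k + 1)) +
        f (leftEdge m (k + 1))
    | .L, .plus => f (leftEdge m k) + f (G.diagEdge m k)
    | .L, .minus => f (G.diagEdge m (k + 1)) + f (leftEdge m (k + 1)) := by
  have n1 := fun m k m' k' => (leftEdge_ne_rightEdge m k m' k').symm
  have n2 := fun m k m' k' => (leftEdge_ne_diagEdge m k m' k' (G := G)).symm
  have n3 := fun m k m' k' => (rightEdge_ne_diagEdge m k m' k' (G := G)).symm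
  rw [halfFace_left]
  cases ha : G.a m <;> cases hb : G.b m <;> simp only <;> repeat rw [Finset.sum_insert]
  all_goals simp [leftEdge_ne_rightEdge, leftEdge_ne_diagEdge, rightEdge_ne_diagEdge, n1, n2, n3,
    leftEdge_inj, add_assoc]

theorem IsHeight.heightJump_covering {N : ℤ → ℤ → ℤ} (hN : G.IsHeight N) {i : ℤ}
    (hi : i ∈ G.cols) (j : ℤ) : G.heightJump (G.covering N) i j = N i j - N (i - 1) j := by
  rw [heightJump, hN.ind_diagEdge hi, hN.ind_diagEdge hi, diagVal, diagVal]
  cases G.b i <;> simp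

theorem heightJump_covering_of_notMem (N : ℤ → ℤ → ℤ) {i : ℤ} (hi : i ∉ G.cols) (j : ℤ) :
    G.heightJump (G.covering N) i j = 0 := by
  have h : ∀ k, ind (G.covering N) (G.diagEdge i k) = 0 := fun k =>
    ind_of_notMem fun hc => hi (diagEdge_mem_covering.1 hc).1
  rw [heightJump, h, h]
  cases G.b i <;> simp

section Removal

variable {N N' : ℤ → ℤ → ℤ} {m κ : ℤ}
  (h : ∀ m' k, N' m' k = N m' k - if m' = m ∧ k = κ then 1 else 0)
include h

theorem diagVal_removal (i j : ℤ) : G.diagVal N' i j = G.diagVal N i j +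
    if G.b i = .plus then
      (if i = m + 1 ∧ j + 1 = κ then 1 else 0) - if i = m ∧ j + 1 = κ then 1 else 0
    else (if i = m ∧ j = κ then 1 else 0) - if i = m + 1 ∧ j = κ then 1 else 0 := by
  have hi : i - 1 = m ↔ i = m + 1 := by omega
  rw [diagVal, diagVal]
  cases G.b i <;> simp only [h, hi, if_true, reduceCtorEq, if_false] <;> ring

theorem occ_removal (i j : ℤ) : occ N' i j = occ N i j +
    ((if i = m ∧ j + 1 = κ then 1 else 0) - if i = m ∧ j = κ then 1 else 0) := by
  rw [occ, occ, h, h]; ring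

/-- The indicators of the edges after the removal of one cell. -/
theorem vals_removal (hN : G.IsHeight N) (hN' : G.IsHeight N') {i : ℤ} (hi : i ∈ G.cols) (j : ℤ) :
    (leftEdge i j ∈ G.face m (κ - 1) ∧ G.leftVal N' i j = 1 - G.leftVal N i j ∨
      leftEdge i j ∉ G.face m (κ - 1) ∧ G.leftVal N' i j = G.leftVal N i j) ∧
    (rightEdge i j ∈ G.face m (κ - 1) ∧ G.rightVal N' i j = 1 - G.rightVal N i j ∨
      rightEdge i j ∉ G.face m (κ - 1) ∧ G.rightVal N' i j = G.rightVal N i j) ∧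
    (G.diagEdge i j ∈ G.face m (κ - 1) ∧ G.diagVal N' i j = 1 - G.diagVal N i j ∨
      G.diagEdge i j ∉ G.face m (κ - 1) ∧ G.diagVal N' i j = G.diagVal N i j) := by
  rw [leftEdge_mem_face, rightEdge_mem_face, diagEdge_mem_face]
  -- These bounds confine all values to `0` and `1`, so that a change by `1` or `-1` can only be the
  -- passage to the complementary value.
  have a1 := hN.diagVal_nonneg i hi j
  have a2 := hN.leftVal_nonneg i hi j
  have a3 := hN.rightVal_nonneg i hi j
  have b1 := hN'.diagVal_nonneg i hi j
  have b2 := hN'.leftVal_nonneg i hi j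
  have b3 := hN'.rightVal_nonneg i hi j
  obtain ⟨a4, a5, a6⟩ := hN.vals_le hi j
  obtain ⟨b4, b5, b6⟩ := hN'.vals_le hi j
  have d1 := diagVal_removal (G := G) h i j
  have d2 := diagVal_removal (G := G) h i (j - (G.b i).toInt)
  have o1 := occ_removal h i j
  have o2 := occ_removal h (i - 1) j
  rw [leftVal] at a2 b2 a4 b4 ⊢
  rw [rightVal] at a3 b3 a5 b5 ⊢
  rw [leftVal, rightVal]
  have c1 : i - 1 = m ↔ i = m + 1 := by omega
  have c2 : m ≠ m + 1 := by omega
  have c3 : m + 1 ≠ m := by omega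
  by_cases e1 : i = m
  · subst e1
    cases ha : G.a i <;> cases hb : G.b i <;>
      simp only [ha, hb, c1, c2, true_and, false_and, and_false, or_false, false_or, reduceCtorEq, not_false_eq_true,
        Sgn.toInt, if_true, if_false, sub_neg_eq_add, sub_add_cancel] at * <;>
      split_ifs at * <;> omega
  · by_cases e2 : i = m + 1
    · subst e2
      cases ha : G.a (m + 1) <;> cases hb : G.b (m + 1) <;>
        simp only [ha, hb, c1, c3, true_and, false_and, and_false, or_false, false_or,
          reduceCtorEq, not_false_eq_true, Sgn.toInt, if_true, if_false, sub_neg_eq_add, sub_add_cancel] at * <;>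
        split_ifs at * <;> omega
    · cases hb : G.b i <;>
        simp only [hb, c1, e1, e2, false_and, if_false, sub_zero, add_zero] at d1 d2 o1 o2 ⊢ <;>
        simp [d1, d2, o1, o2]

theorem ind_removal (hN : G.IsHeight N) (hN' : G.IsHeight N') {e : RYEdge} (he : e ∈ G.edges) :
    e ∈ G.face m (κ - 1) ∧ ind (G.covering N') e = 1 - ind (G.covering N) e ∨
      e ∉ G.face m (κ - 1) ∧ ind (G.covering N') e = ind (G.covering N) e := by
  obtain ⟨i, hi, j, rfl | rfl | rfl⟩ := he
  · have := (vals_removal h hN hN' hi j).1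
    rwa [← hN.ind_leftEdge hi, ← hN'.ind_leftEdge hi] at this
  · have := (vals_removal h hN hN' hi j).2.1
    rwa [← hN.ind_rightEdge hi, ← hN'.ind_rightEdge hi] at this
  · have := (vals_removal h hN hN' hi j).2.2
    rwa [← hN.ind_diagEdge hi, ← hN'.ind_diagEdge hi] at this

theorem isFlip_removal (hN : G.IsHeight N) (hN' : G.IsHeight N') (hm : m ∈ G.cols)
    (hm' : m + 1 ∈ G.cols) : G.IsFlip (G.covering N) (G.covering N') := by
  have hface : ∀ e ∈ G.face m (κ - 1), e ∈ G.edges := fun e he => by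
    rw [face_eq, Finset.mem_union, halfFace_right, halfFace_left] at he
    rcases he with he | he
    · refine ⟨m, hm, ?_⟩
      cases ha : G.a m <;> cases hb : G.b m <;> simp only [ha, hb, Finset.mem_insert,
        Finset.mem_singleton] at he <;> rcases he with rfl | rfl | rfl | rfl <;>
        simp [leftEdge_mem_columnEdges, rightEdge_mem_columnEdges, diagEdge_mem_columnEdges]
    · refine ⟨m + 1, hm', ?_⟩
      cases ha : G.a (m + 1) <;> cases hb : G.b (m + 1) <;> simp only [ha, hb,
        Finset.mem_insert, Finset.mem_singleton] at he <;> rcases he with rfl | rfl | rfl | rfl <;>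
        simp [leftEdge_mem_columnEdges, rightEdge_mem_columnEdges, diagEdge_mem_columnEdges]
  refine ⟨m, κ - 1, hm, hm', two_mul_ncard_inter ?_, ?_⟩
  · have h0 : ∀ e ∈ G.face m (κ - 1),
        2 * ind (G.covering N) e - 1 = ind (G.covering N) e - ind (G.covering N') e := by
      intro e he
      rcases ind_removal h hN hN' (hface e he) with h1 | h1
      · rw [h1.2]; ring
      · exact absurd he h1.1
    rw [Finset.sum_congr rfl h0, sum_face, sum_halfFace_right, sum_halfFace_left]
    have d1 := diagVal_removal (G := G) h m
    have d2 := diagVal_removal (G := G) h (m + 1)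
    have o1 := occ_removal h m
    have o2 := occ_removal h (m - 1)
    have o3 := occ_removal h (m + 1)
    have c1 : m - 1 ≠ m := by omega
    have c2 : m ≠ m + 1 := by omega
    have c3 : m + 1 ≠ m := by omega
    simp only [hN.ind_leftEdge hm, hN.ind_leftEdge hm', hN'.ind_leftEdge hm, hN'.ind_leftEdge hm',
      hN.ind_rightEdge hm, hN.ind_rightEdge hm', hN'.ind_rightEdge hm, hN'.ind_rightEdge hm',
      hN.ind_diagEdge hm, hN.ind_diagEdge hm', hN'.ind_diagEdge hm, hN'.ind_diagEdge hm',
      leftVal, rightVal, add_sub_cancel_right, sub_add_cancel, d1, d2, o1, o2, o3, c1, c2, c3,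
      true_and, false_and, if_false, sub_zero, zero_sub, add_zero]
    cases ha : G.a m <;> cases hb : G.b m <;>
      simp [Sgn.toInt] <;>
      cases ha' : G.a (m + 1) <;> cases hb' : G.b (m + 1) <;> simp
  · ext e
    by_cases he : e ∈ G.edges
    · have h1 := ind_flip (G.covering N) (G.face m (κ - 1)) e
      rw [← ind_eq_one, ← ind_eq_one]
      rcases ind_removal h hN hN' he with h2 | h2 <;> rcases h1 with h1 | h1
      · rw [h1.2, h2.2]
      · exact absurd h2.1 h1.1
      · exact absurd h1.1 h2.1
      · rw [h1.2, h2.2]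
    · refine iff_of_false (fun hc => he (covering_subset _ hc)) ?_
      rintro (hc | hc)
      · exact he (covering_subset _ hc.1)
      · exact he (hface _ hc.1)

theorem volume_removal (hN : G.IsHeight N) (hN' : G.IsHeight N') (hm : m ∈ G.cols)
    (hm' : m + 1 ∈ G.cols) : G.volume (G.covering N') = G.volume (G.covering N) + -1 := by
  refine volume_eq_add hN.isPure_covering.isAdmissible (m := m) (k := κ) fun i j => ?_
  have h1 : i - 1 = m ↔ i = m + 1 := by omega
  simp only [Prod.mk.injEq]
  by_cases hi : i ∈ G.cols
  · simp only [hN.heightJump_covering hi, hN'.heightJump_covering hi, h, h1]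
    split_ifs <;> ring
  · have h2 : i ≠ m := fun hc => hi (hc ▸ hm)
    have h3 : i ≠ m + 1 := fun hc => hi (hc ▸ hm')
    simp [heightJump_covering_of_notMem _ hi, h2, h3]

end Removal

theorem isState_bot : G.IsState fun _ => ⊥ := by
  refine ⟨by simp, fun _ _ => rfl, fun m _ => ?_⟩
  exact (isSeq_bot (G := G) (σ := Equiv.refl ℤ) (l := m) (r := m)).2 m le_rfl le_rfl

theorem stateSize_bot : stateSize (fun _ => ⊥) = 0 := by
  simp [stateSize, card_bot]

theorem exists_ne_bot_of_stateSize_ne_zero {Λ : ℤ → YoungDiagram} (h : stateSize Λ ≠ 0) :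
    ∃ m, Λ m ≠ ⊥ := by
  by_contra! hc
  rw [funext hc, stateSize_bot] at h
  exact h rfl

theorem volume_covering_bot : G.volume (G.covering (heights fun _ => ⊥)) = 0 := by
  refine IsFundamental.volume_eq_zero ⟨isState_bot.isHeight.isPure_covering, ?_⟩
  rintro e ⟨m, -, k, ⟨rfl, -⟩ | ⟨rfl, -⟩ | ⟨rfl, h⟩⟩
  · exact isHorizontal_leftEdge m k
  · exact isHorizontal_rightEdge m k
  · rw [diagVal_eq_zero rfl] at h
    exact absurd h zero_ne_one

/-- The descent to the fundamental covering by the removal of cells. -/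
theorem IsState.exists_walk (n : ℕ) : ∀ {Λ : ℤ → YoungDiagram}, G.IsState Λ → stateSize Λ = n →
    G.volume (G.covering (heights Λ)) = n ∧
      ∃ w : G.flipGraph.Walk (G.covering (heights fun _ => ⊥)) (G.covering (heights Λ)),
        w.length = n := by
  induction n with
  | zero =>
    intro Λ hΛ h0
    have hbot : Λ = fun _ => ⊥ := by
      by_contra hc
      obtain ⟨m, hm⟩ := Function.ne_iff.1 hc
      obtain ⟨Λ', -, -, -, h1, -⟩ := hΛ.exists_removal hm
      omega
    subst hbot
    exact ⟨volume_covering_bot, .nil, rfl⟩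
  | succ n ih =>
    intro Λ hΛ hn
    obtain ⟨m₀, hm₀⟩ := exists_ne_bot_of_stateSize_ne_zero (by omega : stateSize Λ ≠ 0)
    obtain ⟨Λ', m, κ, hΛ', hsize, hm, hm', hh⟩ := hΛ.exists_removal hm₀
    obtain ⟨hv, w, hw⟩ := ih hΛ' (by omega)
    have hN := hΛ.isHeight
    have hN' := hΛ'.isHeight
    have hadj : G.flipGraph.Adj (G.covering (heights Λ')) (G.covering (heights Λ)) :=
      ⟨hN'.isPure_covering.isAdmissible, hN.isPure_covering.isAdmissible,
        (isFlip_removal hh hN hN' hm hm').symm⟩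
    refine ⟨?_, w.concat hadj, ?_⟩
    · have := volume_removal hh hN hN' hm hm'
      push_cast
      omega
    · rw [SimpleGraph.Walk.length_concat, hw]

/-- The walk that adds the cells one by one bounds the distance from above, and the volume bounds it
from below by the same number. -/
theorem IsState.dist_eq {Λ : ℤ → YoungDiagram} (hΛ : G.IsState Λ) :
    G.flipGraph.Reachable (G.covering (heights fun _ => ⊥)) (G.covering (heights Λ)) ∧
      G.flipGraph.dist (G.covering (heights fun _ => ⊥)) (G.covering (heights Λ)) =
        stateSize Λ := by
  obtain ⟨hv, w, hw⟩ := hΛ.exists_walk _ rfl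
  have h1 := volume_sub_le_dist w.reachable
  rw [volume_covering_bot, hv] at h1
  have h2 := SimpleGraph.dist_le w
  exact ⟨w.reachable, by omega⟩

/-- Without diagonal edges the volume is zero, and the volume is the length of a walk from the
covering of the empty sequence. -/
theorem IsFundamental.eq_covering {C : Set RYEdge} (hC : G.IsFundamental C) :
    C = G.covering (heights fun _ => ⊥) := by
  obtain ⟨N, hN, rfl⟩ := hC.1.exists_height
  obtain ⟨Λ, hΛ, rfl⟩ := hN.exists_state
  obtain ⟨hv, w, hw⟩ := hΛ.exists_walk _ rfl
  rw [hC.volume_eq_zero] at hv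
  exact (SimpleGraph.Walk.eq_of_length_eq_zero (by omega : w.length = 0)).symm

end RailYard

theorem theorem2 (G : RailYard) (hG : G.FinitenessCondition)
    (C₀ : Set RYEdge) (hC₀ : G.IsFundamental C₀) :
    (∀ C : Set RYEdge, G.IsPure C → G.flipGraph.Reachable C₀ C) ∧
    Summable (fun C : {C : Set RYEdge // G.IsPure C} => G.qWeight C₀ C) ∧
    HasProd (fun p : G.hooks => G.hookFactor p.1.1 p.1.2) (G.qPartitionFunction C₀) := by
  obtain ⟨e, he⟩ := G.exists_stateEquiv
  obtain rfl := hC₀.eq_covering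
  have hdist := fun C => (e C).2.dist_eq
  simp only [← he] at hdist
  obtain ⟨Z, hsum, hprod⟩ := hG.hasSum_and_hasProd e fun C => (hdist C).2
  refine ⟨fun C hC => (hdist ⟨C, hC⟩).1, hsum.summable, ?_⟩
  rw [← hsum.tsum_eq] at hprod
  exact hprod
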